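/- Let $\kappa,G>0$ (with $G$ Newton's constant) and let $\bar g=-\kappa^2\rho^2d\tau^2+d\rho^2+dy^2+dz^2$ be the Rindler metric on the wedge $\rho>0$ with coordinates $(\tau,\rho,y,z)\in\mathbb R^4$. All fields and maps are $C^\infty$ up to the horizon $\rho=0$ (restrictions of smooth functions on $\mathbb R^4$), and $O(\rho^2)$ refers to $\rho\to0^+$ at fixed $(\tau,y,z)$. Indices $A,B,C$ run over $y,z$ and repeated indices are summed. **Fields.** $\mathcal B$ is the set of vector fields $U=(W(y,z),0,R^y(y,z),R^z(y,z))+O(\rho^2)$ (all four components) with smooth $W,R^A$. We write $U_1$ for such a field with $R=0$ (supertranslation) and $U_2$ for one with $W=0$ (superrotation). A field is called *bounded* if it vanishes for $(y,z)$ outside a bounded set. **Diffeomorphisms.** $\gamma_{(\tilde P,\tilde G)}$ denotes any diffeomorphism of $\{\rho\ge0\}$, smooth up to the horizon, with $\gamma=(\tau+\tilde P(y,z),\rho,\tilde G^y(y,z),\tilde G^z(y,z))+O(\rho^2)$, where $\tilde P,\tilde G$ are smooth. Put $L_{1A}=-\kappa^2\partial_A\tilde P$, $L_{AB}=\partial_A\tilde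 G^C\partial_B\tilde G^C$, $L=L_{yy}L_{zz}-L_{yz}^2$. The metrics considered are the pullbacks $g=\gamma_{(\tilde P,\tilde G)}^*\bar g$. **Charges.** For a metric $g$, a symmetric tensor $h_{\mu\nu}$ and a vector field $\xi$, let $$Q^{\mu\nu}[\xi]=-\tfrac{\sqrt{-g}}{8\pi G}\nabla^{[\mu}\xi^{\nu]},\qquad \Theta^\mu(g,h)=\tfrac{\sqrt{-g}}{16\pi G}\big(g^{\mu\alpha}\nabla^\beta h_{\alpha\beta}-g^{\alpha\beta}\nabla^\mu h_{\alpha\beta}\big),$$ $$S^{\mu\nu}(g,h,\pounds_\xi g)=\tfrac{\sqrt{-g}}{8\pi G}\Big(-\tfrac12h^\alpha{}_\alpha\nabla^{[\mu}\xi^{\nu]}+h^{\alpha[\mu}\nabla_\alpha\xi^{\nu]}-\nabla^{[\mu}h^{\nu]\alpha}\xi_\alpha+\xi^{[\mu}\nabla_\alpha h^{\nu]\alpha}-\xi^{[\mu}\nabla^{\nu]}h^\alpha{}_\alpha\Big).$$ For an antisymmetric $F^{\mu\nu}$, $\oint F=\lim_{\rho\to0^+}\int_{\mathbb R^2}F^{\tau\rho}\,dy\,dz$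 at fixed $\tau$, where the integrals are required to converge and the limit to exist. Along a smooth path of metrics $g(\lambda)=\gamma_\lambda^*\bar g$, $\gamma_\lambda=\gamma_{(\tilde P_\lambda,\tilde G_\lambda)}$ (smooth jointly in $\lambda$ and the point), the variation of the charge of $\xi$ is $\oint\big(\partial_\lambda Q^{\mu\nu}[\xi]+2\xi^{[\mu}\Theta^{\nu]}(g,\partial_\lambda g)\big)$. **Claims.** 1. $\mathcal B$ is a vector space closed under the Lie bracket: if $U,U'$ have leading data $(W,R),(W',R')$, then $[U,U']\in\mathcal B$ has data $\big(R^A\partial_AW'-R'^A\partial_AW,\;R^B\partial_BR'^A-R'^B\partial_BR^A\big)$, and it is bounded if $U,U'$ are. In particular $[U_1,U_2]=(-R^A\partial_AW,0,0,0)+O(\rho^2)$. 2. Every finite product of maps $\exp[\eta]$, with $\eta\in\mathcal B$ having a smooth global flow on $\{\rho\ge0\}$ (smooth jointly in flow time and point, up to the horizon), is a $\gamma_{(\tilde P,\tilde G)}$ for some $\tilde P,\tilde G$. 3. The integrability condition $\oint\xi^{[\mu}\partial_\alpha S^{\nu]\alpha}(g,\pounds_\eta g,\pounds_\chi g)=0$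 holds at every $\tau$, for every $g=\gamma_{(\tilde P,\tilde G)}^*\bar g$ and all $\xi,\eta,\chi\in\mathcal B$ with $\xi$ bounded. 4. There are functions $H[\xi]$ of the metric (for bounded $\xi\in\mathcal B$) whose derivative along every smooth path of such metrics exists and equals the variation of the charge of $\xi$, at every $\tau$; the integral of this variation over $[a,b]$ is $H[\xi]|_{g(b)}-H[\xi]|_{g(a)}$. At $g=\gamma_{(\tilde P,\tilde G)}^*\bar g$ they are $$H[U_1]=\frac{\kappa}{8\pi G}\int\sqrt L\,W\,dy\,dz,\qquad H[U_2]=-\frac{1}{8\pi G\kappa}\int\sqrt L\,R^AL_{1A}\,dy\,dz,$$ and the sum of the two expressions for a general bounded $\xi\in\mathcal B$ with data $(W,R)$. These values are also the integrals over $0<\lambda\le1$ of the variation along any smooth path of metrics $\gamma_{(\lambda\tilde P,\lambda\tilde G)}^*\bar g$. -/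

import Mathlib

open Set Filter Topology MeasureTheory Asymptotics
open scoped ContDiff

noncomputable section

namespace Rindler

/-! ### Coordinates

Index `0, 1, 2, 3` stands for `τ, ρ, y, z`. The spacetime is the wedge `ρ > 0`, with the horizon at
`ρ = 0`. Objects that are smooth up to the horizon are represented by smooth functions on the whole
of `ℝ⁴`; only their values at `ρ ≥ 0` matter. -/

/-- Spacetime coordinates `(τ, ρ, y, z)`. -/
abbrev Pt := Fin 4 → ℝ

/-- Coordinates `(y, z)` along the horizon. -/
abbrev Plane := Fin 2 → ℝ

/-- The point with coordinates `(τ, ρ, u)`. -/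
def pt (τ ρ : ℝ) (u : Plane) : Pt := ![τ, ρ, u 0, u 1]

/-- The `(y, z)` coordinates of a point. -/
def horiz (x : Pt) : Plane := ![x 2, x 3]

/-- The wedge together with its horizon, `ρ ≥ 0`. -/
def closedWedge : Set Pt := {x | 0 ≤ x 1}

/-- The partial derivative `∂_μ f` on spacetime. -/
def pd (μ : Fin 4) (f : Pt → ℝ) (x : Pt) : ℝ := fderiv ℝ f x (Pi.single μ 1)

/-- The partial derivative `∂_A f` on the plane. -/
def pdPlane (A : Fin 2) (f : Plane → ℝ) (u : Plane) : ℝ := fderiv ℝ f u (Pi.single A 1)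

/-- `f = O(ρ²)` as `ρ → 0`, at fixed `τ, y, z`. -/
def IsBigORhoSq (f : Pt → ℝ) : Prop :=
  ∀ (τ : ℝ) (u : Plane), (fun ρ : ℝ => f (pt τ ρ u)) =O[𝓝[>] 0] (fun ρ : ℝ => ρ ^ 2)

/-! ### The algebra of vector fields -/

/-- The field `(W(y,z), 0, R^y(y,z), R^z(y,z))`. -/
def leadField (W : Plane → ℝ) (R : Plane → Plane) (x : Pt) : Pt :=
  ![W (horiz x), 0, R (horiz x) 0, R (horiz x) 1]

/-- `U = (W + O(ρ²), O(ρ²), R^y + O(ρ²), R^z + O(ρ²))`, smooth up to the horizon. -/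
structure InAlgebra (W : Plane → ℝ) (R : Plane → Plane) (U : Pt → Pt) : Prop where
  smooth_W : ContDiff ℝ ∞ W
  smooth_R : ContDiff ℝ ∞ R
  smooth : ContDiff ℝ ∞ U
  asymp : ∀ μ, IsBigORhoSq (fun x => U x μ - leadField W R x μ)

/-- The algebra `ℬ`. -/
def algebraB : Set (Pt → Pt) := {U | ∃ W R, InAlgebra W R U}

/-- `U` vanishes in the wedge outside a bounded region of the `(y, z)` plane. -/
def HorizontallyBounded (U : Pt → Pt) : Prop :=
  ∃ r : ℝ, ∀ x : Pt, 0 < x 1 → (r < |x 2| ∨ r < |x 3|) → U x = 0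

/-- The derivative `R^A ∂_A f` of a function on the plane. -/
def along (R : Plane → Plane) (f : Plane → ℝ) (u : Plane) : ℝ := ∑ A, R u A * pdPlane A f u

/-! ### Diffeomorphisms -/

/-- The map `(τ + P(y,z), ρ, G^y(y,z), G^z(y,z))`. -/
def leadMap (P : Plane → ℝ) (G : Plane → Plane) (x : Pt) : Pt :=
  ![x 0 + P (horiz x), x 1, G (horiz x) 0, G (horiz x) 1]

/-- `γ` is a diffeomorphism of the wedge, smooth up to and including the horizon, with
`γ = (τ + P, ρ, G^y, G^z) + O(ρ²)` in all components. -/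
structure IsGamma (P : Plane → ℝ) (G : Plane → Plane) (γ : Pt → Pt) : Prop where
  smooth_P : ContDiff ℝ ∞ P
  smooth_G : ContDiff ℝ ∞ G
  smooth : ContDiff ℝ ∞ γ
  bijOn : BijOn γ closedWedge closedWedge
  regular : ∀ x ∈ closedWedge, (Matrix.of fun α μ => pd μ (fun x' => γ x' α) x).det ≠ 0
  asymp : ∀ μ, IsBigORhoSq (fun x => γ x μ - leadMap P G x μ)

/-- `φ` is the flow of `η`, `φ_l = exp[l η]`, on the wedge with its horizon. -/
structure IsFlow (η : Pt → Pt) (φ : ℝ → Pt → Pt) : Prop where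
  smooth : ContDiff ℝ ∞ (fun p : ℝ × Pt => φ p.1 p.2)
  mapsTo : ∀ l, MapsTo (φ l) closedWedge closedWedge
  init : ∀ x ∈ closedWedge, φ 0 x = x
  ode : ∀ x ∈ closedWedge, ∀ l, HasDerivAt (fun l' => φ l' x) (η (φ l x)) l

/-- Finite products of the maps `exp[η]` with `η ∈ ℬ`. -/
inductive Generated : (Pt → Pt) → Prop
  | exp (η : Pt → Pt) (φ : ℝ → Pt → Pt) : η ∈ algebraB → IsFlow η φ → Generated (φ 1)
  | comp (γ₁ γ₂ : Pt → Pt) : Generated γ₁ → Generated γ₂ → Generated (γ₁ ∘ γ₂)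

/-! ### Metrics and their geometry, in coordinates -/

/-- A field of `4 × 4` matrices: the components of a `(0,2)` tensor field. -/
abbrev Tensor2 := Pt → Matrix (Fin 4) (Fin 4) ℝ

/-- The Rindler metric `-κ²ρ² dτ² + dρ² + dy² + dz²`. -/
def background (κ : ℝ) : Tensor2 := fun x =>
  Matrix.diagonal ![-(κ ^ 2 * x 1 ^ 2), 1, 1, 1]

/-- The pullback `∂_μ γ^α ∂_ν γ^β g_{αβ}(γ(x))`. -/
def pullback (γ : Pt → Pt) (g : Tensor2) : Tensor2 := fun x => Matrix.of fun μ ν =>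
  ∑ α, ∑ β, pd μ (fun x' => γ x' α) x * pd ν (fun x' => γ x' β) x * g (γ x) α β

/-- The metric `γ^* ḡ`. -/
def metricOf (κ : ℝ) (γ : Pt → Pt) : Tensor2 := pullback γ (background κ)

/-- The Lie derivative `£_η g`. -/
def lieDeriv (η : Pt → Pt) (g : Tensor2) : Tensor2 := fun x => Matrix.of fun μ ν =>
  ∑ α, (η x α * pd α (fun x' => g x' μ ν) x
    + g x α ν * pd μ (fun x' => η x' α) x + g x μ α * pd ν (fun x' => η x' α) x)

/-- The inverse metric `g^{μν}`. -/
def ginv (g : Tensor2) (x : Pt) (μ ν : Fin 4) : ℝ := (g x)⁻¹ μ ν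

/-- `√(-det g)`. -/
def sqrtNegDet (g : Tensor2) (x : Pt) : ℝ := Real.sqrt (-(g x).det)

/-- The Christoffel symbol `Γ^α_{μν}`. -/
def christoffel (g : Tensor2) (x : Pt) (α μ ν : Fin 4) : ℝ :=
  (1 / 2) * ∑ β, ginv g x α β *
    (pd μ (fun x' => g x' β ν) x + pd ν (fun x' => g x' β μ) x - pd β (fun x' => g x' μ ν) x)

/-- `∇_μ ξ^ν`. -/
def covVec (g : Tensor2) (ξ : Pt → Pt) (x : Pt) (μ ν : Fin 4) : ℝ :=
  pd μ (fun x' => ξ x' ν) x + ∑ α, christoffel g x ν μ α * ξ x α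

/-- `∇^μ ξ^ν`. -/
def covVecUp (g : Tensor2) (ξ : Pt → Pt) (x : Pt) (μ ν : Fin 4) : ℝ :=
  ∑ α, ginv g x μ α * covVec g ξ x α ν

/-- `∇_α h_{μν}`. -/
def covTen (g h : Tensor2) (x : Pt) (α μ ν : Fin 4) : ℝ :=
  pd α (fun x' => h x' μ ν) x
    - ∑ β, (christoffel g x β α μ * h x β ν + christoffel g x β α ν * h x μ β)

/-- The trace `h^α_α`. -/
def trace (g h : Tensor2) (x : Pt) : ℝ := ∑ α, ∑ β, ginv g x α β * h x α β

/-- `h^{μν}`. -/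
def raised (g h : Tensor2) (x : Pt) (μ ν : Fin 4) : ℝ :=
  ∑ α, ∑ β, ginv g x μ α * ginv g x ν β * h x α β

/-- `∇^σ h^{μν}`. -/
def covTenUp (g h : Tensor2) (x : Pt) (σ μ ν : Fin 4) : ℝ :=
  ∑ τ, ∑ α, ∑ β, ginv g x σ τ * ginv g x μ α * ginv g x ν β * covTen g h x τ α β

/-- The divergence `∇_α h^{μα}`. -/
def divTen (g h : Tensor2) (x : Pt) (μ : Fin 4) : ℝ :=
  ∑ α, ∑ β, ∑ σ, ginv g x μ β * ginv g x α σ * covTen g h x α β σ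

/-- The gradient `∇^μ h^α_α = g^{αβ} ∇^μ h_{αβ}` of the trace. -/
def gradTrace (g h : Tensor2) (x : Pt) (μ : Fin 4) : ℝ :=
  ∑ σ, ∑ α, ∑ β, ginv g x μ σ * ginv g x α β * covTen g h x σ α β

/-- The antisymmetric part `T^{[μν]}`. -/
def antisym (T : Fin 4 → Fin 4 → ℝ) (μ ν : Fin 4) : ℝ := (T μ ν - T ν μ) / 2

/-! ### The covariant phase space of Einstein gravity; `Gn` is Newton's constant -/

/-- The pre-symplectic potential
`Θ^μ(g, h) = √-g / (16πG) (g^{μα} ∇^β h_{αβ} - g^{αβ} ∇^μ h_{αβ})`. -/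
def theta (Gn : ℝ) (g h : Tensor2) (x : Pt) (μ : Fin 4) : ℝ :=
  sqrtNegDet g x / (16 * Real.pi * Gn) * (divTen g h x μ - gradTrace g h x μ)

/-- The Noether 2-form `Q^{μν}[ξ] = -√-g / (8πG) ∇^{[μ} ξ^{ν]}`. -/
def noether (Gn : ℝ) (g : Tensor2) (ξ : Pt → Pt) (x : Pt) (μ ν : Fin 4) : ℝ :=
  -(sqrtNegDet g x / (8 * Real.pi * Gn)) * antisym (covVecUp g ξ x) μ ν

/-- The 2-form `S^{μν}(g, h, £_ξ g)`:
`√-g / (8πG) (-½ h^α_α ∇^{[μ} ξ^{ν]} + h^{α[μ} ∇_α ξ^{ν]} - ∇^{[μ} h^{ν]α} ξ_α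
  + ξ^{[μ} ∇_α h^{ν]α} - ξ^{[μ} ∇^{ν]} h^α_α)`. -/
def sForm (Gn : ℝ) (g h : Tensor2) (ξ : Pt → Pt) (x : Pt) (μ ν : Fin 4) : ℝ :=
  sqrtNegDet g x / (8 * Real.pi * Gn) * antisym (fun μ ν =>
    -(1 / 2) * trace g h x * covVecUp g ξ x μ ν
    + (∑ α, raised g h x α μ * covVec g ξ x α ν)
    - (∑ α, ∑ β, covTenUp g h x μ ν α * g x α β * ξ x β)
    + ξ x μ * divTen g h x ν
    - ξ x μ * gradTrace g h x ν) μ ν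

/-- The integrand `ξ^{[μ} ∂_α S^{ν]α}(g, h, £_χ g)` of the integrability condition. -/
def obstruction (Gn : ℝ) (g h : Tensor2) (ξ χ : Pt → Pt) (x : Pt) : Fin 4 → Fin 4 → ℝ :=
  antisym fun μ ν => ξ x μ * ∑ α, pd α (fun x' => sForm Gn g h χ x' ν α) x

/-- The variation `∂_l g_{μν}` along a path of metrics. -/
def pathDeriv (g : ℝ → Tensor2) (l : ℝ) : Tensor2 := fun x => Matrix.of fun μ ν =>
  deriv (fun l' => g l' x μ ν) l

/-- The integrand `∂_l Q^{μν}[ξ] + 2 ξ^{[μ} Θ^{ν]}(g, ∂_l g)` of the variation of the charge of `ξ`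
along a path of metrics. -/
def chargeVariation (Gn : ℝ) (g : ℝ → Tensor2) (ξ : Pt → Pt) (l : ℝ) (x : Pt) (μ ν : Fin 4) : ℝ :=
  deriv (fun l' => noether Gn (g l') ξ x μ ν) l
    + 2 * antisym (fun μ ν => ξ x μ * theta Gn (g l) (pathDeriv g l) x ν) μ ν

/-- The density in `dy dz` of `(d²x)_{μν} F^{μν}` on a surface of constant `τ` and `ρ`, where
`(d²x)_{μν} = ε_{μναβ} / (2! 2!) dx^α ∧ dx^β`. It is `F^{τρ}` for antisymmetric `F`. -/
def surfaceDensity (F : Fin 4 → Fin 4 → ℝ) : ℝ := (F 0 1 - F 1 0) / 2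

/-- The integral of `F` over the horizon section at time `τ` exists and has the value `c`: it is
the limit `ρ → 0` of convergent integrals over the surfaces of constant `τ` and `ρ`. -/
def HasHorizonIntegral (F : Pt → Fin 4 → Fin 4 → ℝ) (τ c : ℝ) : Prop :=
  (∀ᶠ ρ in 𝓝[>] (0 : ℝ), Integrable (fun u : Plane => surfaceDensity (F (pt τ ρ u)))) ∧
  Tendsto (fun ρ : ℝ => ∫ u : Plane, surfaceDensity (F (pt τ ρ u))) (𝓝[>] 0) (𝓝 c)

/-- A family `γ_l`, `l ∈ I`, of diffeomorphisms `γ_{(P_l, G_l)}` depending smoothly on `l`. -/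
structure IsGammaPath (I : Set ℝ) (P : ℝ → Plane → ℝ) (G : ℝ → Plane → Plane)
    (γ : ℝ → Pt → Pt) : Prop where
  isOpen : IsOpen I
  smooth : ContDiffOn ℝ ∞ (fun p : ℝ × Pt => γ p.1 p.2) (I ×ˢ univ)
  mem : ∀ l ∈ I, IsGamma (P l) (G l) (γ l)

/-! ### The charges -/

/-- `L_{1A} = -κ² ∂_A P`. -/
def L1 (κ : ℝ) (P : Plane → ℝ) (A : Fin 2) (u : Plane) : ℝ := -κ ^ 2 * pdPlane A P u

/-- `L_{AB} = ∂_A G^y ∂_B G^y + ∂_A G^z ∂_B G^z`. -/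
def L2 (G : Plane → Plane) (A B : Fin 2) (u : Plane) : ℝ :=
  ∑ C, pdPlane A (fun u' => G u' C) u * pdPlane B (fun u' => G u' C) u

/-- `L = L_{yy} L_{zz} - L_{yz}²`. -/
def Ldet (G : Plane → Plane) (u : Plane) : ℝ := L2 G 0 0 u * L2 G 1 1 u - L2 G 0 1 u ^ 2

/-- The supertranslation charge `κ / (8πG) ∫ √L W dy dz`. -/
def chargeST (κ Gn : ℝ) (G : Plane → Plane) (W : Plane → ℝ) : ℝ :=
  κ / (8 * Real.pi * Gn) * ∫ u : Plane, Real.sqrt (Ldet G u) * W u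

/-- The superrotation charge `-1 / (8πGκ) ∫ √L R^A L_{1A} dy dz`. -/
def chargeSR (κ Gn : ℝ) (P : Plane → ℝ) (G : Plane → Plane) (R : Plane → Plane) : ℝ :=
  -(1 / (8 * Real.pi * Gn * κ)) *
    ∫ u : Plane, Real.sqrt (Ldet G u) * ∑ A, R u A * L1 κ P A u

end Rindler

end

open Rindler

/-! Every metric `γ^*ḡ` is flat. The functions `T = γ^ρ sinh(κ γ^τ)`, `X = γ^ρ cosh(κ γ^τ)`, `γ^y`,
`γ^z` are inertial coordinates, and their differentials form a closed orthonormal coframe. In such a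
frame the Levi-Civita derivative is the plain derivative of components (`IsFrame.covVec_eq`,
`IsFrame.covTen_eq`), so `Q`, `Θ` and `S` become polynomials in the frame components of the fields
and of the perturbation, and in their derivatives along the frame.

The price is that the dual frame is singular: its `τ` components have a simple pole at `ρ = 0`.
Against this, `√-g = κ γ^ρ |det Dγ|` has a simple zero. The rest is a count of powers of `ρ`: `Ord p
k` says that a germ is `ρ^k` times a smooth one, `Stat` that it is smooth and independent of `τ` on
the horizon, `StatSq` that it depends on `y, z` and the parameter only, up to `O(ρ²)`.

In the inertial frame a field of `ℬ` reads `Y⁰ = κ X w + O(ρ²)`, `Y¹ = κ T w + O(ρ²)`, where `w` is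
the `τ` component of the push-forward by `γ`. Up to `O(ρ)` this is an infinitesimal boost in the
`01` plane plus a tangential field, so every component of its strain `£g` with an index `0` or `1`
is `O(ρ)`. The variation `∂_λ g` along a path is the strain of `∂_λ` of the inertial coordinates,
which have the same form, and is covered by the same estimates.

Integrability: since `ξ^ρ = O(ρ²)`, only `ξ^τ ∂_α S^{ρα}` could survive on the horizon. The
tangential components `S^{ρA}` are `O(ρ)`, and `S^{τρ}` is independent of `τ` at `ρ = 0`. The
delicate term of the latter is the curl `D_0 h_{1b} - D_1 h_{0b}` with `b` tangential; as frame
derivatives commute it equals `D_b (D_0 Y¹ + D_1 Y⁰)`, a tangential derivative of a `τ`-independent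
function (`stat_curl_strain`, `stat_frameS`, `ord_obstruction`).

Charges: on the horizon the density of `Q` is `κ/(8πG) |det Dγ| w`. There `det Dγ` is the Jacobian
of the planar map, whose absolute value is `√L`, and `w = W + R^A ∂_A P` (`ord_noether`,
`ord_hair`). The terms `ξ^τ Θ^ρ` and `ξ^ρ Θ^τ` are both `O(ρ)`, so the variation is the derivative
of this density and is integrable: `H` is the horizon limit of `∮ Q`, a functional of the metric
alone (`ord_chargeVariation`, `noetherCharge`). Boundedness and compactness pass from germs to
integrals (`tendsto_integral_of_ord`).

For the bracket, derivatives along the horizon preserve `O(ρ²)`, and `∂_ρ` appears only multiplied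
by a component that is `O(ρ²)`. For the flows, the leading field does not depend on `ρ`, so the
orbit of `(τ, ρ, u)` and that of `(τ, 0, u)` shifted by `ρ` satisfy the same equation up to `O(ρ²)`,
and Gronwall's inequality compares them (`IsFlow.isBigO`). -/

noncomputable section

namespace Rindler

/-! ### Smooth functions vanishing on the horizon -/

/-- An integral over `[0, 1]` depending smoothly on parameters. -/
theorem contDiffOn_integral_param {E V : Type} [NormedAddCommGroup E] [NormedSpace ℝ E]
    [FiniteDimensional ℝ E] [NormedAddCommGroup V] [NormedSpace ℝ V]
    {S : Set E} (hS : IsOpen S) (n : ℕ) (F : E × ℝ → V)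
    (hF : ContDiffOn ℝ n F (S ×ˢ univ)) :
    ContDiffOn ℝ n (fun q => ∫ t in (0 : ℝ)..1, F (q, t)) S := by
  have hO : IsOpen (S ×ˢ (univ : Set ℝ)) := hS.prod isOpen_univ
  have hcont : ∀ {V : Type} [NormedAddCommGroup V] [NormedSpace ℝ V] (F : E × ℝ → V),
      ContinuousOn F (S ×ˢ univ) → ContinuousOn (fun q => ∫ t in (0 : ℝ)..1, F (q, t)) S := by
    intro V _ _ F hF
    rw [continuousOn_iff_continuous_domRestrict]
    refine intervalIntegral.continuous_parametric_intervalIntegral_of_continuous'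
      (f := fun (q : S) t => F (q, t)) ?_ 0 1
    exact hF.comp_continuous (by fun_prop) (fun x => ⟨x.1.2, trivial⟩)
  -- The target space varies in the induction, because the derivative takes values in `E →L[ℝ] V`.
  induction n generalizing V with
  | zero =>
    rw [Nat.cast_zero, contDiffOn_zero] at *
    exact hcont F hF
  | succ n ih =>
    have hF' : ContDiffOn ℝ n (fun p => (fderiv ℝ F p).comp (ContinuousLinearMap.inl ℝ E ℝ))
        (S ×ˢ univ) := by
      refine ContDiffOn.clm_comp ?_ contDiffOn_const
      exact hF.fderiv_of_isOpen hO (by norm_cast)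
    have hd : ∀ q ∈ S, HasFDerivAt (fun q => ∫ t in (0 : ℝ)..1, F (q, t))
        (∫ t in (0 : ℝ)..1, (fderiv ℝ F (q, t)).comp (ContinuousLinearMap.inl ℝ E ℝ)) q := by
      intro q hq
      obtain ⟨ε, hε, hball⟩ := Metric.isOpen_iff.1 hS q hq
      have hK : IsCompact (Metric.closedBall q (ε / 2) ×ˢ Icc (0 : ℝ) 1) :=
        (isCompact_closedBall _ _).prod isCompact_Icc
      have hsub : Metric.closedBall q (ε / 2) ⊆ S :=
        (Metric.closedBall_subset_ball (by linarith)).trans hball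
      obtain ⟨C, hC⟩ := hK.exists_bound_of_continuousOn
        (hF'.continuousOn.mono (prod_mono hsub (subset_univ _)))
      have hsl : ∀ {W : Type} [NormedAddCommGroup W] [NormedSpace ℝ W] {H : E × ℝ → W},
          ContinuousOn H (S ×ˢ univ) → ∀ x ∈ S, Continuous fun t => H (x, t) := by
        intro W _ _ H hH x hx
        exact hH.comp_continuous (by fun_prop) (fun t => ⟨hx, trivial⟩)
      refine intervalIntegral.hasFDerivAt_integral_of_dominated_of_fderiv_le
        (F' := fun q t => (fderiv ℝ F (q, t)).comp (ContinuousLinearMap.inl ℝ E ℝ))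
        (s := Metric.ball q (ε / 2)) (bound := fun _ => C)
        (Metric.ball_mem_nhds _ (by positivity)) ?_ ?_ ?_ ?_ ?_ ?_
      · filter_upwards [hS.mem_nhds hq] with x hx
        exact (hsl hF.continuousOn x hx).aestronglyMeasurable
      · exact (hsl hF.continuousOn q hq).intervalIntegrable _ _
      · exact (hsl hF'.continuousOn q hq).aestronglyMeasurable
      · refine Eventually.of_forall fun t ht x hx => hC (x, t) ⟨Metric.ball_subset_closedBall hx, ?_⟩
        rw [uIoc_of_le zero_le_one] at ht
        exact ⟨ht.1.le, ht.2⟩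
      · exact intervalIntegrable_const
      · refine Eventually.of_forall fun t ht x hx => ?_
        have hxS : x ∈ S := hsub (Metric.ball_subset_closedBall hx)
        have h1 : HasFDerivAt F (fderiv ℝ F (x, t)) (x, t) :=
          ((hF.differentiableOn (by simp)).differentiableAt
            (hO.mem_nhds ⟨hxS, trivial⟩)).hasFDerivAt
        exact h1.comp x (hasFDerivAt_prodMk_left x t)
    rw [Nat.cast_succ, contDiffOn_succ_iff_fderiv_of_isOpen hS]
    refine ⟨fun q hq => (hd q hq).differentiableAt.differentiableWithinAt, by simp, ?_⟩
    exact (ih _ hF').congr fun q hq => (hd q hq).fderiv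

/-- A smooth function on a family of spacetimes which vanishes on the horizon is `ρ` times
a smooth function. -/
theorem exists_eq_rho_mul {I : Set ℝ} (hI : IsOpen I) {f : ℝ × Pt → ℝ}
    (hf : ContDiffOn ℝ ∞ f (I ×ˢ univ)) (h0 : ∀ l ∈ I, ∀ x : Pt, x 1 = 0 → f (l, x) = 0) :
    ∃ k : ℝ × Pt → ℝ, ContDiffOn ℝ ∞ k (I ×ˢ univ) ∧
      ∀ q ∈ I ×ˢ (univ : Set Pt), f q = q.2 1 * k q := by
  have hO : IsOpen (I ×ˢ (univ : Set Pt)) := hI.prod isOpen_univ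
  let e : ℝ × Pt := (0, Pi.single 1 1)
  -- Hadamard's lemma: `σ` scales the coordinate `ρ` by `t`, and integrating `d/dt f(σ) = ρ ∂_ρ
  -- f(σ)` over `[0, 1]` exhibits the factor `ρ`.
  let σ : (ℝ × Pt) × ℝ → ℝ × Pt := fun z => (z.1.1, Function.update z.1.2 1 (z.2 * z.1.2 1))
  have hσ : ContDiff ℝ ∞ σ := by
    refine (contDiff_fst.comp contDiff_fst).prodMk ?_
    rw [contDiff_pi]
    intro i
    by_cases hi : i = 1
    · subst hi
      simp only [Function.update_self]
      fun_prop
    · simp only [Function.update_of_ne hi]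
      fun_prop
  have hσm : MapsTo σ ((I ×ˢ univ) ×ˢ univ) (I ×ˢ univ) := fun z hz => ⟨hz.1.1, trivial⟩
  have hd : ContDiffOn ℝ ∞ (fun z => fderiv ℝ f (σ z) e) ((I ×ˢ univ) ×ˢ univ) :=
    ((hf.fderiv_of_isOpen hO (m := ∞) (by simp)).comp hσ.contDiffOn hσm).clm_apply
      contDiffOn_const
  refine ⟨fun q => ∫ t in (0 : ℝ)..1, fderiv ℝ f (σ (q, t)) e, ?_, ?_⟩
  · rw [contDiffOn_infty]
    intro n
    exact contDiffOn_integral_param hO n _ (hd.of_le (by exact_mod_cast le_top))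
  · rintro ⟨l, x⟩ ⟨hl, -⟩
    have key : ∀ t : ℝ, HasDerivAt (fun t => f (σ ((l, x), t)))
        (x 1 * fderiv ℝ f (σ ((l, x), t)) e) t := by
      intro t
      have h1 : HasFDerivAt f (fderiv ℝ f (σ ((l, x), t))) (σ ((l, x), t)) :=
        ((hf.differentiableOn (by simp)).differentiableAt
          (hO.mem_nhds (show σ ((l, x), t) ∈ I ×ˢ univ from ⟨hl, trivial⟩))).hasFDerivAt
      have h2 : HasDerivAt (fun t => σ ((l, x), t)) (x 1 • e) t := by
        refine HasDerivAt.prodMk (by simpa [e] using hasDerivAt_const t l) ?_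
        rw [hasDerivAt_pi]
        intro i
        by_cases hi : i = 1
        · subst hi
          simpa [e] using (hasDerivAt_id t).mul_const (x 1)
        · simpa [Function.update_of_ne hi, hi, e] using hasDerivAt_const t (x i)
      have h3 := h1.comp_hasDerivAt t h2
      rw [map_smul, smul_eq_mul] at h3
      exact h3
    have h3 := intervalIntegral.integral_eq_sub_of_hasDerivAt (a := 0) (b := 1)
      (fun t _ => key t) (by
        refine Continuous.intervalIntegrable ?_ _ _
        refine continuous_const.mul ?_
        exact hd.continuousOn.comp_continuous (f := fun t : ℝ => ((l, x), t)) (by fun_prop)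
          (fun t => ⟨⟨hl, trivial⟩, trivial⟩))
    rw [intervalIntegral.integral_const_mul] at h3
    have h4 : σ ((l, x), 1) = (l, x) := by simp [σ]
    have h5 : f (σ ((l, x), 0)) = 0 := h0 l hl _ (by simp)
    rw [h4, h5, sub_zero] at h3
    exact h3.symm

theorem continuous_pt (τ : ℝ) (u : Plane) : Continuous fun ρ => pt τ ρ u := by
  refine continuous_pi fun i => ?_
  fin_cases i <;> simp [pt] <;> fun_prop

theorem pt_horiz (x : Pt) : pt (x 0) (x 1) (horiz x) = x := by
  ext i; fin_cases i <;> simp [pt, horiz]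

theorem pt_zero_horiz {x : Pt} (hx : x 1 = 0) : pt (x 0) 0 (horiz x) = x := by
  conv_rhs => rw [← pt_horiz x, hx]

/-- A smooth function which is `O(ρ²)` is `ρ²` times a smooth function. -/
theorem exists_eq_rho_sq_mul {I : Set ℝ} (hI : IsOpen I) {f : ℝ × Pt → ℝ}
    (hf : ContDiffOn ℝ ∞ f (I ×ˢ univ)) (h0 : ∀ l ∈ I, IsBigORhoSq fun x => f (l, x)) :
    ∃ k : ℝ × Pt → ℝ, ContDiffOn ℝ ∞ k (I ×ˢ univ) ∧
      ∀ q ∈ I ×ˢ (univ : Set Pt), f q = q.2 1 ^ 2 * k q := by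
  have lim : ∀ {g : ℝ × Pt → ℝ}, ContDiffOn ℝ ∞ g (I ×ˢ univ) → ∀ l ∈ I, ∀ τ u,
      Tendsto (fun ρ => g (l, pt τ ρ u)) (𝓝[>] 0) (𝓝 (g (l, pt τ 0 u))) := by
    intro g hg l hl τ u
    have : Continuous fun ρ => g (l, pt τ ρ u) :=
      hg.continuousOn.comp_continuous (continuous_const.prodMk (continuous_pt τ u))
        (fun t => ⟨hl, trivial⟩)
    exact (this.tendsto 0).mono_left nhdsWithin_le_nhds
  have hρ : Tendsto (fun ρ : ℝ => ρ) (𝓝[>] 0) (𝓝 0) := tendsto_id.mono_left nhdsWithin_le_nhds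
  have z1 : ∀ l ∈ I, ∀ x : Pt, x 1 = 0 → f (l, x) = 0 := by
    intro l hl x hx
    have h1 := lim hf l hl (x 0) (horiz x)
    have h2 := (h0 l hl (x 0) (horiz x)).trans_tendsto (by simpa using hρ.pow 2)
    have h3 := tendsto_nhds_unique h1 h2
    rwa [pt_zero_horiz hx] at h3
  obtain ⟨k, hk, hfk⟩ := exists_eq_rho_mul hI hf z1
  -- Dividing the bound by `ρ > 0` shows that the first quotient is `O(ρ)`; by continuity it
  -- vanishes on the horizon, so Hadamard's lemma applies a second time.
  have z2 : ∀ l ∈ I, ∀ x : Pt, x 1 = 0 → k (l, x) = 0 := by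
    intro l hl x hx
    have h1 := lim hk l hl (x 0) (horiz x)
    have h2 : (fun ρ : ℝ => k (l, pt (x 0) ρ (horiz x))) =O[𝓝[>] 0] (fun ρ : ℝ => ρ) := by
      have h := h0 l hl (x 0) (horiz x)
      obtain ⟨C, hC⟩ := h.bound
      refine IsBigO.of_bound C ?_
      filter_upwards [hC, self_mem_nhdsWithin] with ρ h hρ
      have hρ : 0 < ρ := hρ
      rw [hfk _ ⟨hl, trivial⟩] at h
      simp only [pt, Matrix.cons_val_one, Matrix.cons_val_zero, norm_mul, norm_pow,
        Real.norm_eq_abs, abs_of_pos hρ] at h ⊢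
      have : ρ * |k (l, ![x 0, ρ, horiz x 0, horiz x 1])| ≤ ρ * (C * ρ) := by
        calc _ ≤ _ := h
          _ = _ := by ring
      exact le_of_mul_le_mul_left this hρ
    have h3 := tendsto_nhds_unique h1 (h2.trans_tendsto hρ)
    rwa [pt_zero_horiz hx] at h3
  obtain ⟨m, hm, hkm⟩ := exists_eq_rho_mul hI hk z2
  refine ⟨m, hm, fun q hq => ?_⟩
  rw [hfk q hq, hkm q hq]; ring

/-! ### Partial derivatives of functions of a parameter and a point -/

/-- The partial derivative `∂_μ` of a function of a parameter and a point. -/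
def xd (μ : Fin 4) (f : ℝ × Pt → ℝ) (q : ℝ × Pt) : ℝ := pd μ (fun x => f (q.1, x)) q.2

/-- The derivative in the parameter of a function of a parameter and a point. -/
def ld (f : ℝ × Pt → ℝ) (q : ℝ × Pt) : ℝ := deriv (fun l => f (l, q.2)) q.1

/-- The unit vector in the direction of `x^μ`. -/
abbrev xdir (μ : Fin 4) : ℝ × Pt := (0, Pi.single μ 1)

/-- The unit vector in the direction of the parameter. -/
abbrev ldir : ℝ × Pt := (1, 0)

/-- Passing to the joint derivative in `(λ, x)` reduces all rules for `xd` and `ld`, including their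
commutation, to rules for `fderiv`. -/
theorem xd_eq_fderiv {f : ℝ × Pt → ℝ} {q : ℝ × Pt} (hf : DifferentiableAt ℝ f q) (μ : Fin 4) :
    xd μ f q = fderiv ℝ f q (xdir μ) := by
  have h : HasFDerivAt (fun x => f (q.1, x)) _ q.2 :=
    hf.hasFDerivAt.comp q.2 (hasFDerivAt_prodMk_right q.1 q.2)
  simp [xd, pd, h.fderiv]

theorem ld_eq_fderiv {f : ℝ × Pt → ℝ} {q : ℝ × Pt} (hf : DifferentiableAt ℝ f q) :
    ld f q = fderiv ℝ f q ldir := by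
  have h : HasFDerivAt (fun l => f (l, q.2)) _ q.1 :=
    hf.hasFDerivAt.comp q.1 (hasFDerivAt_prodMk_left q.1 q.2)
  simp [ld, ← fderiv_apply_one_eq_deriv, h.fderiv]

theorem xd_eventuallyEq {f : ℝ × Pt → ℝ} {q : ℝ × Pt} (hf : ContDiffAt ℝ 1 f q) (μ : Fin 4) :
    xd μ f =ᶠ[𝓝 q] fun q => fderiv ℝ f q (xdir μ) := by
  filter_upwards [hf.eventually (by simp)] with q hq
  exact xd_eq_fderiv (hq.differentiableAt (by simp)) μ

theorem ld_eventuallyEq {f : ℝ × Pt → ℝ} {q : ℝ × Pt} (hf : ContDiffAt ℝ 1 f q) :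
    ld f =ᶠ[𝓝 q] fun q => fderiv ℝ f q ldir := by
  filter_upwards [hf.eventually (by simp)] with q hq
  exact ld_eq_fderiv (hq.differentiableAt (by simp))

theorem xd_eq_of_eventuallyEq {f g : ℝ × Pt → ℝ} {q : ℝ × Pt} (h : f =ᶠ[𝓝 q] g)
    (μ : Fin 4) : xd μ f q = xd μ g q := by
  have : Tendsto (fun x => (q.1, x)) (𝓝 q.2) (𝓝 q) :=
    (continuous_const.prodMk continuous_id).tendsto' _ _ rfl
  simp only [xd, pd]
  rw [Filter.EventuallyEq.fderiv_eq (f₁ := fun x => f (q.1, x)) (this.eventually h)]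

theorem ld_eq_of_eventuallyEq {f g : ℝ × Pt → ℝ} {q : ℝ × Pt} (h : f =ᶠ[𝓝 q] g) :
    ld f q = ld g q := by
  have : Tendsto (fun l => (l, q.2)) (𝓝 q.1) (𝓝 q) :=
    (continuous_id.prodMk continuous_const).tendsto' _ _ rfl
  simp only [ld]
  rw [Filter.EventuallyEq.deriv_eq (f₁ := fun l => f (l, q.2)) (this.eventually h)]

theorem fderiv_fderiv_comm {f : ℝ × Pt → ℝ} {q : ℝ × Pt} (hf : ContDiffAt ℝ 2 f q)
    (v w : ℝ × Pt) : fderiv ℝ (fun q => fderiv ℝ f q v) q w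
      = fderiv ℝ (fun q => fderiv ℝ f q w) q v := by
  have hd : DifferentiableAt ℝ (fderiv ℝ f) q :=
    (hf.fderiv_right (m := 1) (by norm_num)).differentiableAt (by simp)
  have h : ∀ v w, fderiv ℝ (fun q => fderiv ℝ f q v) q w = fderiv ℝ (fderiv ℝ f) q w v := by
    intro v w
    rw [fderiv_clm_apply hd (by fun_prop)]
    simp
  rw [h, h]
  exact hf.isSymmSndFDerivAt (by simp) w v

theorem differentiableAt_fderiv_apply {f : ℝ × Pt → ℝ} {q : ℝ × Pt} (hf : ContDiffAt ℝ 2 f q)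
    (v : ℝ × Pt) : DifferentiableAt ℝ (fun q => fderiv ℝ f q v) q :=
  ((hf.fderiv_right (m := 1) (by norm_num)).differentiableAt (by simp)).clm_apply (by fun_prop)

theorem xd_xd_comm {f : ℝ × Pt → ℝ} {q : ℝ × Pt} (hf : ContDiffAt ℝ 2 f q) (μ ν : Fin 4) :
    xd μ (xd ν f) q = xd ν (xd μ f) q := by
  have h1 : ContDiffAt ℝ 1 f q := hf.of_le (by norm_num)
  rw [xd_eq_of_eventuallyEq (xd_eventuallyEq h1 ν), xd_eq_of_eventuallyEq (xd_eventuallyEq h1 μ),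
    xd_eq_fderiv (differentiableAt_fderiv_apply hf _),
    xd_eq_fderiv (differentiableAt_fderiv_apply hf _), fderiv_fderiv_comm hf]

theorem ld_xd_comm {f : ℝ × Pt → ℝ} {q : ℝ × Pt} (hf : ContDiffAt ℝ 2 f q) (μ : Fin 4) :
    ld (xd μ f) q = xd μ (ld f) q := by
  have h1 : ContDiffAt ℝ 1 f q := hf.of_le (by norm_num)
  rw [ld_eq_of_eventuallyEq (xd_eventuallyEq h1 μ), xd_eq_of_eventuallyEq (ld_eventuallyEq h1),
    ld_eq_fderiv (differentiableAt_fderiv_apply hf _),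
    xd_eq_fderiv (differentiableAt_fderiv_apply hf _), fderiv_fderiv_comm hf]

section pointwise
variable {f g : ℝ × Pt → ℝ} {q : ℝ × Pt}

theorem xd_const (c : ℝ) (μ : Fin 4) : xd μ (fun _ => c) q = 0 := by simp [xd, pd]

theorem xd_add (hf : DifferentiableAt ℝ f q) (hg : DifferentiableAt ℝ g q) (μ : Fin 4) :
    xd μ (fun q => f q + g q) q = xd μ f q + xd μ g q := by
  rw [xd_eq_fderiv hf, xd_eq_fderiv hg, xd_eq_fderiv (hf.fun_add hg), fderiv_fun_add hf hg]; rfl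

theorem xd_sub (hf : DifferentiableAt ℝ f q) (hg : DifferentiableAt ℝ g q) (μ : Fin 4) :
    xd μ (fun q => f q - g q) q = xd μ f q - xd μ g q := by
  rw [xd_eq_fderiv hf, xd_eq_fderiv hg, xd_eq_fderiv (hf.fun_sub hg), fderiv_fun_sub hf hg]; rfl

theorem xd_mul (hf : DifferentiableAt ℝ f q) (hg : DifferentiableAt ℝ g q) (μ : Fin 4) :
    xd μ (fun q => f q * g q) q = xd μ f q * g q + f q * xd μ g q := by
  rw [xd_eq_fderiv hf, xd_eq_fderiv hg, xd_eq_fderiv (hf.fun_mul hg), fderiv_fun_mul hf hg]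
  simp; ring

theorem xd_sum {ι : Type*} {s : Finset ι} {F : ι → ℝ × Pt → ℝ}
    (hF : ∀ i ∈ s, DifferentiableAt ℝ (F i) q) (μ : Fin 4) :
    xd μ (fun q => ∑ i ∈ s, F i q) q = ∑ i ∈ s, xd μ (F i) q := by
  rw [xd_eq_fderiv (DifferentiableAt.fun_sum hF), fderiv_fun_sum hF]
  simp only [_root_.sum_apply]
  exact Finset.sum_congr rfl fun i hi => (xd_eq_fderiv (hF i hi) μ).symm

theorem ld_mul (hf : DifferentiableAt ℝ f q) (hg : DifferentiableAt ℝ g q) :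
    ld (fun q => f q * g q) q = ld f q * g q + f q * ld g q := by
  rw [ld_eq_fderiv hf, ld_eq_fderiv hg, ld_eq_fderiv (hf.fun_mul hg), fderiv_fun_mul hf hg]
  simp; ring

theorem ld_sub (hf : DifferentiableAt ℝ f q) (hg : DifferentiableAt ℝ g q) :
    ld (fun q => f q - g q) q = ld f q - ld g q := by
  rw [ld_eq_fderiv hf, ld_eq_fderiv hg, ld_eq_fderiv (hf.fun_sub hg), fderiv_fun_sub hf hg]; rfl

end pointwise

/-- Finite order is essential: the neighbourhood on which `f` is `C^n` may shrink as `n` grows. -/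
theorem eventually_contDiffAt_nat {f : ℝ × Pt → ℝ} {p : ℝ × Pt} (hf : ContDiffAt ℝ ∞ f p)
    (n : ℕ) : ∀ᶠ q in 𝓝 p, ContDiffAt ℝ n f q :=
  (hf.of_le (by exact_mod_cast le_top)).eventually (by simp)

theorem contDiffAt_xd {f : ℝ × Pt → ℝ} {p : ℝ × Pt} (hf : ContDiffAt ℝ ∞ f p) (μ : Fin 4) :
    ContDiffAt ℝ ∞ (xd μ f) p :=
  ((hf.fderiv_right (m := ∞) (by simp)).clm_apply contDiffAt_const).congr_of_eventuallyEq
    (xd_eventuallyEq (hf.of_le (by simp)) μ)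

theorem contDiffAt_ld {f : ℝ × Pt → ℝ} {p : ℝ × Pt} (hf : ContDiffAt ℝ ∞ f p) :
    ContDiffAt ℝ ∞ (ld f) p :=
  ((hf.fderiv_right (m := ∞) (by simp)).clm_apply contDiffAt_const).congr_of_eventuallyEq
    (ld_eventuallyEq (hf.of_le (by simp)))

/-! ### Orders in `ρ` of germs at the horizon -/

/-- The neighbourhoods of `p` in the wedge `ρ > 0`. -/
def wedgeNhds (p : ℝ × Pt) : Filter (ℝ × Pt) := 𝓝[{q | 0 < q.2 1}] p

/-- Near `p`, the function `f` is `ρ^k` times a smooth function. -/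
def Ord (p : ℝ × Pt) (k : ℤ) (f : ℝ × Pt → ℝ) : Prop :=
  ∃ g : ℝ × Pt → ℝ, ContDiffAt ℝ ∞ g p ∧ f =ᶠ[wedgeNhds p] fun q => q.2 1 ^ k * g q

theorem isOpen_wedge : IsOpen {q : ℝ × Pt | 0 < q.2 1} :=
  isOpen_lt continuous_const (by fun_prop)

theorem eventually_pos (p : ℝ × Pt) : ∀ᶠ q in wedgeNhds p, 0 < q.2 1 := self_mem_nhdsWithin

theorem eventually_wedgeNhds {p : ℝ × Pt} {P : ℝ × Pt → Prop} (h : ∀ᶠ q in 𝓝 p, P q) :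
    ∀ᶠ q in wedgeNhds p, P q := h.filter_mono nhdsWithin_le_nhds

/-- As the wedge is open, an identity of germs at `p` holds in a full neighbourhood of each nearby
point of the wedge, and so may be differentiated there. -/
theorem eventually_eventually_wedgeNhds {p : ℝ × Pt} {P : ℝ × Pt → Prop}
    (h : ∀ᶠ q in wedgeNhds p, P q) : ∀ᶠ q in wedgeNhds p, ∀ᶠ q' in 𝓝 q, P q' := by
  filter_upwards [eventually_eventually_nhdsWithin.2 h, eventually_pos p] with q hq hpos
  rwa [isOpen_wedge.nhdsWithin_eq hpos] at hq

theorem xd_congr {p : ℝ × Pt} {f g : ℝ × Pt → ℝ} (h : f =ᶠ[wedgeNhds p] g) (μ : Fin 4) :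
    xd μ f =ᶠ[wedgeNhds p] xd μ g := by
  filter_upwards [eventually_eventually_wedgeNhds h] with q hq
  exact xd_eq_of_eventuallyEq hq μ

theorem ld_congr {p : ℝ × Pt} {f g : ℝ × Pt → ℝ} (h : f =ᶠ[wedgeNhds p] g) :
    ld f =ᶠ[wedgeNhds p] ld g := by
  filter_upwards [eventually_eventually_wedgeNhds h] with q hq
  exact ld_eq_of_eventuallyEq hq

theorem contDiffAt_rho_zpow {q : ℝ × Pt} (h : 0 < q.2 1) (k : ℤ) (n : ℕ∞ω) :
    ContDiffAt ℝ n (fun q : ℝ × Pt => q.2 1 ^ k) q := by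
  have h1 : ContDiffAt ℝ n (fun q : ℝ × Pt => q.2 1) q := by fun_prop
  obtain ⟨m, rfl | rfl⟩ := k.eq_nat_or_neg
  · simpa using h1.pow m
  · simp only [zpow_neg, zpow_natCast]
    exact (h1.pow m).inv (by positivity)

namespace Ord
variable {p : ℝ × Pt} {k m : ℤ} {f g : ℝ × Pt → ℝ}

theorem congr (hf : Ord p k f) (h : g =ᶠ[wedgeNhds p] f) : Ord p k g := by
  obtain ⟨a, ha, hfa⟩ := hf
  exact ⟨a, ha, h.trans hfa⟩

theorem of_contDiffAt (hf : ContDiffAt ℝ ∞ f p) : Ord p 0 f :=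
  ⟨f, hf, Eventually.of_forall fun q => by simp⟩

theorem const (c : ℝ) : Ord p 0 fun _ => c := of_contDiffAt contDiffAt_const

theorem mono (hf : Ord p k f) (h : m ≤ k) : Ord p m f := by
  obtain ⟨a, ha, hfa⟩ := hf
  obtain ⟨n, rfl⟩ := Int.le.dest h
  refine ⟨fun q => q.2 1 ^ n * a q, ContDiffAt.mul (by fun_prop) ha, ?_⟩
  filter_upwards [hfa, eventually_pos p] with q hq hpos
  rw [hq, zpow_add₀ hpos.ne', zpow_natCast, mul_assoc]

theorem zero (k : ℤ) : Ord p k fun _ => 0 :=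
  ⟨fun _ => 0, contDiffAt_const, Eventually.of_forall fun q => by simp⟩

theorem add (hf : Ord p k f) (hg : Ord p k g) : Ord p k fun q => f q + g q := by
  obtain ⟨a, ha, hfa⟩ := hf
  obtain ⟨b, hb, hgb⟩ := hg
  refine ⟨fun q => a q + b q, ha.add hb, ?_⟩
  filter_upwards [hfa, hgb] with q h1 h2
  rw [h1, h2]; ring

theorem mul (hf : Ord p k f) (hg : Ord p m g) : Ord p (k + m) fun q => f q * g q := by
  obtain ⟨a, ha, hfa⟩ := hf
  obtain ⟨b, hb, hgb⟩ := hg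
  refine ⟨fun q => a q * b q, ha.mul hb, ?_⟩
  filter_upwards [hfa, hgb, eventually_pos p] with q h1 h2 hpos
  rw [h1, h2, zpow_add₀ hpos.ne']; ring

/-- A product has every order up to the sum of the orders of the factors. -/
theorem mul' {n : ℤ} (hf : Ord p k f) (hg : Ord p m g) (h : n ≤ k + m := by norm_num) :
    Ord p n fun q => f q * g q := (hf.mul hg).mono h

theorem const_mul (c : ℝ) (hf : Ord p k f) : Ord p k fun q => c * f q :=
  (const c).mul' hf (by simp)

theorem neg (hf : Ord p k f) : Ord p k fun q => -f q := by
  simpa using hf.const_mul (-1)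

theorem sub (hf : Ord p k f) (hg : Ord p k g) : Ord p k fun q => f q - g q := by
  simpa [sub_eq_add_neg] using hf.add hg.neg

theorem sum {ι : Type*} {s : Finset ι} {F : ι → ℝ × Pt → ℝ} (h : ∀ i ∈ s, Ord p k (F i)) :
    Ord p k fun q => ∑ i ∈ s, F i q := by
  classical
  induction s using Finset.induction_on with
  | empty => simpa using zero k
  | insert a s ha ih =>
    simp only [Finset.sum_insert ha]
    exact (h a (by simp)).add (ih fun i hi => h i (by simp [hi]))

theorem rho : Ord p 1 fun q => q.2 1 := ⟨fun _ => 1, contDiffAt_const, by simp⟩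

theorem rho_zpow (k : ℤ) : Ord p k fun q => q.2 1 ^ k := ⟨fun _ => 1, contDiffAt_const, by simp⟩

theorem eventually_contDiffAt (hf : Ord p k f) (n : ℕ) :
    ∀ᶠ q in wedgeNhds p, ContDiffAt ℝ n f q := by
  obtain ⟨a, ha, hfa⟩ := hf
  filter_upwards [eventually_eventually_wedgeNhds hfa,
    eventually_wedgeNhds (eventually_contDiffAt_nat ha n), eventually_pos p] with q h1 h2 h3
  exact ((contDiffAt_rho_zpow h3 k n).mul h2).congr_of_eventuallyEq h1

theorem eventually_differentiableAt (hf : Ord p k f) :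
    ∀ᶠ q in wedgeNhds p, DifferentiableAt ℝ f q := by
  filter_upwards [hf.eventually_contDiffAt 1] with q hq
  exact hq.differentiableAt (by simp)

theorem xd_rho_zpow {q : ℝ × Pt} (h : 0 < q.2 1) (k : ℤ) (μ : Fin 4) :
    xd μ (fun q => q.2 1 ^ k) q = if μ = 1 then k * q.2 1 ^ (k - 1) else 0 := by
  have h1 : HasFDerivAt (fun x : Pt => x 1) (ContinuousLinearMap.proj 1) q.2 :=
    (ContinuousLinearMap.proj (R := ℝ) (φ := fun _ : Fin 4 => ℝ) 1).hasFDerivAt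
  have h2 := (hasDerivAt_zpow k (q.2 1) (Or.inl h.ne')).comp_hasFDerivAt q.2 h1
  have h3 : HasFDerivAt (fun x : Pt => x 1 ^ k) _ q.2 := h2
  simp only [Rindler.xd, pd, h3.fderiv]
  by_cases hμ : μ = 1
  · subst hμ; simp
  · simp [hμ, Ne.symm hμ]

theorem eventually_xd_eq {a : ℝ × Pt → ℝ} (ha : ContDiffAt ℝ ∞ a p)
    (hfa : f =ᶠ[wedgeNhds p] fun q => q.2 1 ^ k * a q) (μ : Fin 4) :
    Rindler.xd μ f =ᶠ[wedgeNhds p] fun q =>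
      (if μ = 1 then k * q.2 1 ^ (k - 1) else 0) * a q + q.2 1 ^ k * Rindler.xd μ a q := by
  filter_upwards [xd_congr hfa μ, eventually_wedgeNhds (eventually_contDiffAt_nat ha 1),
    eventually_pos p] with q h1 h2 h3
  rw [h1, xd_mul ((contDiffAt_rho_zpow h3 k 1).differentiableAt (by simp))
    (h2.differentiableAt (by simp)), xd_rho_zpow h3]

/-- Directions other than `∂_ρ` do not act on `ρ^k`; only `∂_ρ` costs a power. -/
theorem xd_of_ne (hf : Ord p k f) {μ : Fin 4} (hμ : μ ≠ 1) : Ord p k (xd μ f) := by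
  obtain ⟨a, ha, hfa⟩ := hf
  exact ⟨_, contDiffAt_xd ha μ, (eventually_xd_eq ha hfa μ).trans (by simp [hμ])⟩

theorem xd (hf : Ord p k f) (μ : Fin 4) : Ord p (k - 1) (xd μ f) := by
  by_cases hμ : μ = 1
  · obtain ⟨a, ha, hfa⟩ := hf
    refine Ord.congr ?_ (eventually_xd_eq ha hfa μ)
    simp only [hμ, if_true]
    exact (((rho_zpow (k - 1)).const_mul k).mul' (of_contDiffAt ha) (by simp)).add
      ((rho_zpow k).mul' (of_contDiffAt (contDiffAt_xd ha 1)) (by simp))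
  · exact (hf.xd_of_ne hμ).mono (by simp)

theorem ld (hf : Ord p k f) : Ord p k (ld f) := by
  obtain ⟨a, ha, hfa⟩ := hf
  refine ⟨_, contDiffAt_ld ha, ?_⟩
  filter_upwards [ld_congr hfa, eventually_wedgeNhds (eventually_contDiffAt_nat ha 1),
    eventually_pos p] with q h1 h2 h3
  rw [h1, ld_mul ((contDiffAt_rho_zpow h3 k 1).differentiableAt (by simp))
    (h2.differentiableAt (by simp))]
  simp [Rindler.ld]

theorem eventually_xd_mul (hf : Ord p k f) (hg : Ord p m g) (μ : Fin 4) :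
    Rindler.xd μ (fun q => f q * g q) =ᶠ[wedgeNhds p]
      fun q => Rindler.xd μ f q * g q + f q * Rindler.xd μ g q := by
  filter_upwards [hf.eventually_differentiableAt, hg.eventually_differentiableAt] with q h1 h2
  exact xd_mul h1 h2 μ

theorem eventually_xd_add (hf : Ord p k f) (hg : Ord p m g) (μ : Fin 4) :
    Rindler.xd μ (fun q => f q + g q) =ᶠ[wedgeNhds p]
      fun q => Rindler.xd μ f q + Rindler.xd μ g q := by
  filter_upwards [hf.eventually_differentiableAt, hg.eventually_differentiableAt] with q h1 h2
  exact xd_add h1 h2 μ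

theorem eventually_xd_xd (hf : Ord p k f) (μ ν : Fin 4) :
    Rindler.xd μ (Rindler.xd ν f) =ᶠ[wedgeNhds p] Rindler.xd ν (Rindler.xd μ f) := by
  filter_upwards [hf.eventually_contDiffAt 2] with q hq
  exact xd_xd_comm hq μ ν

/-- Division by a function which does not vanish at the horizon. -/
theorem inv (hf : ContDiffAt ℝ ∞ f p) (h : f p ≠ 0) : Ord p 0 fun q => (f q)⁻¹ :=
  of_contDiffAt (hf.inv h)

end Ord

/-- `f` is smooth up to the horizon, and independent of `τ` there. -/
structure Stat (p : ℝ × Pt) (f : ℝ × Pt → ℝ) : Prop where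
  ord : Ord p 0 f
  xd_zero : Ord p 1 (xd 0 f)

/-- `f` is a smooth function of the parameter and of `y, z`, up to `O(ρ²)`. -/
structure StatSq (p : ℝ × Pt) (f : ℝ × Pt → ℝ) : Prop where
  ord : Ord p 0 f
  xd_zero : Ord p 2 (xd 0 f)
  xd_one : Ord p 1 (xd 1 f)

/-! ### Algebra and derivatives of functions independent of `τ` on the horizon. -/

section
variable {p : ℝ × Pt} {f g : ℝ × Pt → ℝ}

theorem Ord.stat (hf : Ord p 1 f) : Stat p f := ⟨hf.mono (by norm_num), hf.xd_of_ne (by decide)⟩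

theorem Ord.statSq (hf : Ord p 2 f) : StatSq p f :=
  ⟨hf.mono (by norm_num), hf.xd_of_ne (by decide), hf.xd 1⟩

theorem StatSq.stat (hf : StatSq p f) : Stat p f := ⟨hf.ord, hf.xd_zero.mono (by norm_num)⟩

theorem Stat.congr (hf : Stat p f) (h : g =ᶠ[wedgeNhds p] f) : Stat p g :=
  ⟨hf.ord.congr h, hf.xd_zero.congr (xd_congr h 0)⟩

theorem StatSq.congr (hf : StatSq p f) (h : g =ᶠ[wedgeNhds p] f) : StatSq p g :=
  ⟨hf.ord.congr h, hf.xd_zero.congr (xd_congr h 0), hf.xd_one.congr (xd_congr h 1)⟩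

theorem Stat.const (c : ℝ) : Stat p fun _ => c :=
  ⟨Ord.const c, (Ord.zero 1).congr (Eventually.of_forall fun _ => xd_const c 0)⟩

theorem StatSq.const (c : ℝ) : StatSq p fun _ => c :=
  ⟨Ord.const c, (Ord.zero 2).congr (Eventually.of_forall fun _ => xd_const c 0),
    (Ord.zero 1).congr (Eventually.of_forall fun _ => xd_const c 1)⟩

theorem Stat.add (hf : Stat p f) (hg : Stat p g) : Stat p fun q => f q + g q :=
  ⟨hf.ord.add hg.ord, (hf.xd_zero.add hg.xd_zero).congr (hf.ord.eventually_xd_add hg.ord 0)⟩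

theorem StatSq.add (hf : StatSq p f) (hg : StatSq p g) : StatSq p fun q => f q + g q :=
  ⟨hf.ord.add hg.ord, (hf.xd_zero.add hg.xd_zero).congr (hf.ord.eventually_xd_add hg.ord 0),
    (hf.xd_one.add hg.xd_one).congr (hf.ord.eventually_xd_add hg.ord 1)⟩

theorem Stat.mul (hf : Stat p f) (hg : Stat p g) : Stat p fun q => f q * g q :=
  ⟨hf.ord.mul hg.ord, ((hf.xd_zero.mul' hg.ord).add (hf.ord.mul' hg.xd_zero)).congr
    (hf.ord.eventually_xd_mul hg.ord 0)⟩

theorem StatSq.mul (hf : StatSq p f) (hg : StatSq p g) : StatSq p fun q => f q * g q :=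
  ⟨hf.ord.mul hg.ord, ((hf.xd_zero.mul' hg.ord).add (hf.ord.mul' hg.xd_zero)).congr
    (hf.ord.eventually_xd_mul hg.ord 0), ((hf.xd_one.mul' hg.ord).add
    (hf.ord.mul' hg.xd_one)).congr (hf.ord.eventually_xd_mul hg.ord 1)⟩

theorem Stat.const_mul (c : ℝ) (hf : Stat p f) : Stat p fun q => c * f q := (Stat.const c).mul hf

theorem Stat.neg (hf : Stat p f) : Stat p fun q => -f q := by simpa using hf.const_mul (-1)

theorem Stat.sub (hf : Stat p f) (hg : Stat p g) : Stat p fun q => f q - g q := by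
  simpa [sub_eq_add_neg] using hf.add hg.neg

theorem Stat.sum {ι : Type*} {s : Finset ι} {F : ι → ℝ × Pt → ℝ} (h : ∀ i ∈ s, Stat p (F i)) :
    Stat p fun q => ∑ i ∈ s, F i q := by
  classical
  induction s using Finset.induction_on with
  | empty => simpa using Stat.const 0
  | insert a s ha ih =>
    simp only [Finset.sum_insert ha]
    exact (h a (by simp)).add (ih fun i hi => h i (by simp [hi]))

theorem StatSq.sum {ι : Type*} {s : Finset ι} {F : ι → ℝ × Pt → ℝ}
    (h : ∀ i ∈ s, StatSq p (F i)) : StatSq p fun q => ∑ i ∈ s, F i q := by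
  classical
  induction s using Finset.induction_on with
  | empty => simpa using StatSq.const 0
  | insert a s ha ih =>
    simp only [Finset.sum_insert ha]
    exact (h a (by simp)).add (ih fun i hi => h i (by simp [hi]))

theorem Stat.prod {ι : Type*} {s : Finset ι} {F : ι → ℝ × Pt → ℝ} (h : ∀ i ∈ s, Stat p (F i)) :
    Stat p fun q => ∏ i ∈ s, F i q := by
  classical
  induction s using Finset.induction_on with
  | empty => simpa using Stat.const 1
  | insert a s ha ih =>
    simp only [Finset.prod_insert ha]
    exact (h a (by simp)).mul (ih fun i hi => h i (by simp [hi]))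

/-- `∂_A` of a function independent of `τ` on the horizon, more generally any derivative along
the horizon. -/
theorem Stat.xd (hf : Stat p f) {μ : Fin 4} (hμ : μ ≠ 1) : Stat p (xd μ f) :=
  ⟨hf.ord.xd_of_ne hμ, (hf.xd_zero.xd_of_ne hμ).congr (hf.ord.eventually_xd_xd 0 μ)⟩

theorem StatSq.xd (hf : StatSq p f) {μ : Fin 4} (hμ : μ ≠ 1) : StatSq p (Rindler.xd μ f) :=
  ⟨hf.ord.xd_of_ne hμ, (hf.xd_zero.xd_of_ne hμ).congr (hf.ord.eventually_xd_xd 0 μ),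
    (hf.xd_one.xd_of_ne hμ).congr (hf.ord.eventually_xd_xd 1 μ)⟩

theorem StatSq.ld (hf : StatSq p f) : StatSq p (ld f) := by
  have h : ∀ μ, Rindler.xd μ (Rindler.ld f) =ᶠ[wedgeNhds p] Rindler.ld (Rindler.xd μ f) := by
    intro μ
    filter_upwards [hf.ord.eventually_contDiffAt 2] with q hq
    exact (ld_xd_comm hq μ).symm
  exact ⟨hf.ord.ld, hf.xd_zero.ld.congr (h 0), hf.xd_one.ld.congr (h 1)⟩

end

/-! ### Geometry of a flat metric in an inertial frame -/

section pd
variable {f g : Pt → ℝ} {x : Pt}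

theorem pd_mul (hf : DifferentiableAt ℝ f x) (hg : DifferentiableAt ℝ g x) (μ : Fin 4) :
    pd μ (fun x => f x * g x) x = pd μ f x * g x + f x * pd μ g x := by
  simp only [pd, fderiv_fun_mul hf hg]
  simp; ring

theorem pd_const_mul (c : ℝ) (hf : DifferentiableAt ℝ f x) (μ : Fin 4) :
    pd μ (fun x => c * f x) x = c * pd μ f x := by
  simp [pd, fderiv_const_mul hf]

theorem pd_sum {ι : Type*} {s : Finset ι} {F : ι → Pt → ℝ}
    (hF : ∀ i ∈ s, DifferentiableAt ℝ (F i) x) (μ : Fin 4) :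
    pd μ (fun x => ∑ i ∈ s, F i x) x = ∑ i ∈ s, pd μ (F i) x := by
  simp [pd, fderiv_fun_sum hF]

theorem pd_congr (h : f =ᶠ[𝓝 x] g) (μ : Fin 4) : pd μ f x = pd μ g x := by
  simp [pd, h.fderiv_eq]

end pd

/-- The signature of the metric. -/
def sgn : Fin 4 → ℝ := ![-1, 1, 1, 1]

theorem sgn_mul_self (a : Fin 4) : sgn a * sgn a = 1 := by fin_cases a <;> simp [sgn]

theorem diagonal_sgn_mul_self :
    Matrix.diagonal sgn * Matrix.diagonal sgn = 1 := by
  rw [Matrix.diagonal_mul_diagonal, ← Matrix.diagonal_one]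
  congr 1; ext a; exact sgn_mul_self a

/-- The coframe `E` is closed and orthonormal for the metric `g` near `x`, and `N` is the dual
frame at `x`. -/
structure IsFrame (g : Tensor2) (E : Tensor2) (N : Matrix (Fin 4) (Fin 4) ℝ) (x : Pt) : Prop where
  metric : ∀ᶠ x' in 𝓝 x, ∀ μ ν, g x' μ ν = ∑ a, sgn a * (E x' a μ * E x' a ν)
  diff : ∀ a μ, DifferentiableAt ℝ (fun x' => E x' a μ) x
  closed : ∀ a μ ν, pd μ (fun x' => E x' a ν) x = pd ν (fun x' => E x' a μ) x
  inv : N * E x = 1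

/-- The derivative along the vector `N_a` of a frame. -/
def frd (N : Matrix (Fin 4) (Fin 4) ℝ) (a : Fin 4) (f : Pt → ℝ) (x : Pt) : ℝ :=
  ∑ μ, N μ a * pd μ f x

namespace IsFrame
open Matrix
variable {g : Tensor2} {E : Tensor2} {N : Matrix (Fin 4) (Fin 4) ℝ} {x : Pt}
variable (F : IsFrame g E N x)
include F

theorem inv' : E x * N = 1 := mul_eq_one_comm.1 F.inv

theorem inv_apply (μ ν : Fin 4) : ∑ a, N μ a * E x a ν = if μ = ν then 1 else 0 := by
  have := congrFun (congrFun F.inv μ) ν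
  rwa [mul_apply, one_apply] at this

theorem inv_apply' (a b : Fin 4) : ∑ μ, E x a μ * N μ b = if a = b then 1 else 0 := by
  have := congrFun (congrFun F.inv' a) b
  rwa [mul_apply, one_apply] at this

theorem metric_eq : g x = (E x)ᵀ * diagonal sgn * E x := by
  ext μ ν
  rw [F.metric.self_of_nhds μ ν, mul_apply]
  simp only [mul_diagonal, transpose_apply]
  exact Finset.sum_congr rfl fun a _ => by ring

theorem transpose_inv' : Nᵀ * (E x)ᵀ = 1 := by rw [← transpose_mul, F.inv', transpose_one]

theorem metric_inv : (g x)⁻¹ = N * diagonal sgn * Nᵀ := by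
  apply inv_eq_left_inv
  rw [F.metric_eq]
  calc N * diagonal sgn * Nᵀ * ((E x)ᵀ * diagonal sgn * E x)
      = N * (diagonal sgn * (Nᵀ * (E x)ᵀ) * diagonal sgn) * E x := by simp only [mul_assoc]
    _ = 1 := by rw [F.transpose_inv', mul_one, diagonal_sgn_mul_self, mul_one, F.inv]

theorem metric_inv_transpose : ((g x)⁻¹)ᵀ = (g x)⁻¹ := by
  rw [F.metric_inv]; simp [mul_assoc]

theorem ginv_mul_transpose : (g x)⁻¹ * (E x)ᵀ = N * diagonal sgn := by
  rw [F.metric_inv, mul_assoc, F.transpose_inv', mul_one]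

theorem mul_ginv : E x * (g x)⁻¹ = diagonal sgn * Nᵀ := by
  rw [F.metric_inv, ← mul_assoc, ← mul_assoc, F.inv', one_mul]

theorem ginv_sum (μ a : Fin 4) : ∑ ν, ginv g x μ ν * E x a ν = N μ a * sgn a := by
  have := congrFun (congrFun F.ginv_mul_transpose μ) a
  rwa [mul_apply, mul_diagonal] at this

theorem pd_eq_sum (μ : Fin 4) (f : Pt → ℝ) : pd μ f x = ∑ a, E x a μ * frd N a f x := by
  simp only [frd, Finset.mul_sum]
  rw [Finset.sum_comm]
  have : ∀ ν, ∑ a, E x a μ * (N ν a * pd ν f x) = if ν = μ then pd ν f x else 0 := by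
    intro ν
    have h := F.inv_apply ν μ
    calc _ = (∑ a, N ν a * E x a μ) * pd ν f x := by
          rw [Finset.sum_mul]; exact Finset.sum_congr rfl fun a _ => by ring
      _ = _ := by rw [h]; split_ifs <;> simp
  simp [this]

/-- With `g = Σ ε_a E^a E^a` and `dE^a = 0`, four of the six terms of the Christoffel combination
cancel and the other two agree, leaving `2 Σ ε_a E^a_β ∂_μ E^a_ν`. Raising `β` produces a second
`ε_a`, and `ε_a² = 1`. -/
theorem christoffel_eq (α μ ν : Fin 4) :
    christoffel g x α μ ν = ∑ a, N α a * pd μ (fun x' => E x' a ν) x := by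
  have hpd : ∀ β μ ν, pd β (fun x' => g x' μ ν) x = ∑ a, sgn a *
      (pd β (fun x' => E x' a μ) x * E x a ν + E x a μ * pd β (fun x' => E x' a ν) x) := by
    intro β μ ν
    rw [pd_congr (F.metric.mono fun x' h => h μ ν), pd_sum]
    · refine Finset.sum_congr rfl fun a _ => ?_
      rw [pd_const_mul _ ((F.diff a μ).fun_mul (F.diff a ν)), pd_mul (F.diff a μ) (F.diff a ν)]
    · exact fun a _ => ((F.diff a μ).fun_mul (F.diff a ν)).const_mul _
  have hsum : ∀ β, pd μ (fun x' => g x' β ν) x + pd ν (fun x' => g x' β μ) x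
      - pd β (fun x' => g x' μ ν) x
      = ∑ a, E x a β * (2 * sgn a * pd μ (fun x' => E x' a ν) x) := by
    intro β
    rw [hpd, hpd, hpd, ← Finset.sum_add_distrib, ← Finset.sum_sub_distrib]
    refine Finset.sum_congr rfl fun a _ => ?_
    rw [F.closed a μ β, F.closed a ν β, F.closed a ν μ]
    ring
  simp only [christoffel, hsum, Finset.mul_sum]
  rw [Finset.sum_comm]
  refine Finset.sum_congr rfl fun a _ => ?_
  calc _ = (∑ β, ginv g x α β * E x a β) * (sgn a * pd μ (fun x' => E x' a ν) x) := by
        rw [Finset.sum_mul]; exact Finset.sum_congr rfl fun β _ => by ring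
    _ = N α a * (sgn a * sgn a) * pd μ (fun x' => E x' a ν) x := by rw [F.ginv_sum]; ring
    _ = _ := by rw [sgn_mul_self, mul_one]

/-- Covariant derivatives of vector fields are partial derivatives of the frame components. -/
theorem covVec_eq {ξ : Pt → Pt} (hξ : ∀ μ, DifferentiableAt ℝ (fun x' => ξ x' μ) x) :
    Matrix.of (covVec g ξ x)
      = (E x)ᵀ * Matrix.of (fun a b => frd N a (fun x' => ∑ β, E x' b β * ξ x' β) x) * Nᵀ := by
  ext μ ν
  have h1 : ((E x)ᵀ * Matrix.of (fun a b => frd N a (fun x' => ∑ β, E x' b β * ξ x' β) x) * Nᵀ) μ ν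
      = ∑ b, N ν b * pd μ (fun x' => ∑ β, E x' b β * ξ x' β) x := by
    rw [mul_apply]
    refine Finset.sum_congr rfl fun b _ => ?_
    rw [F.pd_eq_sum, mul_apply, mul_comm]
    simp
  have h2 : ∀ b, pd μ (fun x' => ∑ β, E x' b β * ξ x' β) x
      = ∑ β, (pd μ (fun x' => E x' b β) x * ξ x β + E x b β * pd μ (fun x' => ξ x' β) x) := by
    intro b
    rw [pd_sum fun β _ => (F.diff b β).fun_mul (hξ β)]
    exact Finset.sum_congr rfl fun β _ => pd_mul (F.diff b β) (hξ β) μ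
  have h3 : ∑ b, ∑ β, N ν b * (E x b β * pd μ (fun x' => ξ x' β) x)
      = pd μ (fun x' => ξ x' ν) x := by
    rw [Finset.sum_comm]
    simp_rw [← mul_assoc, ← Finset.sum_mul, F.inv_apply]
    simp
  rw [h1]
  simp only [h2, Finset.mul_sum, mul_add, Finset.sum_add_distrib, h3, of_apply, covVec,
    F.christoffel_eq, Finset.sum_mul]
  rw [add_comm, Finset.sum_comm]
  congr 1
  exact Finset.sum_congr rfl fun _ _ => Finset.sum_congr rfl fun _ _ => by ring

/-- The product rule on `h = E E H` gives two terms with derivatives of the coframe; by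
`christoffel_eq` they are exactly the two connection terms, so only the derivatives of `H` remain.
-/
theorem covTen_eq {h H : Tensor2} (hH : ∀ a b, DifferentiableAt ℝ (fun x' => H x' a b) x)
    (hh : ∀ᶠ x' in 𝓝 x, ∀ μ ν, h x' μ ν = ∑ a, ∑ b, E x' a μ * E x' b ν * H x' a b)
    (α : Fin 4) : Matrix.of (covTen g h x α)
      = (E x)ᵀ * Matrix.of (fun a b => pd α (fun x' => H x' a b) x) * E x := by
  ext μ ν
  have h0 := hh.self_of_nhds
  have h1 : pd α (fun x' => h x' μ ν) x = ∑ a, ∑ b,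
      (pd α (fun x' => E x' a μ) x * E x b ν * H x a b
      + E x a μ * pd α (fun x' => E x' b ν) x * H x a b
      + E x a μ * E x b ν * pd α (fun x' => H x' a b) x) := by
    have hd : ∀ a b, DifferentiableAt ℝ (fun x' => E x' a μ * E x' b ν) x :=
      fun a b => (F.diff a μ).fun_mul (F.diff b ν)
    rw [pd_congr (hh.mono fun x' h => h μ ν),
      pd_sum fun a _ => DifferentiableAt.fun_sum fun b _ => (hd a b).fun_mul (hH a b)]
    refine Finset.sum_congr rfl fun a _ => ?_
    rw [pd_sum fun b _ => (hd a b).fun_mul (hH a b)]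
    refine Finset.sum_congr rfl fun b _ => ?_
    rw [pd_mul (hd a b) (hH a b), pd_mul (F.diff a μ) (F.diff b ν)]
    ring
  have h2 : ∑ β, christoffel g x β α μ * h x β ν
      = ∑ a, ∑ b, pd α (fun x' => E x' a μ) x * E x b ν * H x a b := by
    have : ∀ β, christoffel g x β α μ * h x β ν = ∑ c, ∑ a, ∑ b,
        (E x a β * N β c) * (pd α (fun x' => E x' c μ) x * E x b ν * H x a b) := by
      intro β
      rw [F.christoffel_eq, h0, Finset.sum_mul]
      refine Finset.sum_congr rfl fun c _ => ?_
      rw [Finset.mul_sum]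
      refine Finset.sum_congr rfl fun a _ => ?_
      rw [Finset.mul_sum]
      exact Finset.sum_congr rfl fun b _ => by ring
    simp_rw [this]
    rw [Finset.sum_comm]
    refine Finset.sum_congr rfl fun c _ => ?_
    rw [Finset.sum_comm]
    rw [Finset.sum_eq_single c]
    · rw [Finset.sum_comm]
      refine Finset.sum_congr rfl fun b _ => ?_
      rw [← Finset.sum_mul, F.inv_apply']; simp
    · intro a _ hac
      rw [Finset.sum_comm]
      refine Finset.sum_eq_zero fun b _ => ?_
      rw [← Finset.sum_mul, F.inv_apply']; simp [hac]
    · simp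
  have h3 : ∑ β, christoffel g x β α ν * h x μ β
      = ∑ a, ∑ b, E x a μ * pd α (fun x' => E x' b ν) x * H x a b := by
    have : ∀ β, christoffel g x β α ν * h x μ β = ∑ c, ∑ b, ∑ a,
        (E x b β * N β c) * (E x a μ * pd α (fun x' => E x' c ν) x * H x a b) := by
      intro β
      rw [F.christoffel_eq, h0, Finset.sum_mul]
      refine Finset.sum_congr rfl fun c _ => ?_
      rw [Finset.mul_sum, Finset.sum_comm]
      refine Finset.sum_congr rfl fun a _ => ?_
      rw [Finset.mul_sum]
      exact Finset.sum_congr rfl fun b _ => by ring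
    simp_rw [this]
    rw [Finset.sum_comm, Finset.sum_comm (f := fun a b => E x a μ * _ * H x a b)]
    refine Finset.sum_congr rfl fun c _ => ?_
    rw [Finset.sum_comm]
    rw [Finset.sum_eq_single c]
    · rw [Finset.sum_comm]
      refine Finset.sum_congr rfl fun b _ => ?_
      rw [← Finset.sum_mul, F.inv_apply']; simp
    · intro a _ hac
      rw [Finset.sum_comm]
      refine Finset.sum_eq_zero fun b _ => ?_
      rw [← Finset.sum_mul, F.inv_apply']; simp [hac]
    · simp
  rw [of_apply, covTen, Finset.sum_add_distrib, h1, h2, h3, mul_apply]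
  simp only [Finset.sum_add_distrib, mul_apply, transpose_apply, of_apply, Finset.sum_mul]
  rw [add_sub_cancel_left, Finset.sum_comm]
  exact Finset.sum_congr rfl fun _ _ => Finset.sum_congr rfl fun _ _ => by ring

end IsFrame

/-- The frame components of the pre-symplectic potential, without the volume factor, in terms of
the derivatives `DH c a b` of the frame components of the perturbation. -/
def frameTheta (DH : Fin 4 → Fin 4 → Fin 4 → ℝ) (b : Fin 4) : ℝ :=
  ∑ c, sgn b * sgn c * DH c b c - ∑ c, sgn b * sgn c * DH b c c

/-- The frame components of the 2-form `S` before antisymmetrization, without the volume factor,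
in terms of the frame components `v` of the vector field, `H` of the perturbation, and of their
derivatives. -/
def frameS (v : Fin 4 → ℝ) (DX H : Fin 4 → Fin 4 → ℝ) (DH : Fin 4 → Fin 4 → Fin 4 → ℝ)
    (a b : Fin 4) : ℝ :=
  -(1 / 2) * (∑ c, sgn c * H c c) * (sgn a * DX a b) + ∑ c, sgn c * sgn a * H c a * DX c b
    - ∑ c, sgn a * sgn b * DH a b c * v c + v a * frameTheta DH b

/-- The frame components of a vector field. -/
def frameVec (E : Tensor2) (ξ : Pt → Pt) (x : Pt) (a : Fin 4) : ℝ := ∑ β, E x a β * ξ x β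

/-- `h` has frame components `H` near `x`. -/
structure HasFrameTen (E h H : Tensor2) (x : Pt) : Prop where
  diff : ∀ a b, DifferentiableAt ℝ (fun x' => H x' a b) x
  eq : ∀ᶠ x' in 𝓝 x, ∀ μ ν, h x' μ ν = ∑ a, ∑ b, E x' a μ * E x' b ν * H x' a b

theorem antisym_sandwich (N : Matrix (Fin 4) (Fin 4) ℝ) (t : Fin 4 → Fin 4 → ℝ) (μ ν : Fin 4) :
    antisym (fun μ ν => ∑ a, ∑ b, N μ a * N ν b * t a b) μ ν
      = ∑ a, ∑ b, N μ a * N ν b * antisym t a b := by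
  simp only [antisym]
  rw [Finset.sum_comm (f := fun a b => N ν a * N μ b * t a b), ← Finset.sum_sub_distrib,
    Finset.sum_div]
  refine Finset.sum_congr rfl fun a _ => ?_
  rw [← Finset.sum_sub_distrib, Finset.sum_div]
  exact Finset.sum_congr rfl fun b _ => by ring

namespace IsFrame
open Matrix
variable {g : Tensor2} {E : Tensor2} {N : Matrix (Fin 4) (Fin 4) ℝ} {x : Pt}
variable (F : IsFrame g E N x)
include F

omit F in
theorem sandwich_apply (N : Matrix (Fin 4) (Fin 4) ℝ) (t : Matrix (Fin 4) (Fin 4) ℝ)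
    (μ ν : Fin 4) : (N * t * Nᵀ) μ ν = ∑ a, ∑ b, N μ a * N ν b * t a b := by
  simp only [mul_apply, transpose_apply, Finset.sum_mul]
  rw [Finset.sum_comm]
  exact Finset.sum_congr rfl fun a _ => Finset.sum_congr rfl fun b _ => by ring

theorem vec_eq (ξ : Pt → Pt) (μ : Fin 4) : ξ x μ = ∑ a, N μ a * frameVec E ξ x a := by
  simp only [frameVec, Finset.mul_sum]
  rw [Finset.sum_comm]
  simp_rw [← mul_assoc, ← Finset.sum_mul, F.inv_apply]
  simp

theorem covVecUp_eq {ξ : Pt → Pt} (hξ : ∀ μ, DifferentiableAt ℝ (fun x' => ξ x' μ) x)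
    (μ ν : Fin 4) : covVecUp g ξ x μ ν
      = ∑ a, ∑ b, N μ a * N ν b * (sgn a * frd N a (fun x' => frameVec E ξ x' b) x) := by
  have h1 : covVecUp g ξ x μ ν = ((g x)⁻¹ * Matrix.of (covVec g ξ x)) μ ν := by
    simp [covVecUp, mul_apply, ginv]
  have h2 : (g x)⁻¹ * ((E x)ᵀ * Matrix.of (fun a b => frd N a (fun x' => frameVec E ξ x' b) x) * Nᵀ)
      = N * (diagonal sgn * Matrix.of (fun a b => frd N a (fun x' => frameVec E ξ x' b) x))
        * Nᵀ := by
    rw [← mul_assoc, ← mul_assoc, F.ginv_mul_transpose, mul_assoc N]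
  have h3 : Matrix.of (covVec g ξ x)
      = (E x)ᵀ * Matrix.of (fun a b => frd N a (fun x' => frameVec E ξ x' b) x) * Nᵀ :=
    F.covVec_eq hξ
  rw [h1, h3, h2, sandwich_apply]
  simp [diagonal_mul]

variable {h H : Tensor2} (T : HasFrameTen E h H x)
include T

omit F in
theorem ten_eq : h x = (E x)ᵀ * H x * E x := by
  ext μ ν
  rw [T.eq.self_of_nhds μ ν]
  simp only [mul_apply, transpose_apply, Finset.sum_mul]
  rw [Finset.sum_comm]
  exact Finset.sum_congr rfl fun a _ => Finset.sum_congr rfl fun b _ => by ring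

omit T in
theorem raise (C : Matrix (Fin 4) (Fin 4) ℝ) :
    (g x)⁻¹ * ((E x)ᵀ * C * E x) * (g x)⁻¹ = N * (diagonal sgn * C * diagonal sgn) * Nᵀ := by
  calc _ = ((g x)⁻¹ * (E x)ᵀ) * C * (E x * (g x)⁻¹) := by simp only [mul_assoc]
    _ = _ := by rw [F.ginv_mul_transpose, F.mul_ginv]; simp only [mul_assoc]

omit T in
theorem raise_apply (C : Matrix (Fin 4) (Fin 4) ℝ) (μ ν : Fin 4) :
    ∑ α, ∑ β, ginv g x μ α * ginv g x ν β * ((E x)ᵀ * C * E x) α β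
      = ∑ a, ∑ b, N μ a * N ν b * (sgn a * sgn b * C a b) := by
  have h1 : ∀ β, (g x)⁻¹ ν β = (g x)⁻¹ β ν := fun β =>
    congrFun (congrFun F.metric_inv_transpose β) ν
  have h2 := congrFun (congrFun (F.raise C) μ) ν
  rw [sandwich_apply] at h2
  simp only [ginv]
  rw [mul_apply] at h2
  simp only [mul_apply (M := (g x)⁻¹), Finset.sum_mul] at h2
  rw [Finset.sum_comm] at h2
  simp only [mul_diagonal, diagonal_mul] at h2
  calc _ = _ := Finset.sum_congr rfl fun a _ => Finset.sum_congr rfl fun b _ => by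
        rw [h1 b, mul_right_comm]
    _ = _ := h2
    _ = _ := Finset.sum_congr rfl fun a _ => Finset.sum_congr rfl fun b _ => by ring

omit T in
theorem contract (C : Matrix (Fin 4) (Fin 4) ℝ) :
    ∑ α, ∑ β, ginv g x α β * ((E x)ᵀ * C * E x) α β = ∑ c, sgn c * C c c := by
  have h1 : ∑ α, ∑ β, ginv g x α β * ((E x)ᵀ * C * E x) α β
      = ((g x)⁻¹ * ((E x)ᵀ * C * E x)).trace := by
    rw [Matrix.trace, Finset.sum_comm]
    refine Finset.sum_congr rfl fun α _ => ?_
    rw [diag_apply, mul_apply]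
    refine Finset.sum_congr rfl fun β _ => ?_
    rw [ginv, ← congrFun (congrFun F.metric_inv_transpose β) α, transpose_apply]
  rw [h1, ← mul_assoc, ← mul_assoc, F.ginv_mul_transpose, mul_assoc, trace_mul_comm,
    mul_assoc, ← mul_assoc (E x), F.inv', one_mul, trace_mul_comm, Matrix.trace]
  simp [diagonal_mul]

theorem trace_eq : Rindler.trace g h x = ∑ c, sgn c * H x c c := by
  rw [Rindler.trace, ten_eq T, F.contract]

theorem raised_eq (μ ν : Fin 4) :
    raised g h x μ ν = ∑ a, ∑ b, N μ a * N ν b * (sgn a * sgn b * H x a b) := by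
  rw [raised, ten_eq T, F.raise_apply]

theorem covTen_apply (α β γ : Fin 4) : covTen g h x α β γ
    = ((E x)ᵀ * Matrix.of (fun a b => pd α (fun x' => H x' a b) x) * E x) β γ := by
  rw [← F.covTen_eq T.diff T.eq]; rfl

omit T in
theorem ginv_pd (μ : Fin 4) (f : Pt → ℝ) :
    ∑ α, ginv g x μ α * pd α f x = ∑ a, N μ a * (sgn a * frd N a f x) := by
  simp_rw [F.pd_eq_sum, Finset.mul_sum]
  rw [Finset.sum_comm]
  refine Finset.sum_congr rfl fun a _ => ?_
  simp_rw [← mul_assoc, ← Finset.sum_mul, F.ginv_sum]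

theorem covTenUp_eq (σ μ ν : Fin 4) : covTenUp g h x σ μ ν = ∑ c, ∑ a, ∑ b,
    N σ c * N μ a * N ν b * (sgn c * sgn a * sgn b * frd N c (fun x' => H x' a b) x) := by
  have h1 : ∀ τ, ∑ α, ∑ β, ginv g x σ τ * ginv g x μ α * ginv g x ν β * covTen g h x τ α β
      = ∑ a, ∑ b, N μ a * N ν b * (sgn a * sgn b) *
        (ginv g x σ τ * pd τ (fun x' => H x' a b) x) := by
    intro τ
    calc _ = ginv g x σ τ * ∑ α, ∑ β, ginv g x μ α * ginv g x ν β * covTen g h x τ α β := by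
          simp only [Finset.mul_sum, mul_assoc]
      _ = _ := by
          simp_rw [F.covTen_apply T, F.raise_apply, Finset.mul_sum]
          exact Finset.sum_congr rfl fun a _ => Finset.sum_congr rfl fun b _ => by
            rw [of_apply]; ring
  rw [covTenUp]
  simp_rw [h1]
  rw [Finset.sum_comm, Finset.sum_comm (s := (Finset.univ : Finset (Fin 4)))
    (f := fun c a => ∑ b, N σ c * N μ a * N ν b * _)]
  refine Finset.sum_congr rfl fun a _ => ?_
  rw [Finset.sum_comm, Finset.sum_comm (f := fun c b => N σ c * N μ a * N ν b * _)]
  refine Finset.sum_congr rfl fun b _ => ?_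
  rw [← Finset.mul_sum, F.ginv_pd, Finset.mul_sum]
  exact Finset.sum_congr rfl fun c _ => by ring

theorem divTen_eq (μ : Fin 4) : divTen g h x μ = ∑ a, N μ a * ∑ c, sgn a * sgn c *
    frd N c (fun x' => H x' a c) x := by
  have h1 : ∀ α, ∑ β, ∑ σ, ginv g x μ β * ginv g x α σ * covTen g h x α β σ
      = ∑ a, ∑ c, N μ a * (sgn a * sgn c) * (N α c * pd α (fun x' => H x' a c) x) := by
    intro α
    simp_rw [F.covTen_apply T, F.raise_apply]
    exact Finset.sum_congr rfl fun a _ => Finset.sum_congr rfl fun b _ => by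
      rw [of_apply]; ring
  rw [divTen]
  simp_rw [h1]
  rw [Finset.sum_comm]
  refine Finset.sum_congr rfl fun a _ => ?_
  rw [Finset.sum_comm, Finset.mul_sum]
  refine Finset.sum_congr rfl fun c _ => ?_
  rw [← Finset.mul_sum, frd]; ring

theorem gradTrace_eq (μ : Fin 4) : gradTrace g h x μ = ∑ a, N μ a * ∑ c, sgn a * sgn c *
    frd N a (fun x' => H x' c c) x := by
  have h1 : ∀ σ, ∑ α, ∑ β, ginv g x μ σ * ginv g x α β * covTen g h x σ α β
      = ∑ c, sgn c * (ginv g x μ σ * pd σ (fun x' => H x' c c) x) := by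
    intro σ
    calc _ = ginv g x μ σ * ∑ α, ∑ β, ginv g x α β * covTen g h x σ α β := by
          simp only [Finset.mul_sum, mul_assoc]
      _ = _ := by
          simp_rw [F.covTen_apply T, F.contract, Finset.mul_sum]
          exact Finset.sum_congr rfl fun a _ => by rw [of_apply]; ring
  rw [gradTrace]
  simp_rw [h1]
  rw [Finset.sum_comm]
  simp_rw [← Finset.mul_sum, F.ginv_pd, Finset.mul_sum]
  rw [Finset.sum_comm]
  exact Finset.sum_congr rfl fun a _ => Finset.sum_congr rfl fun b _ => by ring

omit T in
theorem lower_vec (ξ : Pt → Pt) (b : Fin 4) :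
    ∑ α, N α b * ∑ β, g x α β * ξ x β = sgn b * frameVec E ξ x b := by
  have h1 : ∀ α, ∑ β, g x α β * ξ x β = ∑ a, sgn a * E x a α * frameVec E ξ x a := by
    intro α
    simp only [F.metric.self_of_nhds, frameVec, Finset.mul_sum, Finset.sum_mul]
    rw [Finset.sum_comm]
    exact Finset.sum_congr rfl fun a _ => Finset.sum_congr rfl fun b _ => by ring
  simp_rw [h1, Finset.mul_sum]
  rw [Finset.sum_comm]
  have h2 : ∀ a, ∑ α, N α b * (sgn a * E x a α * frameVec E ξ x a)
      = if a = b then sgn a * frameVec E ξ x a else 0 := by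
    intro a
    calc _ = (∑ α, E x a α * N α b) * (sgn a * frameVec E ξ x a) := by
          rw [Finset.sum_mul]; exact Finset.sum_congr rfl fun α _ => by ring
      _ = _ := by rw [F.inv_apply']; split_ifs <;> simp
  simp [h2]

omit T in
theorem noether_eq (Gn : ℝ) {ξ : Pt → Pt} (hξ : ∀ μ, DifferentiableAt ℝ (fun x' => ξ x' μ) x)
    (μ ν : Fin 4) : noether Gn g ξ x μ ν = -(sqrtNegDet g x / (8 * Real.pi * Gn)) *
      ∑ a, ∑ b, N μ a * N ν b *
        antisym (fun a b => sgn a * frd N a (fun x' => frameVec E ξ x' b) x) a b := by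
  rw [noether, ← antisym_sandwich]
  congr 2
  ext μ ν
  exact F.covVecUp_eq hξ μ ν

theorem theta_eq (Gn : ℝ) (μ : Fin 4) : theta Gn g h x μ
    = sqrtNegDet g x / (16 * Real.pi * Gn) *
      ∑ a, N μ a * frameTheta (fun c a b => frd N c (fun x' => H x' a b) x) a := by
  rw [theta, F.divTen_eq T, F.gradTrace_eq T, ← Finset.sum_sub_distrib]
  simp only [frameTheta, mul_sub]

/-- Each term is a contraction of `N N` with its frame counterpart, the last two combining into
`frameTheta`, and antisymmetrization commutes with this contraction (`antisym_sandwich`). -/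
theorem sForm_eq (Gn : ℝ) {ξ : Pt → Pt} (hξ : ∀ μ, DifferentiableAt ℝ (fun x' => ξ x' μ) x)
    (μ ν : Fin 4) : sForm Gn g h ξ x μ ν = sqrtNegDet g x / (8 * Real.pi * Gn) *
      ∑ a, ∑ b, N μ a * N ν b * antisym (frameS (frameVec E ξ x)
        (fun a b => frd N a (fun x' => frameVec E ξ x' b) x) (H x)
        (fun c a b => frd N c (fun x' => H x' a b) x)) a b := by
  rw [sForm, ← antisym_sandwich]
  congr 2
  ext μ ν
  have t1 : -(1 / 2) * Rindler.trace g h x * covVecUp g ξ x μ ν = ∑ a, ∑ b, N μ a * N ν b *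
      (-(1 / 2) * (∑ c, sgn c * H x c c) *
        (sgn a * frd N a (fun x' => frameVec E ξ x' b) x)) := by
    rw [F.trace_eq T, F.covVecUp_eq hξ]
    generalize ∑ c, sgn c * H x c c = t
    simp only [Finset.mul_sum]
    exact Finset.sum_congr rfl fun a _ => Finset.sum_congr rfl fun b _ => by ring
  have t2 : ∑ α, raised g h x α μ * covVec g ξ x α ν = ∑ a, ∑ b, N μ a * N ν b *
      ∑ c, sgn c * sgn a * H x c a * frd N c (fun x' => frameVec E ξ x' b) x := by
    have h1 : ∑ α, raised g h x α μ * covVec g ξ x α ν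
        = ((N * (diagonal sgn * H x * diagonal sgn) * Nᵀ)ᵀ * Matrix.of (covVec g ξ x)) μ ν := by
      rw [mul_apply]
      refine Finset.sum_congr rfl fun α _ => ?_
      rw [F.raised_eq T, transpose_apply, sandwich_apply, of_apply]
      simp only [mul_diagonal, diagonal_mul]
      congr 1
      exact Finset.sum_congr rfl fun a _ => Finset.sum_congr rfl fun b _ => by ring
    have h3 : Matrix.of (covVec g ξ x)
        = (E x)ᵀ * Matrix.of (fun a b => frd N a (fun x' => frameVec E ξ x' b) x) * Nᵀ :=
      F.covVec_eq hξ
    rw [h1, h3]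
    have h2 : (N * (diagonal sgn * H x * diagonal sgn) * Nᵀ)ᵀ * ((E x)ᵀ *
        Matrix.of (fun a b => frd N a (fun x' => frameVec E ξ x' b) x) * Nᵀ)
        = N * ((diagonal sgn * H x * diagonal sgn)ᵀ *
          Matrix.of (fun a b => frd N a (fun x' => frameVec E ξ x' b) x)) * Nᵀ := by
      rw [transpose_mul, transpose_mul, transpose_transpose]
      calc _ = N * ((diagonal sgn * H x * diagonal sgn)ᵀ * (Nᵀ * (E x)ᵀ) *
            Matrix.of (fun a b => frd N a (fun x' => frameVec E ξ x' b) x)) * Nᵀ := by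
            simp only [mul_assoc]
        _ = _ := by rw [F.transpose_inv', mul_one]
    rw [h2, sandwich_apply]
    refine Finset.sum_congr rfl fun a _ => Finset.sum_congr rfl fun b _ => ?_
    rw [mul_apply]
    congr 1
    refine Finset.sum_congr rfl fun c _ => ?_
    simp only [transpose_apply, mul_diagonal, diagonal_mul, of_apply]
    ring
  have t3 : ∑ α, ∑ β, covTenUp g h x μ ν α * g x α β * ξ x β = ∑ a, ∑ b, N μ a * N ν b *
      ∑ c, sgn a * sgn b * frd N a (fun x' => H x' b c) x * frameVec E ξ x c := by
    have h1 : ∀ α, ∑ β, covTenUp g h x μ ν α * g x α β * ξ x β = ∑ a, ∑ b, ∑ c,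
        N μ a * N ν b * (sgn a * sgn b * sgn c * frd N a (fun x' => H x' b c) x) *
          (N α c * ∑ β, g x α β * ξ x β) := by
      intro α
      have : ∑ β, covTenUp g h x μ ν α * g x α β * ξ x β
          = covTenUp g h x μ ν α * ∑ β, g x α β * ξ x β := by
        rw [Finset.mul_sum]; exact Finset.sum_congr rfl fun β _ => by ring
      rw [this, F.covTenUp_eq T]
      generalize ∑ β, g x α β * ξ x β = y
      simp only [Finset.sum_mul]
      exact Finset.sum_congr rfl fun a _ => Finset.sum_congr rfl fun b _ =>
        Finset.sum_congr rfl fun c _ => by ring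
    simp_rw [h1]
    rw [Finset.sum_comm]
    refine Finset.sum_congr rfl fun a _ => ?_
    rw [Finset.sum_comm]
    refine Finset.sum_congr rfl fun b _ => ?_
    rw [Finset.sum_comm, Finset.mul_sum]
    refine Finset.sum_congr rfl fun c _ => ?_
    rw [← Finset.mul_sum, F.lower_vec]
    linear_combination (N μ a * N ν b * sgn a * sgn b * frd N a (fun x' => H x' b c) x *
      frameVec E ξ x c) * sgn_mul_self c
  have t4 : ξ x μ * divTen g h x ν - ξ x μ * gradTrace g h x ν = ∑ a, ∑ b, N μ a * N ν b *
      (frameVec E ξ x a * frameTheta (fun c a b => frd N c (fun x' => H x' a b) x) b) := by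
    rw [← mul_sub, F.divTen_eq T, F.gradTrace_eq T, ← Finset.sum_sub_distrib, F.vec_eq ξ μ,
      Finset.sum_mul]
    refine Finset.sum_congr rfl fun a _ => ?_
    rw [Finset.mul_sum]
    refine Finset.sum_congr rfl fun b _ => ?_
    rw [frameTheta]; ring
  rw [add_sub_assoc, t4, t1, t2, t3]
  simp only [frameS, mul_add, mul_sub, Finset.sum_add_distrib, Finset.sum_sub_distrib]

end IsFrame

/-! ### The inertial frame near the horizon -/

section det
variable {p : ℝ × Pt} {n : ℕ}

theorem contDiffAt_det {A : ℝ × Pt → Matrix (Fin n) (Fin n) ℝ}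
    (hA : ∀ i j, ContDiffAt ℝ ∞ (fun q => A q i j) p) :
    ContDiffAt ℝ ∞ (fun q => (A q).det) p := by
  simp only [Matrix.det_apply]
  exact ContDiffAt.sum fun σ _ => (contDiffAt_prod fun i _ => hA _ _).const_smul _

theorem Stat.det {A : ℝ × Pt → Matrix (Fin n) (Fin n) ℝ}
    (hA : ∀ i j, Stat p (fun q => A q i j)) : Stat p (fun q => (A q).det) := by
  simp only [Matrix.det_apply, Units.smul_def, zsmul_eq_mul]
  exact Stat.sum fun σ _ => (Stat.prod fun i _ => hA _ _).const_mul _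

theorem Stat.inv {f : ℝ × Pt → ℝ} (hf : Stat p f) (hs : ContDiffAt ℝ ∞ f p) (h : f p ≠ 0) :
    Stat p fun q => (f q)⁻¹ := by
  have hi : Ord p 0 fun q => (f q)⁻¹ := Ord.inv hs h
  refine ⟨hi, (hi.mul' (n := 1) (hi.mul' (n := 1) hf.xd_zero)).neg.congr ?_⟩
  filter_upwards [eventually_wedgeNhds (hs.continuousAt.eventually_ne h),
    eventually_wedgeNhds (eventually_contDiffAt_nat hs 1),
    hi.eventually_differentiableAt] with q h1 h2 h3
  have h4 := xd_mul (h2.differentiableAt (by simp)) h3 0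
  have h5 : Rindler.xd 0 (fun q => f q * (f q)⁻¹) q = 0 := by
    rw [xd_eq_of_eventuallyEq (g := fun _ => 1), xd_const]
    filter_upwards [h2.continuousAt.eventually_ne h1] with q' hq'
    exact mul_inv_cancel₀ hq'
  rw [h5] at h4
  field_simp at h4 ⊢
  linarith

end det

/-- The functions `c` are the components of a family of diffeomorphisms
`(τ + P, ρ, G^y, G^z) + O(ρ²)` near the point `p` of the horizon. -/
structure IsChart (p : ℝ × Pt) (c : Fin 4 → ℝ × Pt → ℝ) : Prop where
  horizon : p.2 1 = 0
  smooth : ∀ α, ContDiffAt ℝ ∞ (c α) p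
  rad : Ord p 2 fun q => c 1 q - q.2 1
  time : StatSq p fun q => c 0 q - q.2 0
  two : StatSq p (c 2)
  three : StatSq p (c 3)
  regular : (Matrix.of fun α μ => xd μ (c α) p).det ≠ 0

/-- The Jacobian matrix. -/
def jac (c : Fin 4 → ℝ × Pt → ℝ) (q : ℝ × Pt) : Matrix (Fin 4) (Fin 4) ℝ :=
  Matrix.of fun α μ => xd μ (c α) q

/-- The inertial coordinates. -/
def inertial (κ : ℝ) (c : Fin 4 → ℝ × Pt → ℝ) : Fin 4 → ℝ × Pt → ℝ :=
  ![fun q => c 1 q * Real.sinh (κ * c 0 q), fun q => c 1 q * Real.cosh (κ * c 0 q), c 2, c 3]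

/-- The dual frame of the inertial coordinates. -/
def frame (κ : ℝ) (c : Fin 4 → ℝ × Pt → ℝ) (q : ℝ × Pt) : Matrix (Fin 4) (Fin 4) ℝ :=
  Matrix.of fun μ =>
    ![(jac c q)⁻¹ μ 0 * (Real.cosh (κ * c 0 q) * (κ * c 1 q)⁻¹)
        - (jac c q)⁻¹ μ 1 * Real.sinh (κ * c 0 q),
      (jac c q)⁻¹ μ 1 * Real.cosh (κ * c 0 q)
        - (jac c q)⁻¹ μ 0 * (Real.sinh (κ * c 0 q) * (κ * c 1 q)⁻¹),
      (jac c q)⁻¹ μ 2, (jac c q)⁻¹ μ 3]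

/-- The derivative along a vector of the frame of the inertial coordinates. -/
def fd (κ : ℝ) (c : Fin 4 → ℝ × Pt → ℝ) (a : Fin 4) (f : ℝ × Pt → ℝ) (q : ℝ × Pt) : ℝ :=
  ∑ μ, frame κ c q μ a * xd μ f q

namespace IsChart
variable {p : ℝ × Pt} {c : Fin 4 → ℝ × Pt → ℝ} (X : IsChart p c)
include X

theorem contDiffAt_jac (α μ : Fin 4) : ContDiffAt ℝ ∞ (fun q => jac c q α μ) p :=
  contDiffAt_xd (X.smooth α) μ

omit X in
theorem contDiffAt_coord (μ : Fin 4) : ContDiffAt ℝ ∞ (fun q : ℝ × Pt => q.2 μ) p := by fun_prop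

omit X in
theorem xd_coord (μ ν : Fin 4) (q : ℝ × Pt) :
    xd μ (fun q => q.2 ν) q = if ν = μ then 1 else 0 := by
  have h1 : HasFDerivAt (fun x : Pt => x ν) (ContinuousLinearMap.proj ν) q.2 :=
    (ContinuousLinearMap.proj (R := ℝ) (φ := fun _ : Fin 4 => ℝ) ν).hasFDerivAt
  simp [xd, pd, h1.fderiv, Pi.single_apply]

theorem jac_sub_eventually (α : Fin 4) (μ : Fin 4) : (fun q => jac c q α μ
    - if α = μ then 1 else 0) =ᶠ[wedgeNhds p] xd μ fun q => c α q - q.2 α := by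
  filter_upwards [eventually_wedgeNhds (eventually_contDiffAt_nat (X.smooth α) 1)] with q hq
  rw [xd_sub (hq.differentiableAt (by simp)) (by fun_prop), xd_coord]
  rfl

theorem jac_zero (α : Fin 4) : Ord p 2 fun q => jac c q α 0 - if α = 0 then 1 else 0 := by
  fin_cases α
  · exact X.time.xd_zero.congr (X.jac_sub_eventually 0 0)
  · exact (X.rad.xd_of_ne (by decide)).congr (X.jac_sub_eventually 1 0)
  · simpa using! X.two.xd_zero
  · simpa using! X.three.xd_zero

theorem jac_one (α : Fin 4) : Ord p 1 fun q => jac c q α 1 - if α = 1 then 1 else 0 := by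
  fin_cases α
  · exact X.time.xd_one.congr (X.jac_sub_eventually 0 1)
  · exact (X.rad.xd 1).congr (X.jac_sub_eventually 1 1)
  · simpa using! X.two.xd_one
  · simpa using! X.three.xd_one

theorem jac_rad {μ : Fin 4} (hμ : μ ≠ 1) : Ord p 2 fun q => jac c q 1 μ := by
  refine (X.rad.xd_of_ne hμ).congr ?_
  simpa [Ne.symm hμ] using X.jac_sub_eventually 1 μ

theorem jac_rad' (μ : Fin 4) : Ord p 1 fun q => jac c q 1 μ - if 1 = μ then 1 else 0 :=
  (X.rad.xd μ).congr (X.jac_sub_eventually 1 μ)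

theorem jac_statSq {α μ : Fin 4} (hα : α ≠ 1) (hμ : μ ≠ 1) : StatSq p fun q => jac c q α μ := by
  fin_cases α
  · have h : StatSq p fun q => jac c q 0 μ - if 0 = μ then 1 else 0 :=
      (X.time.xd hμ).congr (X.jac_sub_eventually 0 μ)
    exact (h.add (StatSq.const (if 0 = μ then 1 else 0))).congr
      (Eventually.of_forall fun q => by simp)
  · exact absurd rfl hα
  · exact X.two.xd hμ
  · exact X.three.xd hμ

theorem stat_jac (α μ : Fin 4) : Stat p fun q => jac c q α μ := by
  by_cases hμ : μ = 1
  · subst hμ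
    exact ((X.jac_one α).stat.add (Stat.const (if α = 1 then 1 else 0))).congr
      (Eventually.of_forall fun q => by simp)
  · by_cases hα : α = 1
    · subst hα
      exact ((X.jac_rad hμ).mono (by norm_num)).stat
    · exact (X.jac_statSq hα hμ).stat

theorem det_ne : (jac c p).det ≠ 0 := X.regular

theorem contDiffAt_det_jac : ContDiffAt ℝ ∞ (fun q => (jac c q).det) p :=
  contDiffAt_det X.contDiffAt_jac

theorem eventually_det_ne : ∀ᶠ q in 𝓝 p, (jac c q).det ≠ 0 :=
  X.contDiffAt_det_jac.continuousAt.eventually_ne X.det_ne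

theorem stat_inv (μ α : Fin 4) : Stat p fun q => (jac c q)⁻¹ μ α := by
  have h : Stat p fun q => ((jac c q).det)⁻¹ * (jac c q).adjugate μ α := by
    refine ((Stat.det X.stat_jac).inv X.contDiffAt_det_jac X.det_ne).mul ?_
    simp only [Matrix.adjugate_apply]
    refine Stat.det fun i j => ?_
    by_cases hi : i = α
    · subst hi; simpa using Stat.const _
    · simpa [Matrix.updateRow_ne hi] using X.stat_jac i j
  refine h.congr (Eventually.of_forall fun q => ?_)
  change (jac c q)⁻¹ μ α = (jac c q).det⁻¹ * (jac c q).adjugate μ α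
  rw [Matrix.inv_def, Ring.inverse_eq_inv']
  rfl

theorem inv_mul : ∀ᶠ q in wedgeNhds p, (jac c q)⁻¹ * jac c q = 1 := by
  filter_upwards [eventually_wedgeNhds X.eventually_det_ne] with q hq
  exact Matrix.nonsing_inv_mul _ (isUnit_iff_ne_zero.2 hq)

theorem mul_inv : ∀ᶠ q in wedgeNhds p, jac c q * (jac c q)⁻¹ = 1 := by
  filter_upwards [eventually_wedgeNhds X.eventually_det_ne] with q hq
  exact Matrix.mul_nonsing_inv _ (isUnit_iff_ne_zero.2 hq)

/-- From `J⁻¹ - 1 = -J⁻¹ (J - 1)`, a column in which `J` is close to the identity stays so in `J⁻¹`.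
For the `ρ` row, `inv_rad` uses `J⁻¹ - 1 = -(J - 1) J⁻¹` instead. -/
theorem inv_col {k : ℤ} {β : Fin 4}
    (h : ∀ α, Ord p k fun q => jac c q α β - if α = β then 1 else 0) (μ : Fin 4) :
    Ord p k fun q => (jac c q)⁻¹ μ β - if μ = β then 1 else 0 := by
  refine (Ord.neg (Ord.sum (s := Finset.univ) fun α _ =>
    (X.stat_inv μ α).ord.mul' (h α) (by simp))).congr ?_
  filter_upwards [X.inv_mul] with q hq
  have := congrFun (congrFun hq μ) β
  rw [Matrix.mul_apply, Matrix.one_apply] at this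
  simp only [mul_sub, Finset.sum_sub_distrib, this]
  simp

theorem inv_zero (μ : Fin 4) : Ord p 2 fun q => (jac c q)⁻¹ μ 0 - if μ = 0 then 1 else 0 :=
  X.inv_col X.jac_zero μ

theorem inv_one (μ : Fin 4) : Ord p 1 fun q => (jac c q)⁻¹ μ 1 - if μ = 1 then 1 else 0 :=
  X.inv_col X.jac_one μ

theorem inv_rad (ν : Fin 4) : Ord p 1 fun q => (jac c q)⁻¹ 1 ν - if 1 = ν then 1 else 0 := by
  refine (Ord.neg (Ord.sum (s := Finset.univ) fun α _ =>
    (X.jac_rad' α).mul' (X.stat_inv α ν).ord (by simp))).congr ?_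
  filter_upwards [X.mul_inv] with q hq
  have := congrFun (congrFun hq 1) ν
  rw [Matrix.mul_apply, Matrix.one_apply] at this
  simp only [sub_mul, Finset.sum_sub_distrib, this]
  simp

/-- Since `γ^ρ = ρ + ρ² K`, the factor is `v = 1 + ρ K`. It is a unit at `p`, so `γ^ρ` can be
inverted at the cost of exactly one power of `ρ`. -/
theorem exists_rad : ∃ v : ℝ × Pt → ℝ, ContDiffAt ℝ ∞ v p ∧ v p = 1 ∧
    ∀ᶠ q in wedgeNhds p, c 1 q = q.2 1 * v q := by
  obtain ⟨K, hK, h⟩ := X.rad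
  refine ⟨fun q => 1 + q.2 1 * K q, contDiffAt_const.add ((contDiffAt_coord 1).mul hK), ?_, ?_⟩
  · simp [X.horizon]
  · filter_upwards [h] with q hq
    have : c 1 q = q.2 1 + q.2 1 ^ (2 : ℤ) * K q := by rw [← hq]; ring
    rw [this, zpow_ofNat]; ring

theorem rad_pos : ∀ᶠ q in wedgeNhds p, 0 < c 1 q := by
  obtain ⟨v, hv, hvp, h⟩ := X.exists_rad
  filter_upwards [h, eventually_pos p,
    eventually_wedgeNhds (hv.continuousAt.eventually_const_lt (u := 0) (by simp [hvp]))]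
    with q h1 h2 h3
  rw [h1]; positivity

theorem ord_rad : Ord p 1 (c 1) := by
  refine ((X.rad.mono (by norm_num)).add Ord.rho).congr (Eventually.of_forall fun q => by simp)

variable {κ : ℝ}

theorem ord_inv_rad (hκ : 0 < κ) : Ord p (-1) fun q => (κ * c 1 q)⁻¹ := by
  obtain ⟨v, hv, hvp, h⟩ := X.exists_rad
  refine ⟨fun q => (κ * v q)⁻¹, (contDiffAt_const.mul hv).inv (by simp [hvp, hκ.ne']), ?_⟩
  filter_upwards [h] with q hq
  rw [hq, zpow_neg_one]; ring

theorem contDiffAt_cosh : ContDiffAt ℝ ∞ (fun q => Real.cosh (κ * c 0 q)) p :=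
  Real.contDiff_cosh.contDiffAt.comp p (contDiffAt_const.mul (X.smooth 0))

theorem contDiffAt_sinh : ContDiffAt ℝ ∞ (fun q => Real.sinh (κ * c 0 q)) p :=
  Real.contDiff_sinh.contDiffAt.comp p (contDiffAt_const.mul (X.smooth 0))

theorem ord_cosh : Ord p 0 fun q => Real.cosh (κ * c 0 q) := Ord.of_contDiffAt X.contDiffAt_cosh

theorem ord_sinh : Ord p 0 fun q => Real.sinh (κ * c 0 q) := Ord.of_contDiffAt X.contDiffAt_sinh

/-- The pole `(κ γ^ρ)⁻¹` multiplies only the entry `J⁻¹ μ 0`, which must therefore have one order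
more than `J⁻¹ μ 1`. -/
theorem ord_frame_two {k m : ℤ} {μ : Fin 4} (h0 : Ord p m fun q => (jac c q)⁻¹ μ 0)
    (h1 : Ord p k fun q => (jac c q)⁻¹ μ 1) (hm : k + 1 ≤ m) (hκ : 0 < κ) {a : Fin 4} (ha : a = 0 ∨ a = 1) :
    Ord p k fun q => frame κ c q μ a := by
  rcases ha with rfl | rfl
  · exact (h0.mul' (X.ord_cosh.mul (X.ord_inv_rad hκ)) (by linarith)).sub (h1.mul' X.ord_sinh (by simp))
  · exact (h1.mul' X.ord_cosh (by simp)).sub (h0.mul' (X.ord_sinh.mul (X.ord_inv_rad hκ)) (by linarith))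

theorem frame_time (hκ : 0 < κ) (a : Fin 4) : Ord p (-1) fun q => frame κ c q 0 a := by
  have h : ∀ {a : Fin 4}, a = 0 ∨ a = 1 → Ord p (-1) fun q => frame κ c q 0 a :=
    X.ord_frame_two (X.stat_inv 0 0).ord ((X.stat_inv 0 1).ord.mono (by norm_num)) (by norm_num) hκ
  fin_cases a
  · exact h (Or.inl rfl)
  · exact h (Or.inr rfl)
  · exact (X.stat_inv 0 2).ord.mono (by norm_num)
  · exact (X.stat_inv 0 3).ord.mono (by norm_num)

theorem frame_stat (μ : Fin 4) {a : Fin 4} (ha : a = 2 ∨ a = 3) :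
    Stat p fun q => frame κ c q μ a := by
  rcases ha with rfl | rfl
  exacts [X.stat_inv μ 2, X.stat_inv μ 3]

/-- The pole meets `J⁻¹ 1 0`, which is `O(ρ)` because the `ρ` row of `J⁻¹` is that of the identity
on the horizon. -/
theorem frame_rad (hκ : 0 < κ) (a : Fin 4) : Ord p 0 fun q => frame κ c q 1 a := by
  have h : ∀ {a : Fin 4}, a = 0 ∨ a = 1 → Ord p 0 fun q => frame κ c q 1 a :=
    X.ord_frame_two (m := 1) (by simpa using X.inv_rad 0) (X.stat_inv 1 1).ord (by norm_num) hκ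
  fin_cases a
  · exact h (Or.inl rfl)
  · exact h (Or.inr rfl)
  · exact (X.stat_inv 1 2).ord
  · exact (X.stat_inv 1 3).ord

theorem frame_rad_angle {a : Fin 4} (ha : a = 2 ∨ a = 3) : Ord p 1 fun q => frame κ c q 1 a := by
  rcases ha with rfl | rfl
  · simpa using! X.inv_rad 2
  · simpa using! X.inv_rad 3

/-- Here `J⁻¹ μ 0` is `O(ρ²)`: it absorbs the pole with one power to spare. -/
theorem frame_angle (hκ : 0 < κ) {μ a : Fin 4} (hμ : μ = 2 ∨ μ = 3) (ha : a = 0 ∨ a = 1) :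
    Ord p 1 fun q => frame κ c q μ a := by
  refine X.ord_frame_two (m := 2) ?_ ?_ (by norm_num) hκ ha
  · rcases hμ with rfl | rfl
    exacts [by simpa using X.inv_zero 2, by simpa using X.inv_zero 3]
  · rcases hμ with rfl | rfl
    exacts [by simpa using X.inv_one 2, by simpa using X.inv_one 3]

theorem frame_angle' (hκ : 0 < κ) {μ : Fin 4} (hμ : μ = 2 ∨ μ = 3) (a : Fin 4) :
    Ord p 0 fun q => frame κ c q μ a := by
  have h : a = 0 ∨ a = 1 ∨ a = 2 ∨ a = 3 := by fin_cases a <;> simp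
  rcases h with h | h | h | h
  · exact (X.frame_angle hκ hμ (Or.inl h)).mono (by norm_num)
  · exact (X.frame_angle hκ hμ (Or.inr h)).mono (by norm_num)
  · exact (X.frame_stat μ (Or.inl h)).ord
  · exact (X.frame_stat μ (Or.inr h)).ord

end IsChart

/-- The coframe of the inertial coordinates. -/
def coframe (κ : ℝ) (c : Fin 4 → ℝ × Pt → ℝ) (q : ℝ × Pt) : Matrix (Fin 4) (Fin 4) ℝ :=
  Matrix.of fun a μ => xd μ (inertial κ c a) q

/-- The matrix of the inertial coframe in the coframe of the Rindler coordinates. -/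
def boost (κ : ℝ) (c : Fin 4 → ℝ × Pt → ℝ) (q : ℝ × Pt) : Matrix (Fin 4) (Fin 4) ℝ :=
  !![κ * c 1 q * Real.cosh (κ * c 0 q), Real.sinh (κ * c 0 q), 0, 0;
     κ * c 1 q * Real.sinh (κ * c 0 q), Real.cosh (κ * c 0 q), 0, 0;
     0, 0, 1, 0;
     0, 0, 0, 1]

theorem coframe_eq {κ : ℝ} {c : Fin 4 → ℝ × Pt → ℝ} {q : ℝ × Pt}
    (hc : ∀ α, DifferentiableAt ℝ (c α) q) : coframe κ c q = boost κ c q * jac c q := by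
  have h0 : HasFDerivAt (fun q => κ * c 0 q) (κ • fderiv ℝ (c 0) q) q :=
    (hc 0).hasFDerivAt.const_mul κ
  have hs : ∀ μ, xd μ (fun q => Real.sinh (κ * c 0 q)) q
      = κ * Real.cosh (κ * c 0 q) * xd μ (c 0) q := by
    intro μ
    rw [xd_eq_fderiv h0.sinh.differentiableAt, h0.sinh.fderiv, xd_eq_fderiv (hc 0)]
    simp; ring
  have hh : ∀ μ, xd μ (fun q => Real.cosh (κ * c 0 q)) q
      = κ * Real.sinh (κ * c 0 q) * xd μ (c 0) q := by
    intro μ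
    rw [xd_eq_fderiv h0.cosh.differentiableAt, h0.cosh.fderiv, xd_eq_fderiv (hc 0)]
    simp; ring
  ext a μ
  rw [Matrix.mul_apply, Fin.sum_univ_four]
  fin_cases a
  · simp only [coframe, boost, jac, inertial, Matrix.of_apply, Fin.zero_eta, Matrix.cons_val]
    rw [xd_mul (hc 1) h0.sinh.differentiableAt, hs]
    ring
  · simp only [coframe, boost, jac, inertial, Matrix.of_apply, Fin.mk_one, Matrix.cons_val]
    rw [xd_mul (hc 1) h0.cosh.differentiableAt, hh]
    ring
  · simp [coframe, boost, jac, inertial]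
  · simp [coframe, boost, jac, inertial]

theorem det_boost (κ : ℝ) (c : Fin 4 → ℝ × Pt → ℝ) (q : ℝ × Pt) :
    (boost κ c q).det = κ * c 1 q := by
  have h := Real.cosh_sq_sub_sinh_sq (κ * c 0 q)
  simp [boost, Matrix.det_succ_row_zero, Fin.sum_univ_succ, Fin.succAbove]
  linear_combination (κ * c 1 q) * h

/-- The matrix `frame` is `J⁻¹` times the explicit inverse of `boost`, whose determinant `κ γ^ρ` is
the source of the pole. -/
theorem frame_mul_boost {κ : ℝ} {c : Fin 4 → ℝ × Pt → ℝ} {q : ℝ × Pt} (h : κ * c 1 q ≠ 0) :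
    frame κ c q * boost κ c q = (jac c q)⁻¹ := by
  have h1 := Real.cosh_sq_sub_sinh_sq (κ * c 0 q)
  ext μ ν
  rw [Matrix.mul_apply, Fin.sum_univ_four]
  have hi : κ * c 1 q * (κ * c 1 q)⁻¹ = 1 := mul_inv_cancel₀ h
  fin_cases ν
  · simp [frame, boost, -mul_inv_rev]
    linear_combination ((jac c q)⁻¹ μ 0) * h1 + (jac c q)⁻¹ μ 0 * (Real.cosh (κ * c 0 q) ^ 2 -
      Real.sinh (κ * c 0 q) ^ 2) * hi
  · simp [frame, boost, -mul_inv_rev]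
    linear_combination ((jac c q)⁻¹ μ 1) * h1
  · simp [frame, boost, -mul_inv_rev]
  · simp [frame, boost, -mul_inv_rev]

/-- The pullback of the Rindler metric under the map with components `c`. -/
def metricC (κ : ℝ) (c : Fin 4 → ℝ × Pt → ℝ) (q : ℝ × Pt) : Matrix (Fin 4) (Fin 4) ℝ :=
  Matrix.of fun μ ν => ∑ α, ∑ β, jac c q α μ * jac c q β ν *
    Matrix.diagonal ![-(κ ^ 2 * c 1 q ^ 2), 1, 1, 1] α β

/-- Flatness of the Rindler metric: `-κ²ρ² dτ² + dρ² = -dT² + dX²` for `T = ρ sinh κτ` and `X = ρ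
cosh κτ`, pulled back by the map. -/
theorem metricC_eq {κ : ℝ} {c : Fin 4 → ℝ × Pt → ℝ} {q : ℝ × Pt}
    (hc : ∀ α, DifferentiableAt ℝ (c α) q) (μ ν : Fin 4) :
    metricC κ c q μ ν = ∑ a, sgn a * (coframe κ c q a μ * coframe κ c q a ν) := by
  have h1 := Real.cosh_sq_sub_sinh_sq (κ * c 0 q)
  rw [coframe_eq hc]
  simp only [metricC, Matrix.of_apply, Matrix.mul_apply, Fin.sum_univ_four, sgn, boost,
    Matrix.cons_val, Matrix.diagonal_apply]
  simp
  linear_combination (κ ^ 2 * c 1 q ^ 2 * jac c q 0 μ * jac c q 0 ν - jac c q 1 μ * jac c q 1 ν) * h1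

theorem fd_congr {κ : ℝ} {c : Fin 4 → ℝ × Pt → ℝ} {p : ℝ × Pt} {f g : ℝ × Pt → ℝ}
    (h : f =ᶠ[wedgeNhds p] g) (a : Fin 4) : fd κ c a f =ᶠ[wedgeNhds p] fd κ c a g := by
  filter_upwards [eventually_eventually_wedgeNhds h] with q hq
  exact Finset.sum_congr rfl fun μ _ => by rw [xd_eq_of_eventuallyEq hq]

theorem fd_mul {κ : ℝ} {c : Fin 4 → ℝ × Pt → ℝ} {q : ℝ × Pt} {f g : ℝ × Pt → ℝ}
    (hf : DifferentiableAt ℝ f q) (hg : DifferentiableAt ℝ g q) (a : Fin 4) :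
    fd κ c a (fun q => f q * g q) q = fd κ c a f q * g q + f q * fd κ c a g q := by
  simp only [fd, xd_mul hf hg, mul_add, Finset.sum_add_distrib, Finset.sum_mul, Finset.mul_sum]
  congr 1
  · exact Finset.sum_congr rfl fun _ _ => by ring
  · exact Finset.sum_congr rfl fun _ _ => by ring

theorem fd_add {κ : ℝ} {c : Fin 4 → ℝ × Pt → ℝ} {q : ℝ × Pt} {f g : ℝ × Pt → ℝ}
    (hf : DifferentiableAt ℝ f q) (hg : DifferentiableAt ℝ g q) (a : Fin 4) :
    fd κ c a (fun q => f q + g q) q = fd κ c a f q + fd κ c a g q := by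
  simp only [fd, xd_add hf hg, mul_add, Finset.sum_add_distrib]

theorem fd_const {κ : ℝ} {c : Fin 4 → ℝ × Pt → ℝ} {q : ℝ × Pt} (k : ℝ) (a : Fin 4) :
    fd κ c a (fun _ => k) q = 0 := by
  simp [fd, xd_const]

theorem fd_const_mul {κ : ℝ} {c : Fin 4 → ℝ × Pt → ℝ} {q : ℝ × Pt} {f : ℝ × Pt → ℝ}
    (k : ℝ) (hf : DifferentiableAt ℝ f q) (a : Fin 4) :
    fd κ c a (fun q => k * f q) q = k * fd κ c a f q := by
  rw [fd_mul (by fun_prop) hf, fd_const]; ring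

namespace IsChart
variable {p : ℝ × Pt} {c : Fin 4 → ℝ × Pt → ℝ} (X : IsChart p c) {κ : ℝ}
include X

theorem eventually_contDiffAt (n : ℕ) : ∀ᶠ q in wedgeNhds p, ∀ α, ContDiffAt ℝ n (c α) q :=
  eventually_all.2 fun α => eventually_wedgeNhds (eventually_contDiffAt_nat (X.smooth α) n)

theorem contDiffAt_inertial (a : Fin 4) : ContDiffAt ℝ ∞ (inertial κ c a) p := by
  fin_cases a
  · exact (X.smooth 1).mul X.contDiffAt_sinh
  · exact (X.smooth 1).mul X.contDiffAt_cosh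
  · exact X.smooth 2
  · exact X.smooth 3

theorem eventually_coframe : ∀ᶠ q in wedgeNhds p, coframe κ c q = boost κ c q * jac c q := by
  filter_upwards [X.eventually_contDiffAt 1] with q hq
  exact coframe_eq fun α => (hq α).differentiableAt (by simp)

theorem frame_mul_coframe (hκ : 0 < κ) :
    ∀ᶠ q in wedgeNhds p, frame κ c q * coframe κ c q = 1 := by
  filter_upwards [X.eventually_coframe, X.inv_mul, X.rad_pos] with q h1 h2 h3
  rw [h1, ← mul_assoc, frame_mul_boost (by positivity), h2]

theorem coframe_mul_frame (hκ : 0 < κ) :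
    ∀ᶠ q in wedgeNhds p, coframe κ c q * frame κ c q = 1 := by
  filter_upwards [X.frame_mul_coframe hκ] with q h
  exact mul_eq_one_comm.1 h

theorem isFrame (hκ : 0 < κ) : ∀ᶠ q in wedgeNhds p, IsFrame (fun x => metricC κ c (q.1, x))
    (fun x => coframe κ c (q.1, x)) (frame κ c q) q.2 := by
  have h : ∀ᶠ q in wedgeNhds p, ∀ a, ContDiffAt ℝ 2 (inertial κ c a) q :=
    eventually_all.2 fun α => eventually_wedgeNhds
      (eventually_contDiffAt_nat (X.contDiffAt_inertial α) 2)
  filter_upwards [h, X.frame_mul_coframe hκ,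
    eventually_eventually_wedgeNhds (X.eventually_contDiffAt 1)] with q h1 h2 h3
  refine ⟨?_, fun a μ => ?_, fun a μ ν => xd_xd_comm (h1 a) μ ν, h2⟩
  · have : Tendsto (fun x => (q.1, x)) (𝓝 q.2) (𝓝 q) :=
      (continuous_const.prodMk continuous_id).tendsto' _ _ rfl
    filter_upwards [this.eventually h3] with x hx μ ν
    exact metricC_eq (fun α => (hx α).differentiableAt (by simp)) μ ν
  · have hd : DifferentiableAt ℝ (xd μ (inertial κ c a)) q :=
      (differentiableAt_fderiv_apply (h1 a) (xdir μ)).congr_of_eventuallyEq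
        (xd_eventuallyEq ((h1 a).of_le (by norm_num)) μ)
    exact DifferentiableAt.comp (f := fun x => (q.1, x)) q.2 hd (by fun_prop)

/-- The metric is `Eᵀ η E` with `E = boost * J` and `det η = -1`. The resulting simple zero in `ρ`
compensates the pole of the frame. -/
theorem sqrt_det (hκ : 0 < κ) : ∀ᶠ q in wedgeNhds p,
    sqrtNegDet (fun x => metricC κ c (q.1, x)) q.2 = κ * c 1 q * |(jac c q).det| := by
  filter_upwards [X.isFrame hκ, X.eventually_coframe, X.rad_pos] with q h1 h2 h3
  have h4 := h1.metric_eq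
  have hs : (Matrix.diagonal sgn).det = -1 := by
    simp [sgn, Fin.prod_univ_four]
  rw [sqrtNegDet, h4, Matrix.det_mul, Matrix.det_mul, Matrix.det_transpose, hs]
  rw [show (q.1, q.2) = q from rfl, h2, Matrix.det_mul, det_boost,
    show -(κ * c 1 q * (jac c q).det * -1 * (κ * c 1 q * (jac c q).det))
      = (κ * c 1 q * (jac c q).det) ^ 2 by ring, Real.sqrt_sq_eq_abs, abs_mul,
    abs_of_pos (by positivity)]

/-! #### Derivatives along the frame -/

omit X in
theorem ord_fd_aux {f : ℝ × Pt → ℝ} {k : ℤ} {a : Fin 4}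
    (h : ∀ μ, Ord p k fun q => frame κ c q μ a * xd μ f q) : Ord p k (fd κ c a f) :=
  Ord.sum fun μ _ => h μ

omit X in
theorem forall_fin_four {P : Fin 4 → Prop} (h0 : P 0) (h1 : P 1)
    (h2 : ∀ μ, μ = 2 ∨ μ = 3 → P μ) : ∀ μ, P μ := by
  intro μ
  fin_cases μ
  exacts [h0, h1, h2 2 (Or.inl rfl), h2 3 (Or.inr rfl)]

omit X in
theorem ne_one {μ : Fin 4} (h : μ = 2 ∨ μ = 3) : μ ≠ 1 := by
  rcases h with rfl | rfl <;> decide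

theorem ord_fd (hκ : 0 < κ) {f : ℝ × Pt → ℝ} {k : ℤ} (hf : Ord p k f) (a : Fin 4) :
    Ord p (k - 1) (fd κ c a f) := by
  refine ord_fd_aux (forall_fin_four ?_ ?_ fun μ hμ => ?_)
  · exact (X.frame_time hκ a).mul' (hf.xd_of_ne (by decide)) (by linarith)
  · exact (X.frame_rad hκ a).mul' (hf.xd 1) (by linarith)
  · exact (X.frame_angle' hκ hμ a).mul' (hf.xd_of_ne (ne_one hμ)) (by linarith)

/-- A frame derivative costs a power of `ρ` in general (`ord_fd`), but the pole multiplies only `∂_τ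
f`; if that is `O(ρ)`, nothing is lost. -/
theorem ord_fd_stat (hκ : 0 < κ) {f : ℝ × Pt → ℝ} (hf : Stat p f) (a : Fin 4) :
    Ord p 0 (fd κ c a f) := by
  refine ord_fd_aux (forall_fin_four ?_ ?_ fun μ hμ => ?_)
  · exact (X.frame_time hκ a).mul' hf.xd_zero
  · rcases eq_or_ne a 2 with rfl | h2
    · exact (X.frame_rad_angle (Or.inl rfl)).mul' (hf.ord.xd 1)
    rcases eq_or_ne a 3 with rfl | h3
    · exact (X.frame_rad_angle (Or.inr rfl)).mul' (hf.ord.xd 1)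
    -- `Ord.xd` would lose a power. At order `0` the function itself agrees with a smooth one, whose
    -- `∂_ρ` is again smooth.
    · obtain ⟨g, hg, h⟩ := hf.ord
      exact (X.frame_rad hκ a).mul' ((Ord.of_contDiffAt (contDiffAt_xd hg 1)).congr
        (xd_congr (h.trans (by simp)) 1))
  · exact (X.frame_angle' hκ hμ a).mul' (hf.ord.xd_of_ne (ne_one hμ)) (by linarith)

theorem stat_fd {f : ℝ × Pt → ℝ} (hf : Stat p f) {a : Fin 4} (ha : a = 2 ∨ a = 3) :
    Stat p (fd κ c a f) := by
  refine Stat.sum fun μ _ => forall_fin_four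
    (P := fun μ => Stat p fun q => frame κ c q μ a * xd μ f q) ?_ ?_ (fun μ hμ => ?_) μ
  · exact (X.frame_stat 0 ha).mul hf.xd_zero.stat
  · obtain ⟨g, hg, h⟩ := hf.ord
    refine Ord.stat ((X.frame_rad_angle ha).mul' (m := 0) ?_)
    exact (Ord.of_contDiffAt (contDiffAt_xd hg 1)).congr (xd_congr (h.trans (by simp)) 1)
  · exact (X.frame_stat μ ha).mul (hf.xd (ne_one hμ))

/-- All three contributions gain a power: `∂_τ f = O(ρ²)` against the pole, `∂_ρ f = O(ρ)`, and
`N^A_a = O(ρ)` for `a = 0, 1`. -/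
theorem ord_fd_statSq (hκ : 0 < κ) {f : ℝ × Pt → ℝ} (hf : StatSq p f) {a : Fin 4}
    (ha : a = 0 ∨ a = 1) : Ord p 1 (fd κ c a f) := by
  refine ord_fd_aux (forall_fin_four ?_ ?_ fun μ hμ => ?_)
  · exact (X.frame_time hκ a).mul' hf.xd_zero
  · exact (X.frame_rad hκ a).mul' hf.xd_one
  · exact (X.frame_angle hκ hμ ha).mul' (hf.ord.xd_of_ne (ne_one hμ))

theorem fd_inertial (hκ : 0 < κ) : ∀ᶠ q in wedgeNhds p, ∀ a b,
    fd κ c a (inertial κ c b) q = if b = a then 1 else 0 := by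
  filter_upwards [X.coframe_mul_frame hκ] with q hq a b
  have := congrFun (congrFun hq b) a
  rw [Matrix.mul_apply, Matrix.one_apply] at this
  rw [← this]
  exact Finset.sum_congr rfl fun μ _ => mul_comm _ _

theorem xd_eq_sum (hκ : 0 < κ) : ∀ᶠ q in wedgeNhds p, ∀ f μ,
    xd μ f q = ∑ a, coframe κ c q a μ * fd κ c a f q := by
  filter_upwards [X.isFrame hκ] with q hq f μ
  exact hq.pd_eq_sum μ (fun x => f (q.1, x))

/-- Derivatives along the frame commute. -/
theorem fd_comm (hκ : 0 < κ) {f : ℝ × Pt → ℝ} {k : ℤ} (hf : Ord p k f) (a b : Fin 4) :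
    fd κ c a (fd κ c b f) =ᶠ[wedgeNhds p] fd κ c b (fd κ c a f) := by
  have hfd : ∀ᶠ q in wedgeNhds p, ∀ b, DifferentiableAt ℝ (fd κ c b f) q :=
    eventually_all.2 fun b => (X.ord_fd hκ hf b).eventually_differentiableAt
  have hi : ∀ᶠ q in wedgeNhds p, ∀ b, ContDiffAt ℝ 2 (inertial κ c b) q :=
    eventually_all.2 fun b => eventually_wedgeNhds
      (eventually_contDiffAt_nat (X.contDiffAt_inertial b) 2)
  filter_upwards [eventually_eventually_wedgeNhds (X.xd_eq_sum hκ), hfd, hi,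
    hf.eventually_contDiffAt 2, X.isFrame hκ] with q h1 h2 h3 h4 h5
  have hE : ∀ b ν, DifferentiableAt ℝ (fun q => coframe κ c q b ν) q := fun b ν =>
    (differentiableAt_fderiv_apply (h3 b) (xdir ν)).congr_of_eventuallyEq
      (xd_eventuallyEq ((h3 b).of_le (by norm_num)) ν)
  -- Differentiate `df = Σ_b (D_b f) E^b`. As `d(df) = 0` and `dE^b = 0`, there remains `Σ_b d(D_b
  -- f) ∧ E^b = 0`, which is `key2`; contracting it with two vectors of the frame gives the
  -- commutation.
  have key : ∀ l ν, xd l (xd ν f) q = ∑ b, xd l (fun q => coframe κ c q b ν) q * fd κ c b f q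
      + ∑ b, coframe κ c q b ν * xd l (fd κ c b f) q := by
    intro l ν
    rw [xd_eq_of_eventuallyEq (h1.mono fun q hq => hq f ν),
      xd_sum fun b _ => (hE b ν).fun_mul (h2 b), ← Finset.sum_add_distrib]
    exact Finset.sum_congr rfl fun b _ => xd_mul (hE b ν) (h2 b) l
  have key2 : ∀ l ν, ∑ b, coframe κ c q b ν * xd l (fd κ c b f) q
      = ∑ b, coframe κ c q b l * xd ν (fd κ c b f) q := by
    intro l ν
    have h6 := xd_xd_comm h4 l ν
    rw [key, key] at h6
    have h7 : ∀ b, xd l (fun q => coframe κ c q b ν) q = xd ν (fun q => coframe κ c q b l) q :=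
      fun b => xd_xd_comm (h3 b) l ν
    simp only [h7] at h6
    linarith
  have key3 : ∀ a b, fd κ c a (fd κ c b f) q = ∑ l, ∑ ν, frame κ c q l a * frame κ c q ν b *
      ∑ d, coframe κ c q d ν * xd l (fd κ c d f) q := by
    intro a b
    rw [fd]
    refine Finset.sum_congr rfl fun l _ => ?_
    have : ∑ ν, frame κ c q ν b * ∑ d, coframe κ c q d ν * xd l (fd κ c d f) q
        = xd l (fd κ c b f) q := by
      simp_rw [Finset.mul_sum]
      rw [Finset.sum_comm]
      have h8 : ∀ d, ∑ ν, frame κ c q ν b * (coframe κ c q d ν * xd l (fd κ c d f) q)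
          = if d = b then xd l (fd κ c d f) q else 0 := by
        intro d
        have := h5.inv_apply' d b
        calc _ = (∑ ν, coframe κ c q d ν * frame κ c q ν b) * xd l (fd κ c d f) q := by
              rw [Finset.sum_mul]; exact Finset.sum_congr rfl fun _ _ => by ring
          _ = _ := by
              change (∑ ν, coframe κ c q d ν * frame κ c q ν b) = _ at this
              rw [this]; split_ifs <;> simp
      simp [h8]
    rw [← this, Finset.mul_sum]
    exact Finset.sum_congr rfl fun _ _ => by ring
  rw [key3, key3, Finset.sum_comm]
  refine Finset.sum_congr rfl fun l _ => Finset.sum_congr rfl fun ν _ => ?_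
  rw [key2 ν l]; ring

end IsChart

/-! ### Frame components of asymptotic symmetries and of their strains -/

/-- `Y` are the components in the inertial frame of a vector field whose Rindler components
`w, m, Y 2, Y 3` behave like those of an asymptotic symmetry. -/
structure FrameField (p : ℝ × Pt) (κ : ℝ) (c : Fin 4 → ℝ × Pt → ℝ) (w m : ℝ × Pt → ℝ)
    (Y : Fin 4 → ℝ × Pt → ℝ) : Prop where
  time : StatSq p w
  rad : Ord p 2 m
  zero : Y 0 =ᶠ[wedgeNhds p] fun q => κ * (inertial κ c 1 q * w q) + Real.sinh (κ * c 0 q) * m q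
  one : Y 1 =ᶠ[wedgeNhds p] fun q => κ * (inertial κ c 0 q * w q) + Real.cosh (κ * c 0 q) * m q
  angle : ∀ a, a = 2 ∨ a = 3 → StatSq p (Y a)

/-- The frame components of the variation of the metric generated by `Y`. -/
def strain (κ : ℝ) (c Y : Fin 4 → ℝ × Pt → ℝ) (a b : Fin 4) (q : ℝ × Pt) : ℝ :=
  sgn b * fd κ c a (Y b) q + sgn a * fd κ c b (Y a) q

theorem strain_comm (κ : ℝ) (c Y : Fin 4 → ℝ × Pt → ℝ) (a b : Fin 4) :
    strain κ c Y a b = strain κ c Y b a := by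
  ext q; simp only [strain]; ring

theorem Stat.abs {p : ℝ × Pt} {f : ℝ × Pt → ℝ} (hf : Stat p f) (hs : ContDiffAt ℝ ∞ f p)
    (h : f p ≠ 0) : Stat p fun q => |f q| := by
  rcases h.lt_or_gt with h | h
  · refine hf.neg.congr ?_
    filter_upwards [eventually_wedgeNhds (hs.continuousAt.eventually_lt_const h)] with q hq
    exact abs_of_neg hq
  · refine hf.congr ?_
    filter_upwards [eventually_wedgeNhds (hs.continuousAt.eventually_const_lt h)] with q hq
    exact abs_of_pos hq

namespace IsChart
variable {p : ℝ × Pt} {c : Fin 4 → ℝ × Pt → ℝ} (X : IsChart p c) {κ : ℝ} (hκ : 0 < κ)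
include X

theorem ord_inertial {a : Fin 4} (ha : a = 0 ∨ a = 1) : Ord p 1 (inertial κ c a) := by
  rcases ha with rfl | rfl
  · exact X.ord_rad.mul' X.ord_sinh
  · exact X.ord_rad.mul' X.ord_cosh

include hκ

/-- In `D_a (κ Φ_j w + S m)`, with `Φ_j` an inertial coordinate, `D_a Φ_j = δ_{ja}` gives the
subtracted term. The others are `O(ρ)`: `Φ_j` vanishes on the horizon while `D_a w` is bounded, and
`S m = O(ρ²)` loses one power. -/
theorem ord_fd_sub {w m S f : ℝ × Pt → ℝ} (hw : StatSq p w) (hm : Ord p 2 m) (hS : Ord p 0 S)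
    {j : Fin 4} (hj : j = 0 ∨ j = 1)
    (hf : f =ᶠ[wedgeNhds p] fun q => κ * (inertial κ c j q * w q) + S q * m q) (a : Fin 4) :
    Ord p 1 fun q => fd κ c a f q - if j = a then κ * w q else 0 := by
  have hΦ := X.ord_inertial (κ := κ) hj
  have h1 : Ord p 2 fun q => S q * m q := hS.mul' hm
  have h2 : Ord p 1 fun q => κ * (inertial κ c j q * fd κ c a w q) :=
    (hΦ.mul' (X.ord_fd_stat hκ hw.stat a)).const_mul κ
  refine (h2.add (X.ord_fd hκ h1 a)).congr ?_
  filter_upwards [fd_congr hf a, hΦ.eventually_differentiableAt,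
    hw.ord.eventually_differentiableAt, h1.eventually_differentiableAt, X.fd_inertial hκ]
    with q e1 e2 e3 e4 e5
  rw [e1, fd_add ((e2.fun_mul e3).const_mul κ) e4, fd_const_mul κ (e2.fun_mul e3), fd_mul e2 e3, e5]
  split_ifs <;> ring

section fields
variable {w m : ℝ × Pt → ℝ} {Y : Fin 4 → ℝ × Pt → ℝ} (hY : FrameField p κ c w m Y)
include hY

omit hκ in
theorem ord_field {a : Fin 4} (ha : a = 0 ∨ a = 1) : Ord p 1 (Y a) := by
  rcases ha with rfl | rfl
  · exact ((((X.ord_inertial (Or.inr rfl)).mul' hY.time.ord).const_mul κ).add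
      (X.ord_sinh.mul' hY.rad)).congr hY.zero
  · exact ((((X.ord_inertial (Or.inl rfl)).mul' hY.time.ord).const_mul κ).add
      (X.ord_cosh.mul' hY.rad)).congr hY.one

omit hκ in
theorem ord_field' : ∀ a, Ord p 0 (Y a) :=
  forall_fin_four ((X.ord_field hY (Or.inl rfl)).mono (by norm_num))
    ((X.ord_field hY (Or.inr rfl)).mono (by norm_num)) fun a ha => (hY.angle a ha).ord

/-- With `fd_field_one`, this identifies the derivatives of `Y⁰, Y¹` modulo `O(ρ)` as those of an
infinitesimal boost: `D_1 Y⁰` and `D_0 Y¹` are both `κ w`, and the other entries vanish. -/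
theorem fd_field_zero (a : Fin 4) :
    Ord p 1 fun q => fd κ c a (Y 0) q - if 1 = a then κ * w q else 0 :=
  X.ord_fd_sub hκ hY.time hY.rad X.ord_sinh (Or.inr rfl) hY.zero a

theorem fd_field_one (a : Fin 4) :
    Ord p 1 fun q => fd κ c a (Y 1) q - if 0 = a then κ * w q else 0 :=
  X.ord_fd_sub hκ hY.time hY.rad X.ord_cosh (Or.inl rfl) hY.one a

theorem fd_field_angle {a b : Fin 4} (ha : a = 0 ∨ a = 1) (hb : b = 2 ∨ b = 3) :
    Ord p 1 (fd κ c a (Y b)) := X.ord_fd_statSq hκ (hY.angle b hb) ha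

theorem stat_fd_field (a b : Fin 4) : Stat p (fd κ c a (Y b)) := by
  have hif : ∀ j : Fin 4, Stat p fun q => if j = a then κ * w q else 0 := by
    intro j
    split_ifs
    exacts [hY.time.stat.const_mul κ, Stat.const 0]
  revert b
  refine forall_fin_four ?_ ?_ fun b hb => ?_
  · exact ((X.fd_field_zero hκ hY a).stat.add (hif 1)).congr (Eventually.of_forall fun q => by simp)
  · exact ((X.fd_field_one hκ hY a).stat.add (hif 0)).congr (Eventually.of_forall fun q => by simp)
  · revert a
    refine forall_fin_four (fun _ => ?_) (fun _ => ?_) fun a ha _ => ?_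
    exacts [(X.fd_field_angle hκ hY (Or.inl rfl) hb).stat,
      (X.fd_field_angle hκ hY (Or.inr rfl) hb).stat, X.stat_fd (hY.angle b hb).stat ha]

theorem stat_strain (a b : Fin 4) : Stat p (strain κ c Y a b) :=
  ((X.stat_fd_field hκ hY a b).const_mul _).add ((X.stat_fd_field hκ hY b a).const_mul _)

/-- A boost is an isometry: because of the signature the `01` strain is `D_0 Y¹ - D_1 Y⁰`, in which
the two terms `κ w` cancel. Every other derivative occurring here is itself `O(ρ)`. -/
theorem ord_strain {a : Fin 4} (ha : a = 0 ∨ a = 1) (b : Fin 4) : Ord p 1 (strain κ c Y a b) := by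
  have h00 : Ord p 1 (fd κ c 0 (Y 0)) := by simpa using X.fd_field_zero hκ hY 0
  have h11 : Ord p 1 (fd κ c 1 (Y 1)) := by simpa using X.fd_field_one hκ hY 1
  have h01 : Ord p 1 (strain κ c Y 0 1) := by
    refine ((X.fd_field_one hκ hY 0).sub (X.fd_field_zero hκ hY 1)).congr
      (Eventually.of_forall fun q => ?_)
    simp [strain, sgn]; ring
  have hA : ∀ b, b = 2 ∨ b = 3 → Ord p 1 (fd κ c b (Y 0)) ∧ Ord p 1 (fd κ c b (Y 1)) := by
    rintro b (rfl | rfl)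
    · exact ⟨by simpa using X.fd_field_zero hκ hY 2, by simpa using X.fd_field_one hκ hY 2⟩
    · exact ⟨by simpa using X.fd_field_zero hκ hY 3, by simpa using X.fd_field_one hκ hY 3⟩
  revert b
  rcases ha with rfl | rfl
  · refine forall_fin_four ?_ h01 fun b hb => ?_
    · exact (h00.const_mul _).add (h00.const_mul _)
    · exact ((X.fd_field_angle hκ hY (Or.inl rfl) hb).const_mul _).add ((hA b hb).1.const_mul _)
  · refine forall_fin_four (by rwa [strain_comm]) ?_ fun b hb => ?_
    · exact (h11.const_mul _).add (h11.const_mul _)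
    · exact ((X.fd_field_angle hκ hY (Or.inr rfl) hb).const_mul _).add ((hA b hb).2.const_mul _)

theorem ord_fd_strain (d a b : Fin 4) : Ord p 0 (fd κ c d (strain κ c Y a b)) :=
  X.ord_fd_stat hκ (X.stat_strain hκ hY a b) d

/-- The two terms separately are only known to be bounded. In the difference `D_0 D_1 Y^b` cancels,
and the rest is `D_b (D_0 Y¹ + D_1 Y⁰)`, where a tangential frame derivative preserves `Stat`. -/
theorem stat_curl_strain {b : Fin 4} (hb : b = 2 ∨ b = 3) :
    Stat p fun q => fd κ c 0 (strain κ c Y 1 b) q - fd κ c 1 (strain κ c Y 0 b) q := by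
  refine (X.stat_fd (κ := κ) ((X.stat_fd_field hκ hY 0 1).add (X.stat_fd_field hκ hY 1 0)) hb).congr ?_
  have hd : ∀ a b, ∀ᶠ q in wedgeNhds p, DifferentiableAt ℝ (fd κ c a (Y b)) q := fun a b =>
    (X.stat_fd_field hκ hY a b).ord.eventually_differentiableAt
  have hsb : sgn b = 1 := by rcases hb with rfl | rfl <;> simp [sgn]
  filter_upwards [hd 1 b, hd b 1, hd 0 b, hd b 0, hd 0 1, hd 1 0,
    X.fd_comm hκ (X.ord_field' hY b) 0 1, X.fd_comm hκ (X.ord_field' hY 1) 0 b,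
    X.fd_comm hκ (X.ord_field' hY 0) 1 b] with q d1 d2 d3 d4 d5 d6 c1 c2 c3
  have e1 : fd κ c 0 (strain κ c Y 1 b) q
      = fd κ c 0 (fd κ c 1 (Y b)) q + fd κ c 0 (fd κ c b (Y 1)) q := by
    rw [← fd_add d1 d2]
    congr 1; ext q; simp [strain, hsb, show sgn 1 = 1 from rfl]
  have e2 : fd κ c 1 (strain κ c Y 0 b) q
      = fd κ c 1 (fd κ c 0 (Y b)) q + -1 * fd κ c 1 (fd κ c b (Y 0)) q := by
    rw [← fd_const_mul _ d4, ← fd_add d3 (d4.const_mul _)]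
    congr 1; ext q; simp [strain, hsb, show sgn 0 = -1 from rfl]
  rw [e1, e2, fd_add d5 d6, c1, c2, c3]; ring

theorem ord_frameTheta (b : Fin 4) : Ord p 0 fun q =>
    frameTheta (fun d a b => fd κ c d (strain κ c Y a b) q) b :=
  (Ord.sum fun d _ => (X.ord_fd_strain hκ hY d b d).const_mul _).sub
    (Ord.sum fun d _ => (X.ord_fd_strain hκ hY b d d).const_mul _)

variable {w' m' : ℝ × Pt → ℝ} {V : Fin 4 → ℝ × Pt → ℝ} (hV : FrameField p κ c w' m' V)
include hV

theorem ord_frameS (a b : Fin 4) : Ord p 0 fun q => frameS (fun a => V a q)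
    (fun a b => fd κ c a (V b) q) (fun a b => strain κ c Y a b q)
    (fun d a b => fd κ c d (strain κ c Y a b) q) a b := by
  have hD := fun a b => (X.stat_fd_field hκ hV a b).ord
  have hH := fun a b => (X.stat_strain hκ hY a b).ord
  have hDH := X.ord_fd_strain hκ hY
  have hv := X.ord_field' hV
  exact ((((Ord.sum fun d _ => (hH d d).const_mul _).const_mul _).mul' ((hD a b).const_mul _)).add
    (Ord.sum fun d _ => ((hH d a).const_mul _).mul' (hD d b))).sub
    (Ord.sum fun d _ => ((hDH a b d).const_mul _).mul' (hv d)) |>.add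
    ((hv a).mul' (X.ord_frameTheta hκ hY b))

/-- This is the cancellation behind integrability. The trace term is a product of `τ`-independent
factors. Terms containing a strain with an index `0` or `1` undifferentiated, or a component `V 0`
or `V 1`, are `O(ρ)`. What is left of the gradient term is the curl of the strain contracted with
tangential components, covered by `stat_curl_strain`. -/
theorem stat_frameS : Stat p fun q => antisym (frameS (fun a => V a q)
    (fun a b => fd κ c a (V b) q) (fun a b => strain κ c Y a b q)
    (fun d a b => fd κ c d (strain κ c Y a b) q)) 0 1 := by
  have hD := fun a b => X.stat_fd_field hκ hV a b
  have hH := fun a b => X.stat_strain hκ hY a b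
  have hDH := X.ord_fd_strain hκ hY
  have hθ := X.ord_frameTheta hκ hY
  have hv : ∀ {a : Fin 4}, a = 0 ∨ a = 1 → Ord p 1 (V a) := X.ord_field hV
  have t1 : Stat p fun q => (∑ d, sgn d * strain κ c Y d d q) *
      (fd κ c 0 (V 1) q + fd κ c 1 (V 0) q) :=
    (Stat.sum fun d _ => (hH d d).const_mul _).mul ((hD 0 1).add (hD 1 0))
  have t2 : ∀ {a : Fin 4}, a = 0 ∨ a = 1 → ∀ b, Ord p 1 fun q =>
      ∑ d, sgn d * sgn a * strain κ c Y d a q * fd κ c d (V b) q := by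
    intro a ha b
    refine Ord.sum fun d _ => Ord.mul' (k := 1) (m := 0) ?_ (hD d b).ord
    rw [strain_comm]
    exact (X.ord_strain hκ hY ha d).const_mul _
  have t3 : Stat p fun q => ∑ d, (fd κ c 0 (strain κ c Y 1 d) q - fd κ c 1 (strain κ c Y 0 d) q) *
      V d q := by
    refine Stat.sum fun d hd => ?_
    clear hd
    revert d
    refine forall_fin_four ?_ ?_ fun d hd => ?_
    · exact (((hDH 0 1 0).sub (hDH 1 0 0)).mul' (hv (Or.inl rfl))).stat
    · exact (((hDH 0 1 1).sub (hDH 1 0 1)).mul' (hv (Or.inr rfl))).stat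
    · exact (X.stat_curl_strain hκ hY hd).mul (hV.angle d hd).stat
  have t4 : ∀ {a : Fin 4}, a = 0 ∨ a = 1 → ∀ b, Ord p 1 fun q => V a q *
      frameTheta (fun d a b => fd κ c d (strain κ c Y a b) q) b :=
    fun ha b => (hv ha).mul' (hθ b)
  refine ((((t1.const_mul (1 / 4)).add (((t2 (Or.inl rfl) 1).stat.sub
    (t2 (Or.inr rfl) 0).stat).const_mul (1 / 2))).add (t3.const_mul (1 / 2))).add
    (((t4 (Or.inl rfl) 1).stat.sub (t4 (Or.inr rfl) 0).stat).const_mul (1 / 2))).congr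
    (Eventually.of_forall fun q => ?_)
  have e : ∑ d, (fd κ c 0 (strain κ c Y 1 d) q - fd κ c 1 (strain κ c Y 0 d) q) * V d q
      = -(∑ d, sgn 0 * sgn 1 * fd κ c 0 (strain κ c Y 1 d) q * V d q)
        + ∑ d, sgn 1 * sgn 0 * fd κ c 1 (strain κ c Y 0 d) q * V d q := by
    rw [← Finset.sum_neg_distrib, ← Finset.sum_add_distrib]
    exact Finset.sum_congr rfl fun d _ => by simp [sgn]; ring
  simp only [antisym, frameS, e]
  simp only [show sgn 0 = -1 from rfl, show sgn 1 = 1 from rfl]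
  ring

end fields

/-! #### From the frame to Rindler coordinates -/

-- The `+ 1` is the simple zero of the volume factor `√-g`.
omit hκ in
theorem ord_contract {u : Fin 4 → Fin 4 → ℝ × Pt → ℝ} (hu : ∀ a b, Ord p 0 (u a b))
    {k m : ℤ} {μ ν : Fin 4} (hμ : ∀ a, Ord p k fun q => frame κ c q μ a)
    (hν : ∀ a, Ord p m fun q => frame κ c q ν a) : Ord p (k + m + 1) fun q =>
      κ * c 1 q * |(jac c q).det| * ∑ a, ∑ b, frame κ c q μ a * frame κ c q ν b * u a b q := by
  have hJ := ((Stat.det X.stat_jac).abs X.contDiffAt_det_jac X.det_ne).ord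
  refine ((X.ord_rad.const_mul κ).mul' hJ (n := 1)).mul' (m := k + m)
    (Ord.sum fun a _ => Ord.sum fun b _ => ?_) (by linarith)
  exact ((hμ a).mul (hν b)).mul' (hu a b) (by simp)

omit hκ in
/-- The volume factor of the inertial frame in the `τρ` plane is smooth. -/
theorem stat_volume : Stat p fun q => |(jac c q).det| *
    ((jac c q)⁻¹ 0 0 * (jac c q)⁻¹ 1 1 - (jac c q)⁻¹ 0 1 * (jac c q)⁻¹ 1 0) :=
  ((Stat.det X.stat_jac).abs X.contDiffAt_det_jac X.det_ne).mul
    (((X.stat_inv 0 0).mul (X.stat_inv 1 1)).sub ((X.stat_inv 0 1).mul (X.stat_inv 1 0)))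

/-- The `01` minor of the `τ` and `ρ` rows of the frame is the corresponding minor of `J⁻¹` divided
by `κ γ^ρ`, so the volume factor cancels the pole exactly. Every remaining pair has a tangential
index: if it is the second one, `N^ρ_b = O(ρ)` cancels the pole of `N^τ_a`; if it is the first,
`N^τ_a` has no pole. The volume factor then makes these terms `O(ρ)`. -/
theorem ord_contract_time_rad {u : Fin 4 → Fin 4 → ℝ × Pt → ℝ} (hu : ∀ a b, Ord p 0 (u a b))
    (h00 : u 0 0 = 0) (h11 : u 1 1 = 0) (h10 : ∀ q, u 1 0 q = -u 0 1 q) : Ord p 1 fun q =>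
      κ * c 1 q * |(jac c q).det| * (∑ a, ∑ b, frame κ c q 0 a * frame κ c q 1 b * u a b q)
      - |(jac c q).det| * ((jac c q)⁻¹ 0 0 * (jac c q)⁻¹ 1 1 - (jac c q)⁻¹ 0 1 * (jac c q)⁻¹ 1 0) *
        u 0 1 q := by
  have hJ := ((Stat.det X.stat_jac).abs X.contDiffAt_det_jac X.det_ne).ord
  have n0 := X.frame_time hκ
  have n1 := X.frame_rad hκ
  have n0' : ∀ {a : Fin 4}, a = 2 ∨ a = 3 → Ord p 0 fun q => frame κ c q 0 a :=
    fun ha => (X.frame_stat 0 ha).ord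
  have n1' : ∀ {a : Fin 4}, a = 2 ∨ a = 3 → Ord p 1 fun q => frame κ c q 1 a :=
    fun ha => X.frame_rad_angle ha
  have r1 : ∀ a, ∀ {b : Fin 4}, b = 2 ∨ b = 3 → Ord p 0 fun q =>
      frame κ c q 0 a * frame κ c q 1 b * u a b q := fun a b hb =>
    ((n0 a).mul' (n1' hb) (n := 0)).mul' (hu a b)
  have r2 : ∀ {a : Fin 4}, a = 2 ∨ a = 3 → ∀ b, Ord p 0 fun q =>
      frame κ c q 0 a * frame κ c q 1 b * u a b q := fun {a} ha b =>
    ((n0' ha).mul' (n1 b) (n := 0)).mul' (hu a b)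
  have rest : Ord p 0 fun q =>
      ((frame κ c q 0 0 * frame κ c q 1 2 * u 0 2 q + frame κ c q 0 0 * frame κ c q 1 3 * u 0 3 q)
      + (frame κ c q 0 1 * frame κ c q 1 2 * u 1 2 q + frame κ c q 0 1 * frame κ c q 1 3 * u 1 3 q))
      + (∑ b, frame κ c q 0 2 * frame κ c q 1 b * u 2 b q)
      + ∑ b, frame κ c q 0 3 * frame κ c q 1 b * u 3 b q :=
    ((((r1 0 (Or.inl rfl)).add (r1 0 (Or.inr rfl))).add
      ((r1 1 (Or.inl rfl)).add (r1 1 (Or.inr rfl)))).add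
      (Ord.sum fun b _ => r2 (Or.inl rfl) b)).add (Ord.sum fun b _ => r2 (Or.inr rfl) b)
  refine (((X.ord_rad.const_mul κ).mul' hJ (n := 1)).mul' rest).congr ?_
  filter_upwards [X.rad_pos] with q hr
  have hi : κ * c 1 q * (κ * c 1 q)⁻¹ = 1 := mul_inv_cancel₀ (by positivity)
  have hc := Real.cosh_sq_sub_sinh_sq (κ * c 0 q)
  -- Two powers of the pole cancel inside the minor, and one is left for the volume factor.
  have minor : κ * c 1 q * (frame κ c q 0 0 * frame κ c q 1 1 - frame κ c q 0 1 * frame κ c q 1 0)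
      = (jac c q)⁻¹ 0 0 * (jac c q)⁻¹ 1 1 - (jac c q)⁻¹ 0 1 * (jac c q)⁻¹ 1 0 := by
    simp only [frame, Matrix.of_apply, Matrix.cons_val]
    generalize (κ * c 1 q)⁻¹ = r at *
    generalize (jac c q)⁻¹ = Z at *
    linear_combination (Z 0 0 * Z 1 1 - Z 0 1 * Z 1 0) * hc +
      (Z 0 0 * Z 1 1 - Z 0 1 * Z 1 0) * (Real.cosh (κ * c 0 q) ^ 2 -
        Real.sinh (κ * c 0 q) ^ 2) * hi
  rw [← minor]
  simp only [Fin.sum_univ_four, h00, h11, h10, Pi.zero_apply]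
  ring

end IsChart

/-! ### Asymptotics of the charges near the horizon -/

/-- The components in the inertial frame of the vector field `z`. -/
def toFrame (κ : ℝ) (c z : Fin 4 → ℝ × Pt → ℝ) (a : Fin 4) (q : ℝ × Pt) : ℝ :=
  ∑ β, coframe κ c q a β * z β q

/-- The components in Rindler coordinates of the push-forward of the vector field `z`. -/
def pushC (c z : Fin 4 → ℝ × Pt → ℝ) (a : Fin 4) (q : ℝ × Pt) : ℝ := ∑ β, jac c q a β * z β q

theorem tendsto_slice (q : ℝ × Pt) : Tendsto (fun x => (q.1, x)) (𝓝 q.2) (𝓝 q) :=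
  (continuous_const.prodMk continuous_id).tendsto' _ _ rfl

theorem DifferentiableAt.slice {f : ℝ × Pt → ℝ} {q : ℝ × Pt} (hf : DifferentiableAt ℝ f q) :
    DifferentiableAt ℝ (fun x => f (q.1, x)) q.2 :=
  DifferentiableAt.comp (f := fun x => (q.1, x)) q.2 hf (by fun_prop)

/-- `z` are the components of a vector field with the asymptotic behaviour of a symmetry. -/
structure SymField (p : ℝ × Pt) (z : Fin 4 → ℝ × Pt → ℝ) : Prop where
  rad : Ord p 2 (z 1)
  stat : ∀ a, a ≠ 1 → StatSq p (z a)

theorem SymField.ord {p : ℝ × Pt} {z : Fin 4 → ℝ × Pt → ℝ} (hz : SymField p z) (a : Fin 4) :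
    Ord p 0 (z a) := by
  by_cases ha : a = 1
  · subst ha; exact hz.rad.mono (by norm_num)
  · exact (hz.stat a ha).ord

/-- The density of the Noether charge on the horizon. -/
def hairC (κ Gn : ℝ) (c z : Fin 4 → ℝ × Pt → ℝ) (q : ℝ × Pt) : ℝ :=
  κ / (8 * Real.pi * Gn) * (|(jac c q).det| * pushC c z 0 q)

namespace IsChart
variable {p : ℝ × Pt} {c : Fin 4 → ℝ × Pt → ℝ} (X : IsChart p c) {κ : ℝ} (hκ : 0 < κ)
include X

theorem statSq_push {z : Fin 4 → ℝ × Pt → ℝ} (hz : SymField p z) {a : Fin 4} (ha : a ≠ 1) :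
    StatSq p (pushC c z a) := by
  refine StatSq.sum fun β _ => ?_
  by_cases hβ : β = 1
  · subst hβ
    exact ((X.stat_jac a 1).ord.mul' hz.rad).statSq
  · exact (X.jac_statSq ha hβ).mul (hz.stat β hβ)

theorem ord_push {z : Fin 4 → ℝ × Pt → ℝ} (hz : SymField p z) : Ord p 2 (pushC c z 1) := by
  refine Ord.sum fun β _ => ?_
  by_cases hβ : β = 1
  · subst hβ
    exact (X.stat_jac 1 1).ord.mul' hz.rad
  · exact (X.jac_rad hβ).mul' (hz.stat β hβ).ord

/-- As the coframe is `boost * J`, the frame components are `boost` applied to the push-forward; its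
entries `κ γ^ρ cosh` and `κ γ^ρ sinh` are `κ` times the inertial coordinates `1` and `0`. -/
theorem frameField_sym {z : Fin 4 → ℝ × Pt → ℝ} (hz : SymField p z) :
    FrameField p κ c (pushC c z 0) (pushC c z 1) (toFrame κ c z) := by
  have h : ∀ᶠ q in wedgeNhds p, ∀ a, toFrame κ c z a q = ∑ b, boost κ c q a b * pushC c z b q := by
    filter_upwards [X.eventually_coframe] with q hq a
    have e : ∀ β, coframe κ c q a β = ∑ b, boost κ c q a b * jac c q b β := fun β => by
      rw [hq, Matrix.mul_apply]
    simp only [toFrame, pushC, e, Finset.sum_mul, Finset.mul_sum]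
    rw [Finset.sum_comm]
    exact Finset.sum_congr rfl fun _ _ => Finset.sum_congr rfl fun _ _ => by ring
  refine ⟨X.statSq_push hz (by decide), X.ord_push hz, ?_, ?_, ?_⟩
  · filter_upwards [h] with q hq
    rw [hq, Fin.sum_univ_four]
    simp [boost, inertial]; ring
  · filter_upwards [h] with q hq
    rw [hq, Fin.sum_univ_four]
    simp [boost, inertial]; ring
  · rintro a (rfl | rfl)
    · refine (X.statSq_push hz (a := 2) (by decide)).congr ?_
      filter_upwards [h] with q hq
      rw [hq, Fin.sum_univ_four]
      simp [boost]
    · refine (X.statSq_push hz (a := 3) (by decide)).congr ?_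
      filter_upwards [h] with q hq
      rw [hq, Fin.sum_univ_four]
      simp [boost]

/-- The chain rule gives `∂_λ T = κ X ∂_λ γ^τ + sinh(κ γ^τ) ∂_λ γ^ρ`, and likewise for `X`: the
velocity of the inertial coordinates has the form of a symmetry, so path variations need no separate
estimates. -/
theorem frameField_path : FrameField p κ c (ld (c 0)) (ld (c 1)) fun a => ld (inertial κ c a) := by
  have hd : ∀ α, ∀ᶠ q in wedgeNhds p, DifferentiableAt ℝ (c α) q := fun α => by
    filter_upwards [X.eventually_contDiffAt 1] with q hq
    exact (hq α).differentiableAt (by simp)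
  have htr : ∀ μ, ld (fun q => c μ q - q.2 μ) =ᶠ[wedgeNhds p] ld (c μ) := fun μ => by
    filter_upwards [hd μ] with q hq
    rw [ld_sub hq (by fun_prop)]
    simp [ld]
  refine ⟨X.time.ld.congr (htr 0).symm, X.rad.ld.congr (htr 1).symm, ?_, ?_, ?_⟩
  · filter_upwards [hd 0, hd 1] with q h0 h1
    have h : HasFDerivAt (fun q => κ * c 0 q) (κ • fderiv ℝ (c 0) q) q :=
      h0.hasFDerivAt.const_mul κ
    have hs : ld (fun q => Real.sinh (κ * c 0 q)) q = κ * Real.cosh (κ * c 0 q) * ld (c 0) q := by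
      rw [ld_eq_fderiv h.sinh.differentiableAt, h.sinh.fderiv, ld_eq_fderiv h0]
      simp; ring
    simp only [inertial, Matrix.cons_val]
    rw [ld_mul h1 h.sinh.differentiableAt, hs]
    ring
  · filter_upwards [hd 0, hd 1] with q h0 h1
    have h : HasFDerivAt (fun q => κ * c 0 q) (κ • fderiv ℝ (c 0) q) q :=
      h0.hasFDerivAt.const_mul κ
    have hs : ld (fun q => Real.cosh (κ * c 0 q)) q = κ * Real.sinh (κ * c 0 q) * ld (c 0) q := by
      rw [ld_eq_fderiv h.cosh.differentiableAt, h.cosh.fderiv, ld_eq_fderiv h0]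
      simp; ring
    simp only [inertial, Matrix.cons_val]
    rw [ld_mul h1 h.cosh.differentiableAt, hs]
    ring
  · rintro a (rfl | rfl)
    exacts [X.two.ld, X.three.ld]

theorem differentiableAt_coframe : ∀ᶠ q in wedgeNhds p, ∀ a μ,
    DifferentiableAt ℝ (fun q => coframe κ c q a μ) q :=
  eventually_all.2 fun a => eventually_all.2 fun μ =>
    (Ord.of_contDiffAt (contDiffAt_xd (X.contDiffAt_inertial (κ := κ) a) μ)).eventually_differentiableAt

include hκ

theorem sum_strain (Y : Fin 4 → ℝ × Pt → ℝ) : ∀ᶠ q in wedgeNhds p, ∀ μ ν,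
    ∑ a, sgn a * (xd μ (Y a) q * coframe κ c q a ν + coframe κ c q a μ * xd ν (Y a) q)
      = ∑ a, ∑ b, coframe κ c q a μ * coframe κ c q b ν * strain κ c Y a b q := by
  filter_upwards [X.xd_eq_sum hκ] with q hq μ ν
  simp only [strain, mul_add, Finset.sum_add_distrib]
  congr 1
  · rw [Finset.sum_comm]
    refine Finset.sum_congr rfl fun a _ => ?_
    rw [hq, Finset.sum_mul, Finset.mul_sum]
    exact Finset.sum_congr rfl fun b _ => by ring
  · refine Finset.sum_congr rfl fun a _ => ?_
    rw [hq, Finset.mul_sum, Finset.mul_sum]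
    exact Finset.sum_congr rfl fun b _ => by ring

/-- The common form of both perturbations is `Σ ε_a (dY^a ⊗ E^a + E^a ⊗ dY^a)`. For `£_η g` it comes
from Cartan's formula `£_η E^a = d(E^a(η))`, valid because `E^a` is closed; for `∂_λ g` from `∂_λ
E^a = d(∂_λ Φ^a)`, where `E^a = dΦ^a`. -/
theorem hasFrameTen_of_eventually {Y : Fin 4 → ℝ × Pt → ℝ} (h : ℝ → Tensor2)
    (hs : ∀ a b, Stat p (strain κ c Y a b)) (hh : ∀ᶠ q in wedgeNhds p, ∀ μ ν, h q.1 q.2 μ ν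
      = ∑ a, sgn a * (xd μ (Y a) q * coframe κ c q a ν + coframe κ c q a μ * xd ν (Y a) q)) :
    ∀ᶠ q in wedgeNhds p, HasFrameTen (fun x => coframe κ c (q.1, x)) (h q.1)
      (fun x => Matrix.of fun a b => strain κ c Y a b (q.1, x)) q.2 := by
  have hd : ∀ᶠ q in wedgeNhds p, ∀ a b, DifferentiableAt ℝ (strain κ c Y a b) q :=
    eventually_all.2 fun a => eventually_all.2 fun b => (hs a b).ord.eventually_differentiableAt
  filter_upwards [eventually_eventually_wedgeNhds (hh.and (X.sum_strain hκ Y)), hd] with q h1 h2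
  refine ⟨fun a b => DifferentiableAt.slice (h2 a b), ?_⟩
  filter_upwards [(tendsto_slice q).eventually h1] with x hx μ ν
  exact (hx.1 μ ν).trans (hx.2 μ ν)

theorem hasFrameTen_lieDeriv {η : Pt → Pt} (hz : SymField p fun μ q => η q.2 μ) :
    ∀ᶠ q in wedgeNhds p, HasFrameTen (fun x => coframe κ c (q.1, x))
      (lieDeriv η fun x => metricC κ c (q.1, x))
      (fun x => Matrix.of fun a b =>
        strain κ c (toFrame κ c fun μ q => η q.2 μ) a b (q.1, x)) q.2 := by
  have hY := X.frameField_sym (κ := κ) hz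
  refine X.hasFrameTen_of_eventually hκ (fun l => lieDeriv η fun x => metricC κ c (l, x))
    (X.stat_strain hκ hY) ?_
  have hdη : ∀ᶠ q in wedgeNhds p, ∀ μ, DifferentiableAt ℝ (fun q : ℝ × Pt => η q.2 μ) q :=
    eventually_all.2 fun μ => (hz.ord μ).eventually_differentiableAt
  filter_upwards [X.isFrame hκ, hdη, X.differentiableAt_coframe (κ := κ)] with q h1 h2 h3 μ ν
  have hg : ∀ α μ ν, pd α (fun x' => metricC κ c (q.1, x') μ ν) q.2 = ∑ a, sgn a *
      (xd α (fun q => coframe κ c q a μ) q * coframe κ c q a ν +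
        coframe κ c q a μ * xd α (fun q => coframe κ c q a ν) q) := by
    intro α μ ν
    rw [pd_congr (h1.metric.mono fun x' h => h μ ν),
      pd_sum fun a _ => ((h1.diff a μ).fun_mul (h1.diff a ν)).const_mul _]
    refine Finset.sum_congr rfl fun a _ => ?_
    rw [pd_const_mul _ ((h1.diff a μ).fun_mul (h1.diff a ν)), pd_mul (h1.diff a μ) (h1.diff a ν)]
    rfl
  have hY' : ∀ a μ, xd μ (toFrame κ c (fun μ q => η q.2 μ) a) q = ∑ α,
      (η q.2 α * xd α (fun q => coframe κ c q a μ) q +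
        coframe κ c q a α * pd μ (fun x' => η x' α) q.2) := by
    intro a μ
    unfold toFrame
    rw [xd_sum fun β _ => (h3 a β).fun_mul (h2 β)]
    refine Finset.sum_congr rfl fun α _ => ?_
    rw [xd_mul (h3 a α) (h2 α), show xd μ (fun q => coframe κ c q a α) q
      = xd α (fun q => coframe κ c q a μ) q from h1.closed a μ α, mul_comm]
    rfl
  have hm : ∀ μ ν, metricC κ c (q.1, q.2) μ ν
      = ∑ a, sgn a * (coframe κ c q a μ * coframe κ c q a ν) := h1.metric.self_of_nhds
  simp only [lieDeriv, Matrix.of_apply, hg, hY', hm]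
  simp only [Finset.mul_sum, Finset.sum_mul, ← Finset.sum_add_distrib]
  rw [Finset.sum_comm]
  exact Finset.sum_congr rfl fun _ _ => Finset.sum_congr rfl fun _ _ => by ring

theorem hasFrameTen_pathDeriv : ∀ᶠ q in wedgeNhds p, HasFrameTen (fun x => coframe κ c (q.1, x))
      (pathDeriv (fun l x => metricC κ c (l, x)) q.1)
      (fun x => Matrix.of fun a b =>
        strain κ c (fun a => ld (inertial κ c a)) a b (q.1, x)) q.2 := by
  have hY := X.frameField_path (κ := κ)
  refine X.hasFrameTen_of_eventually hκ (fun l => pathDeriv (fun l x => metricC κ c (l, x)) l)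
    (X.stat_strain hκ hY) ?_
  have hm : ∀ μ ν, (fun q => metricC κ c q μ ν) =ᶠ[wedgeNhds p]
      fun q => ∑ a, sgn a * (coframe κ c q a μ * coframe κ c q a ν) := by
    intro μ ν
    filter_upwards [X.eventually_contDiffAt 1] with q hq
    exact metricC_eq (fun α => (hq α).differentiableAt (by simp)) μ ν
  have hm' : ∀ᶠ q in wedgeNhds p, ∀ μ ν, ld (fun q => metricC κ c q μ ν) q
      = ld (fun q => ∑ a, sgn a * (coframe κ c q a μ * coframe κ c q a ν)) q :=
    eventually_all.2 fun μ => eventually_all.2 fun ν => ld_congr (hm μ ν)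
  have hi : ∀ᶠ q in wedgeNhds p, ∀ b, ContDiffAt ℝ 2 (inertial κ c b) q :=
    eventually_all.2 fun b => eventually_wedgeNhds
      (eventually_contDiffAt_nat (X.contDiffAt_inertial b) 2)
  filter_upwards [hm', hi, X.differentiableAt_coframe (κ := κ)] with q h1 h2 h3 μ ν
  have h4 : pathDeriv (fun l x => metricC κ c (l, x)) q.1 q.2 μ ν
      = ld (fun q => metricC κ c q μ ν) q := rfl
  have h5 : ∀ a μ, ld (fun q => coframe κ c q a μ) q = xd μ (ld (inertial κ c a)) q :=
    fun a μ => ld_xd_comm (h2 a) μ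
  rw [h4, h1, ld_eq_fderiv (DifferentiableAt.fun_sum fun a _ =>
    ((h3 a μ).fun_mul (h3 a ν)).const_mul _), fderiv_fun_sum fun a _ =>
    ((h3 a μ).fun_mul (h3 a ν)).const_mul _, _root_.sum_apply]
  refine Finset.sum_congr rfl fun a _ => ?_
  rw [fderiv_const_mul ((h3 a μ).fun_mul (h3 a ν))]
  change sgn a * fderiv ℝ _ q ldir = _
  rw [← ld_eq_fderiv ((h3 a μ).fun_mul (h3 a ν)), ld_mul (h3 a μ) (h3 a ν), h5, h5]

omit X hκ in
theorem differentiable_field {ξ : Pt → Pt} (hz : SymField p fun μ q => ξ q.2 μ) :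
    ∀ᶠ q in wedgeNhds p, ∀ μ, DifferentiableAt ℝ (fun x' => ξ x' μ) q.2 := by
  filter_upwards [eventually_all.2 fun μ => (hz.ord μ).eventually_differentiableAt] with q hq μ
  exact DifferentiableAt.slice (hq μ)

theorem sForm_eventually (Gn : ℝ) {η χ : Pt → Pt} (hη : SymField p fun μ q => η q.2 μ)
    (hχ : SymField p fun μ q => χ q.2 μ) : ∀ᶠ q in wedgeNhds p, ∀ μ ν,
    sForm Gn (fun x => metricC κ c (q.1, x)) (lieDeriv η fun x => metricC κ c (q.1, x)) χ q.2 μ ν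
      = (8 * Real.pi * Gn)⁻¹ * (κ * c 1 q * |(jac c q).det| * ∑ a, ∑ b,
        frame κ c q μ a * frame κ c q ν b * antisym (frameS
        (fun a => toFrame κ c (fun μ q => χ q.2 μ) a q)
        (fun a b => fd κ c a (toFrame κ c (fun μ q => χ q.2 μ) b) q)
        (fun a b => strain κ c (toFrame κ c fun μ q => η q.2 μ) a b q)
        (fun d a b => fd κ c d (strain κ c (toFrame κ c fun μ q => η q.2 μ) a b) q)) a b) := by
  filter_upwards [X.isFrame hκ, X.hasFrameTen_lieDeriv hκ hη, differentiable_field hχ,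
    X.sqrt_det hκ] with q h1 h2 h3 h4 μ ν
  rw [h1.sForm_eq h2 Gn h3, h4, div_eq_inv_mul, mul_assoc]
  rfl

theorem noether_eventually (Gn : ℝ) {ξ : Pt → Pt} (hξ : SymField p fun μ q => ξ q.2 μ) :
    ∀ᶠ q in wedgeNhds p, ∀ μ ν, noether Gn (fun x => metricC κ c (q.1, x)) ξ q.2 μ ν
      = -(8 * Real.pi * Gn)⁻¹ * (κ * c 1 q * |(jac c q).det| * ∑ a, ∑ b,
        frame κ c q μ a * frame κ c q ν b * antisym
        (fun a b => sgn a * fd κ c a (toFrame κ c (fun μ q => ξ q.2 μ) b) q) a b) := by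
  filter_upwards [X.isFrame hκ, differentiable_field hξ, X.sqrt_det hκ] with q h1 h3 h4 μ ν
  rw [h1.noether_eq Gn h3, h4, div_eq_inv_mul, neg_mul, mul_assoc, neg_mul]
  rfl

theorem theta_eventually (Gn : ℝ) : ∀ᶠ q in wedgeNhds p, ∀ μ,
    theta Gn (fun x => metricC κ c (q.1, x))
      (pathDeriv (fun l x => metricC κ c (l, x)) q.1) q.2 μ
      = (16 * Real.pi * Gn)⁻¹ * (κ * c 1 q * |(jac c q).det| * ∑ a, frame κ c q μ a *
        frameTheta (fun d a b => fd κ c d (strain κ c (fun a => ld (inertial κ c a)) a b) q) a) := by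
  filter_upwards [X.isFrame hκ, X.hasFrameTen_pathDeriv hκ, X.sqrt_det hκ] with q h1 h2 h4 μ
  rw [h1.theta_eq h2 Gn, h4, div_eq_inv_mul, mul_assoc]
  rfl

/-- The integrand of the integrability condition vanishes on the horizon. -/
theorem ord_obstruction (Gn : ℝ) {ξ η χ : Pt → Pt} (hξ : SymField p fun μ q => ξ q.2 μ)
    (hη : SymField p fun μ q => η q.2 μ) (hχ : SymField p fun μ q => χ q.2 μ) :
    Ord p 1 fun q => surfaceDensity (obstruction Gn (fun x => metricC κ c (q.1, x))
      (lieDeriv η fun x => metricC κ c (q.1, x)) ξ χ q.2) := by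
  set S : Fin 4 → Fin 4 → ℝ × Pt → ℝ := fun μ ν q => sForm Gn (fun x => metricC κ c (q.1, x))
    (lieDeriv η fun x => metricC κ c (q.1, x)) χ q.2 μ ν with hS
  have hY := X.frameField_sym (κ := κ) hη
  have hV := X.frameField_sym (κ := κ) hχ
  set u : Fin 4 → Fin 4 → ℝ × Pt → ℝ := fun a b q => antisym (frameS
        (fun a => toFrame κ c (fun μ q => χ q.2 μ) a q)
        (fun a b => fd κ c a (toFrame κ c (fun μ q => χ q.2 μ) b) q)
        (fun a b => strain κ c (toFrame κ c fun μ q => η q.2 μ) a b q)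
        (fun d a b => fd κ c d (strain κ c (toFrame κ c fun μ q => η q.2 μ) a b) q)) a b with hu
  have hu0 : ∀ a b, Ord p 0 (u a b) := by
    intro a b
    refine (((X.ord_frameS hκ hY hV a b).sub (X.ord_frameS hκ hY hV b a)).const_mul (1 / 2)).congr
      (Eventually.of_forall fun q => ?_)
    simp only [hu, antisym]; ring
  have hev : ∀ μ ν, S μ ν =ᶠ[wedgeNhds p] fun q => (8 * Real.pi * Gn)⁻¹ *
      (κ * c 1 q * |(jac c q).det| * ∑ a, ∑ b, frame κ c q μ a * frame κ c q ν b * u a b q) := by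
    intro μ ν
    filter_upwards [X.sForm_eventually hκ Gn hη hχ] with q hq
    exact hq μ ν
  have hanti : ∀ μ ν q, S μ ν q = -S ν μ q := by
    intro μ ν q
    simp only [hS, sForm, antisym]; ring
  have hdiag : ∀ μ q, S μ μ q = 0 := fun μ q => by linarith [hanti μ μ q]
  -- Up to `O(ρ)`, `S^{τρ}` is a `τ`-independent volume factor times the frame component `01`, so
  -- its `∂_τ` vanishes on the horizon.
  have h01 : Stat p (S 0 1) := by
    have e1 := X.ord_contract_time_rad hκ hu0 (by ext q; simp [hu, antisym])
      (by ext q; simp [hu, antisym]) (fun q => by simp only [hu, antisym]; ring)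
    have e2 := X.stat_volume.mul (X.stat_frameS hκ hY hV)
    refine ((e1.stat.add e2).const_mul (8 * Real.pi * Gn)⁻¹).congr ((hev 0 1).trans ?_)
    refine Eventually.of_forall fun q => ?_
    simp only [hu]; ring
  have h10 : Stat p (S 1 0) := h01.neg.congr (Eventually.of_forall fun q => hanti 1 0 q)
  have h1A : ∀ A, A = 2 ∨ A = 3 → Ord p 1 (S 1 A) := fun A hA =>
    (((X.ord_contract hu0 (X.frame_rad hκ) (X.frame_angle' hκ hA)).const_mul _).congr
      (hev 1 A)).mono (by norm_num)
  have h0A : ∀ A, A = 2 ∨ A = 3 → Ord p 0 (S 0 A) := fun A hA =>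
    (((X.ord_contract hu0 (X.frame_time hκ) (X.frame_angle' hκ hA)).const_mul _).congr
      (hev 0 A)).mono (by norm_num)
  have hz : ∀ μ, xd μ (S μ μ) = fun _ => 0 := fun μ => by
    ext q; rw [show S μ μ = fun _ => 0 from funext (hdiag μ), xd_const]
  have d1 : Ord p 1 fun q => ∑ α, xd α (S 1 α) q := by
    refine Ord.sum fun α _ => ?_
    refine forall_fin_four (P := fun α => Ord p 1 (xd α (S 1 α))) h10.xd_zero ?_
      (fun A hA => (h1A A hA).xd_of_ne (ne_one hA)) α
    rw [hz]; exact Ord.zero 1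
  -- A crude bound suffices here, since this divergence is multiplied by `ξ^ρ = O(ρ²)`.
  have d0 : Ord p (-1) fun q => ∑ α, xd α (S 0 α) q := by
    refine Ord.sum fun α _ => ?_
    refine forall_fin_four (P := fun α => Ord p (-1) (xd α (S 0 α))) ?_ (by simpa using h01.ord.xd 1)
      (fun A hA => ((h0A A hA).xd_of_ne (ne_one hA)).mono (by norm_num)) α
    rw [hz]; exact Ord.zero (-1)
  refine ((((hξ.ord 0).mul' d1 (n := 1)).sub (hξ.rad.mul' d0 (n := 1))).const_mul (1 / 2)).congr
    (Eventually.of_forall fun q => ?_)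
  simp only [surfaceDensity, obstruction, antisym]
  change ((ξ q.2 0 * (∑ α, xd α (S 1 α) q) - ξ q.2 1 * ∑ α, xd α (S 0 α) q) / 2 -
    (ξ q.2 1 * (∑ α, xd α (S 0 α) q) - ξ q.2 0 * ∑ α, xd α (S 1 α) q) / 2) / 2 = _
  ring

/-- The Noether charge density on the horizon. -/
theorem ord_noether (Gn : ℝ) {ξ : Pt → Pt} (hξ : SymField p fun μ q => ξ q.2 μ) :
    Ord p 1 fun q => noether Gn (fun x => metricC κ c (q.1, x)) ξ q.2 0 1
      - hairC κ Gn c (fun μ q => ξ q.2 μ) q := by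
  have hY := X.frameField_sym (κ := κ) hξ
  set Y := toFrame κ c (fun μ q => ξ q.2 μ)
  set w := pushC c (fun μ q => ξ q.2 μ) 0 with hw
  set u : Fin 4 → Fin 4 → ℝ × Pt → ℝ := fun a b q => antisym
    (fun a b => sgn a * fd κ c a (Y b) q) a b with hu
  have hu0 : ∀ a b, Ord p 0 (u a b) := by
    intro a b
    refine ((((X.stat_fd_field hκ hY a b).ord.const_mul (sgn a)).sub
      ((X.stat_fd_field hκ hY b a).ord.const_mul (sgn b))).const_mul (1 / 2)).congr
      (Eventually.of_forall fun q => ?_)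
    simp only [hu, antisym]; ring
  have e1 := X.ord_contract_time_rad hκ hu0 (by ext q; simp [hu, antisym])
    (by ext q; simp [hu, antisym]) (fun q => by simp only [hu, antisym]; ring)
  -- Raising the index `0` flips one sign, so the antisymmetric part is `-(D_0 Y¹ + D_1 Y⁰) / 2`:
  -- here the two boost entries add up, whereas in the strain they cancel.
  have e2 : Ord p 1 fun q => u 0 1 q + κ * w q := by
    refine (((X.fd_field_one hκ hY 0).add (X.fd_field_zero hκ hY 1)).const_mul (-(1 / 2))).congr
      (Eventually.of_forall fun q => ?_)
    simp [hu, antisym, sgn]; ring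
  have z0 : Ord p 1 fun q => (jac c q)⁻¹ 0 0 - 1 := by
    simpa using (X.inv_zero 0).mono (m := 1) (by norm_num)
  have z1 : Ord p 1 fun q => (jac c q)⁻¹ 1 1 - 1 := by simpa using X.inv_one 1
  have z01 : Ord p 1 fun q => (jac c q)⁻¹ 0 1 := by simpa using X.inv_one 0
  have hJ := ((Stat.det X.stat_jac).abs X.contDiffAt_det_jac X.det_ne).ord
  -- The `τρ` minor of `J⁻¹` equals `1` on the horizon, so of the volume factor only `|det J|`
  -- remains.
  have e3 : Ord p 1 fun q => (jac c q)⁻¹ 0 0 * (jac c q)⁻¹ 1 1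
      - (jac c q)⁻¹ 0 1 * (jac c q)⁻¹ 1 0 - 1 := by
    refine (((z0.mul' (X.stat_inv 1 1).ord (n := 1)).add z1).sub
      (z01.mul' (X.stat_inv 1 0).ord (n := 1))).congr (Eventually.of_forall fun q => ?_)
    dsimp only; ring
  have e4 : Ord p 1 fun q => |(jac c q).det| * (((jac c q)⁻¹ 0 0 * (jac c q)⁻¹ 1 1
      - (jac c q)⁻¹ 0 1 * (jac c q)⁻¹ 1 0) * (u 0 1 q + κ * w q)) :=
    hJ.mul' ((((X.stat_inv 0 0).mul (X.stat_inv 1 1)).sub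
      ((X.stat_inv 0 1).mul (X.stat_inv 1 0))).ord.mul' e2 (n := 1))
  have e5 : Ord p 1 fun q => |(jac c q).det| * (((jac c q)⁻¹ 0 0 * (jac c q)⁻¹ 1 1
      - (jac c q)⁻¹ 0 1 * (jac c q)⁻¹ 1 0 - 1) * (κ * w q)) :=
    hJ.mul' (e3.mul' (hY.time.ord.const_mul κ) (n := 1))
  refine (((e1.add e4).sub e5).const_mul (-(8 * Real.pi * Gn)⁻¹)).congr ?_
  filter_upwards [X.noether_eventually hκ Gn hξ] with q hq
  rw [hq]
  simp only [hairC, ← hw, hu, div_eq_mul_inv]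
  ring

/-- The density of the variation of the charge on the horizon. -/
theorem ord_chargeVariation (Gn : ℝ) {ξ : Pt → Pt} (hξ : SymField p fun μ q => ξ q.2 μ)
    {k : ℝ × Pt → ℝ} (hk : Ord p 0 k)
    (h : Ord p 1 fun q => hairC κ Gn c (fun μ q => ξ q.2 μ) q - k q) :
    Ord p 1 fun q => surfaceDensity (chargeVariation Gn (fun l x => metricC κ c (l, x)) ξ q.1 q.2)
      - ld k q := by
  have hQk : Ord p 1 fun q => noether Gn (fun x => metricC κ c (q.1, x)) ξ q.2 0 1 - k q := by
    refine ((X.ord_noether hκ Gn hξ).add h).congr (Eventually.of_forall fun q => ?_)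
    dsimp only; ring
  have hQ : Ord p 0 fun q => noether Gn (fun x => metricC κ c (q.1, x)) ξ q.2 0 1 := by
    refine ((hQk.mono (by norm_num)).add hk).congr (Eventually.of_forall fun q => ?_)
    dsimp only; ring
  have hY := X.frameField_path (κ := κ)
  have hJ := ((Stat.det X.stat_jac).abs X.contDiffAt_det_jac X.det_ne).ord
  -- The volume factor gives `Θ^μ` one order more than the `μ` row of the frame: `Θ^ρ = O(ρ)` and
  -- `Θ^τ = O(1)`. With `ξ^τ = O(1)` and `ξ^ρ = O(ρ²)`, the potential contributes nothing on the
  -- horizon.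
  have hΘ : ∀ μ k, (∀ a, Ord p k fun q => frame κ c q μ a) → Ord p (k + 1) fun q =>
      theta Gn (fun x => metricC κ c (q.1, x))
      (pathDeriv (fun l x => metricC κ c (l, x)) q.1) q.2 μ := by
    intro μ k hk
    refine ((((X.ord_rad.const_mul κ).mul' hJ (n := 1)).mul' (m := k) (n := k + 1)
      (Ord.sum (s := Finset.univ) fun a _ => (hk a).mul' (X.ord_frameTheta hκ hY a) (by simp))
      (by linarith)).const_mul (16 * Real.pi * Gn)⁻¹).congr ?_
    filter_upwards [X.theta_eventually hκ Gn] with q hq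
    exact hq μ
  have h1 := hΘ 1 0 (X.frame_rad hκ)
  have h0 := hΘ 0 (-1) (X.frame_time hκ)
  refine (hQk.ld.add (((hξ.ord 0).mul' h1 (n := 1)).sub (hξ.rad.mul' h0 (n := 1)))).congr ?_
  filter_upwards [hQ.eventually_differentiableAt, hk.eventually_differentiableAt] with q d1 d2
  rw [ld_sub d1 d2]
  have hanti : (fun l' => noether Gn (fun x => metricC κ c (l', x)) ξ q.2 1 0)
      = fun l' => -noether Gn (fun x => metricC κ c (l', x)) ξ q.2 0 1 := by
    ext l'; simp only [noether, antisym]; ring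
  have hld : ld (fun q => noether Gn (fun x => metricC κ c (q.1, x)) ξ q.2 0 1) q
      = deriv (fun l' => noether Gn (fun x => metricC κ c (l', x)) ξ q.2 0 1) q.1 := rfl
  simp only [surfaceDensity, chargeVariation, hanti, deriv.fun_neg, hld, antisym]
  ring

end IsChart

/-! ### Fields and diffeomorphisms near the horizon -/

/-- The projection to the horizon coordinates as a linear map. -/
def horizL : Pt →L[ℝ] Plane :=
  ContinuousLinearMap.pi ![ContinuousLinearMap.proj 2, ContinuousLinearMap.proj 3]

theorem horizL_apply (x : Pt) : horizL x = horiz x := by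
  ext i; fin_cases i <;> simp [horizL, horiz]

theorem contDiff_horiz {n : ℕ∞ω} : ContDiff ℝ n horiz := by
  have : horiz = horizL := by ext1 x; exact (horizL_apply x).symm
  rw [this]; exact horizL.contDiff

theorem horiz_pt (τ ρ : ℝ) (u : Plane) : horiz (pt τ ρ u) = u := by
  ext i; fin_cases i <;> simp [horiz, pt]

theorem contDiff_pt_zero {n : ℕ∞ω} : ContDiff ℝ n (pt 0 0) := by
  rw [contDiff_pi]
  intro i
  fin_cases i <;> simp [pt] <;> fun_prop

/-- The partial derivatives of a function of `y, z` only. -/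
theorem pd_comp_horiz {φ : Plane → ℝ} {x : Pt} (hφ : DifferentiableAt ℝ φ (horiz x)) :
    (pd 0 (fun x => φ (horiz x)) x = 0 ∧ pd 1 (fun x => φ (horiz x)) x = 0) ∧
    pd 2 (fun x => φ (horiz x)) x = pdPlane 0 φ (horiz x) ∧
    pd 3 (fun x => φ (horiz x)) x = pdPlane 1 φ (horiz x) := by
  have h1 : HasFDerivAt horiz horizL x := by
    have : horiz = horizL := by ext1 x; exact (horizL_apply x).symm
    rw [this]; exact horizL.hasFDerivAt
  have h2 : HasFDerivAt (fun x => φ (horiz x)) _ x := hφ.hasFDerivAt.comp x h1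
  simp only [pd, pdPlane, h2.fderiv, ContinuousLinearMap.comp_apply]
  have e : ∀ i, horizL (Pi.single i 1) = ![(Pi.single i 1 : Pt) 2, (Pi.single i 1 : Pt) 3] :=
    fun i => horizL_apply _
  have e0 : horizL (Pi.single 0 1) = 0 := by rw [e]; ext j; fin_cases j <;> simp
  have e1 : horizL (Pi.single 1 1) = 0 := by rw [e]; ext j; fin_cases j <;> simp
  have e2 : horizL (Pi.single 2 1) = Pi.single 0 1 := by rw [e]; ext j; fin_cases j <;> simp
  have e3 : horizL (Pi.single 3 1) = Pi.single 1 1 := by rw [e]; ext j; fin_cases j <;> simp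
  rw [e0, e1, e2, e3]
  simp

/-- A smooth function of the parameter and of `y, z`. -/
theorem StatSq.of_horiz {p : ℝ × Pt} {φ : ℝ × Plane → ℝ}
    (h : ContDiffAt ℝ ∞ φ (p.1, horiz p.2)) : StatSq p fun q => φ (q.1, horiz q.2) := by
  have hs : ContDiffAt ℝ ∞ (fun q : ℝ × Pt => φ (q.1, horiz q.2)) p :=
    ContDiffAt.comp (f := fun q : ℝ × Pt => (q.1, horiz q.2)) p h
      (contDiffAt_fst.prodMk (contDiff_horiz.contDiffAt.comp p contDiffAt_snd))
  have hd : ∀ᶠ q in wedgeNhds p, DifferentiableAt ℝ φ (q.1, horiz q.2) := by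
    have h1 := (h.of_le (m := 1) (by simp)).eventually (by simp)
    have ht : Tendsto (fun q : ℝ × Pt => (q.1, horiz q.2)) (𝓝 p) (𝓝 (p.1, horiz p.2)) :=
      (continuous_fst.prodMk (contDiff_horiz (n := 0).continuous.comp continuous_snd)).tendsto _
    filter_upwards [eventually_wedgeNhds (ht.eventually h1)] with q hq
    exact hq.differentiableAt (by simp)
  have hp : ∀ᶠ q in wedgeNhds p, (pd 0 (fun x => φ (q.1, horiz x)) q.2 = 0 ∧
      pd 1 (fun x => φ (q.1, horiz x)) q.2 = 0) := by
    filter_upwards [hd] with q hq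
    exact (pd_comp_horiz (φ := fun u => φ (q.1, u))
      (DifferentiableAt.comp (f := fun u => (q.1, u)) _ hq (by fun_prop))).1
  exact ⟨Ord.of_contDiffAt hs, (Ord.zero 2).congr (hp.mono fun q hq => hq.1),
    (Ord.zero 1).congr (hp.mono fun q hq => hq.2)⟩

section algebra
variable {W : Plane → ℝ} {R : Plane → Plane} {U : Pt → Pt}

theorem contDiff_leadField (hW : ContDiff ℝ ∞ W) (hR : ContDiff ℝ ∞ R) (μ : Fin 4) :
    ContDiff ℝ ∞ fun x => leadField W R x μ := by
  have hR' := contDiff_pi.1 (hR.comp contDiff_horiz)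
  fin_cases μ
  · exact hW.comp contDiff_horiz
  · exact contDiff_const
  · exact hR' 0
  · exact hR' 1

theorem InAlgebra.exists_rem (h : InAlgebra W R U) (μ : Fin 4) : ∃ k : ℝ × Pt → ℝ,
    ContDiff ℝ ∞ k ∧ ∀ q, U q.2 μ - leadField W R q.2 μ = q.2 1 ^ 2 * k q := by
  have hU := contDiff_pi.1 h.smooth μ
  obtain ⟨k, hk, e⟩ := exists_eq_rho_sq_mul isOpen_univ
    (f := fun q => U q.2 μ - leadField W R q.2 μ)
    (((hU.comp contDiff_snd).sub ((contDiff_leadField h.smooth_W h.smooth_R μ).comp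
      contDiff_snd)).contDiffOn) (fun _ _ => h.asymp μ)
  rw [univ_prod_univ, contDiffOn_univ] at hk
  exact ⟨k, hk, fun q => e q ⟨trivial, trivial⟩⟩

theorem Ord.of_rho_sq {p : ℝ × Pt} {f k : ℝ × Pt → ℝ} (hk : ContDiffAt ℝ ∞ k p)
    (h : ∀ᶠ q in wedgeNhds p, f q = q.2 1 ^ 2 * k q) : Ord p 2 f :=
  ⟨k, hk, h.mono fun q hq => by rw [hq]; norm_cast⟩

theorem InAlgebra.ord_sub (h : InAlgebra W R U) (p : ℝ × Pt) (μ : Fin 4) :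
    Ord p 2 fun q => U q.2 μ - leadField W R q.2 μ := by
  obtain ⟨k, hk, e⟩ := h.exists_rem μ
  exact Ord.of_rho_sq hk.contDiffAt (Eventually.of_forall e)

theorem statSq_leadField (hW : ContDiff ℝ ∞ W) (hR : ContDiff ℝ ∞ R) (p : ℝ × Pt) (μ : Fin 4) :
    StatSq p fun q => leadField W R q.2 μ := by
  have hR' := contDiff_pi.1 hR
  fin_cases μ
  · exact StatSq.of_horiz (φ := fun v => W v.2) (hW.contDiffAt.comp _ contDiffAt_snd)
  · exact StatSq.const 0
  · exact StatSq.of_horiz (φ := fun v => R v.2 0) ((hR' 0).contDiffAt.comp _ contDiffAt_snd)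
  · exact StatSq.of_horiz (φ := fun v => R v.2 1) ((hR' 1).contDiffAt.comp _ contDiffAt_snd)

theorem InAlgebra.statSq (h : InAlgebra W R U) (p : ℝ × Pt) (μ : Fin 4) :
    StatSq p fun q => U q.2 μ :=
  ((statSq_leadField h.smooth_W h.smooth_R p μ).add (h.ord_sub p μ).statSq).congr
    (Eventually.of_forall fun q => by simp)

theorem InAlgebra.symField (h : InAlgebra W R U) (p : ℝ × Pt) : SymField p fun μ q => U q.2 μ :=
  ⟨(h.ord_sub p 1).congr (Eventually.of_forall fun q => by simp [leadField]),
    fun a _ => h.statSq p a⟩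

end algebra

section path
variable {I : Set ℝ} {P : ℝ → Plane → ℝ} {G : ℝ → Plane → Plane} {γ : ℝ → Pt → Pt}

/-- The condition `O(ρ²)` speaks only of `ρ > 0`; smoothness extends it to equality at `ρ = 0`. -/
theorem IsGamma.apply_horizon {P : Plane → ℝ} {G : Plane → Plane} {γ : Pt → Pt}
    (h : IsGamma P G γ) {x : Pt} (hx : x 1 = 0) (μ : Fin 4) : γ x μ = leadMap P G x μ := by
  have hG := contDiff_pi.1 (h.smooth_G.comp contDiff_horiz)
  have hP := h.smooth_P.comp contDiff_horiz
  have hL : ContDiff ℝ ∞ fun x => leadMap P G x μ := by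
    fin_cases μ
    · exact ContDiff.add (by fun_prop) hP
    · show ContDiff ℝ ∞ fun x : Pt => x 1
      fun_prop
    · exact hG 0
    · exact hG 1
  obtain ⟨k, -, e⟩ := exists_eq_rho_sq_mul isOpen_univ (f := fun q => γ q.2 μ - leadMap P G q.2 μ)
    ((((contDiff_pi.1 h.smooth μ).comp contDiff_snd).sub (hL.comp contDiff_snd)).contDiffOn)
    (fun _ _ => h.asymp μ)
  have := e (0, x) ⟨trivial, trivial⟩
  simp only [hx] at this
  linarith

theorem IsGamma.toPath {P : Plane → ℝ} {G : Plane → Plane} {γ : Pt → Pt} (h : IsGamma P G γ) :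
    IsGammaPath univ (fun _ => P) (fun _ => G) fun _ => γ :=
  ⟨isOpen_univ, (h.smooth.comp contDiff_snd).contDiffOn, fun _ _ => h⟩

namespace IsGammaPath
variable (h : IsGammaPath I P G γ)
include h

theorem isOpen_prod {E : Type*} [TopologicalSpace E] : IsOpen (I ×ˢ (univ : Set E)) :=
  h.isOpen.prod isOpen_univ

theorem contDiffAt {l : ℝ} (hl : l ∈ I) (x : Pt) (α : Fin 4) :
    ContDiffAt ℝ ∞ (fun q : ℝ × Pt => γ q.1 q.2 α) (l, x) :=
  contDiffAt_pi.1 (h.smooth.contDiffAt (h.isOpen_prod.mem_nhds ⟨hl, trivial⟩)) α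

/-- The restriction of the family of maps to the horizon. -/
theorem contDiffOn_horizon (α : Fin 4) :
    ContDiffOn ℝ ∞ (fun v : ℝ × Plane => γ v.1 (pt 0 0 v.2) α) (I ×ˢ univ) :=
  (contDiffOn_pi.1 h.smooth α).comp
    (contDiff_fst.prodMk (contDiff_pt_zero.comp contDiff_snd)).contDiffOn
    (fun _ hv => ⟨hv.1, trivial⟩)

/-- Joint smoothness of `P` and `G` in `(λ, u)` is not part of `IsGammaPath`; it is read off from
the values of `γ_λ` at `τ = ρ = 0`. -/
theorem contDiffOn_P : ContDiffOn ℝ ∞ (fun v : ℝ × Plane => P v.1 v.2) (I ×ˢ univ) := by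
  refine (h.contDiffOn_horizon 0).congr fun v hv => ?_
  rw [(h.mem v.1 hv.1).apply_horizon (by simp [pt])]
  simp only [leadMap, horiz_pt]
  simp [pt]

theorem contDiffOn_G (A : Fin 2) :
    ContDiffOn ℝ ∞ (fun v : ℝ × Plane => G v.1 v.2 A) (I ×ˢ univ) := by
  fin_cases A
  · refine (h.contDiffOn_horizon 2).congr fun v hv => ?_
    rw [(h.mem v.1 hv.1).apply_horizon (by simp [pt])]
    simp [leadMap, horiz_pt]
  · refine (h.contDiffOn_horizon 3).congr fun v hv => ?_
    rw [(h.mem v.1 hv.1).apply_horizon (by simp [pt])]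
    simp [leadMap, horiz_pt]

theorem contDiffOn_lead (α : Fin 4) : ContDiffOn ℝ ∞
    (fun q : ℝ × Pt => leadMap (P q.1) (G q.1) q.2 α) (I ×ˢ univ) := by
  have hh : ContDiffOn ℝ ∞ (fun q : ℝ × Pt => (q.1, horiz q.2)) (I ×ˢ univ) :=
    (contDiff_fst.prodMk (contDiff_horiz.comp contDiff_snd)).contDiffOn
  have hm : MapsTo (fun q : ℝ × Pt => (q.1, horiz q.2)) (I ×ˢ univ) (I ×ˢ univ) :=
    fun q hq => ⟨hq.1, trivial⟩
  fin_cases α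
  · refine ContDiffOn.add ?_ (h.contDiffOn_P.comp hh hm)
    exact ContDiff.contDiffOn (by fun_prop)
  · show ContDiffOn ℝ ∞ (fun q : ℝ × Pt => q.2 1) _
    exact ContDiff.contDiffOn (by fun_prop)
  · exact (h.contDiffOn_G 0).comp hh hm
  · exact (h.contDiffOn_G 1).comp hh hm

theorem ord_sub_lead {p : ℝ × Pt} (hp : p.1 ∈ I) (α : Fin 4) :
    Ord p 2 fun q => γ q.1 q.2 α - leadMap (P q.1) (G q.1) q.2 α := by
  obtain ⟨k, hk, e⟩ := exists_eq_rho_sq_mul h.isOpen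
    ((contDiffOn_pi.1 h.smooth α).sub (h.contDiffOn_lead α)) (fun l hl => (h.mem l hl).asymp α)
  have hn : I ×ˢ univ ∈ 𝓝 p := h.isOpen_prod.mem_nhds ⟨hp, trivial⟩
  exact Ord.of_rho_sq (hk.contDiffAt hn) (eventually_wedgeNhds (by
    filter_upwards [hn] with q hq using e q hq))

theorem isChart {p : ℝ × Pt} (hp : p.1 ∈ I) (hρ : p.2 1 = 0) :
    IsChart p fun α q => γ q.1 q.2 α := by
  have hn : I ×ˢ (univ : Set Plane) ∈ 𝓝 (p.1, horiz p.2) := h.isOpen_prod.mem_nhds ⟨hp, trivial⟩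
  have hP := StatSq.of_horiz (p := p) (h.contDiffOn_P.contDiffAt hn)
  have hG := fun A => StatSq.of_horiz (p := p) ((h.contDiffOn_G A).contDiffAt hn)
  refine ⟨hρ, fun α => h.contDiffAt hp p.2 α, h.ord_sub_lead hp 1, ?_, ?_, ?_,
    (h.mem p.1 hp).regular p.2 hρ.ge⟩
  · refine (hP.add (h.ord_sub_lead hp 0).statSq).congr (Eventually.of_forall fun q => ?_)
    simp only [leadMap, Matrix.cons_val_zero]
    ring
  · refine ((hG 0).add (h.ord_sub_lead hp 2).statSq).congr (Eventually.of_forall fun q => ?_)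
    simp [leadMap]
  · refine ((hG 1).add (h.ord_sub_lead hp 3).statSq).congr (Eventually.of_forall fun q => ?_)
    simp [leadMap]

end IsGammaPath
end path

/-! ### The charge density on the horizon -/

/-- The Jacobian determinant of a map of the plane. -/
def planeDet (G : Plane → Plane) (u : Plane) : ℝ :=
  pdPlane 0 (fun u => G u 0) u * pdPlane 1 (fun u => G u 1) u
    - pdPlane 1 (fun u => G u 0) u * pdPlane 0 (fun u => G u 1) u

/-- The density of the charge on the horizon. -/
def hair (κ Gn : ℝ) (W : Plane → ℝ) (R : Plane → Plane) (P : Plane → ℝ) (G : Plane → Plane)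
    (u : Plane) : ℝ :=
  κ / (8 * Real.pi * Gn) * (|planeDet G u| * (W u + along R P u))

/-- `L` is the Gram determinant of the columns of `DG`, hence the square of the Jacobian of `G`. -/
theorem sqrt_Ldet (G : Plane → Plane) (u : Plane) : Real.sqrt (Ldet G u) = |planeDet G u| := by
  rw [← Real.sqrt_sq_eq_abs]
  congr 1
  simp only [Ldet, L2, planeDet, Fin.sum_univ_two]
  ring

/-! ### Germs modulo `O(ρ)`. -/

section mod
variable {p : ℝ × Pt}

theorem Ord.mul_sub_mul {k : ℤ} {f g f' g' : ℝ × Pt → ℝ} (hf : Ord p k fun q => f q - f' q)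
    (hg : Ord p k fun q => g q - g' q) (hf' : Ord p 0 f') (hg0 : Ord p 0 g) :
    Ord p k fun q => f q * g q - f' q * g' q := by
  refine ((hf.mul' hg0 (n := k)).add (hf'.mul' hg (n := k))).congr (Eventually.of_forall fun q => ?_)
  dsimp only; ring

theorem Ord.of_sub {f f' : ℝ × Pt → ℝ} (hf : Ord p 1 fun q => f q - f' q) (h : Ord p 0 f) :
    Ord p 0 f' := by
  refine (h.sub (hf.mono (by norm_num))).congr (Eventually.of_forall fun q => ?_)
  dsimp only; ring

theorem Ord.prod {ι : Type*} {s : Finset ι} {F : ι → ℝ × Pt → ℝ} (h : ∀ i ∈ s, Ord p 0 (F i)) :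
    Ord p 0 fun q => ∏ i ∈ s, F i q := by
  classical
  induction s using Finset.induction_on with
  | empty => simpa using Ord.const 1
  | insert a s ha ih =>
    simp only [Finset.prod_insert ha]
    exact (h a (by simp)).mul' (ih fun i hi => h i (by simp [hi]))

theorem Ord.prod_sub_prod {ι : Type*} {s : Finset ι} {F F' : ι → ℝ × Pt → ℝ}
    (h : ∀ i ∈ s, Ord p 0 (F i)) (h' : ∀ i ∈ s, Ord p 1 fun q => F i q - F' i q) :
    Ord p 1 fun q => ∏ i ∈ s, F i q - ∏ i ∈ s, F' i q := by
  classical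
  induction s using Finset.induction_on with
  | empty => simpa using Ord.zero 1
  | insert a s ha ih =>
    simp only [Finset.prod_insert ha]
    exact Ord.mul_sub_mul (h' a (by simp)) (ih (fun i hi => h i (by simp [hi]))
      fun i hi => h' i (by simp [hi])) ((h' a (by simp)).of_sub (h a (by simp)))
      (Ord.prod fun i hi => h i (by simp [hi]))

theorem Ord.det_sub_det {n : ℕ} {A B : ℝ × Pt → Matrix (Fin n) (Fin n) ℝ}
    (h : ∀ i j, Ord p 0 fun q => A q i j) (h' : ∀ i j, Ord p 1 fun q => A q i j - B q i j) :
    Ord p 1 fun q => (A q).det - (B q).det := by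
  simp only [Matrix.det_apply, Units.smul_def, zsmul_eq_mul, ← Finset.sum_sub_distrib, ← mul_sub]
  exact Ord.sum fun σ _ => (Ord.prod_sub_prod (fun i _ => h _ _) fun i _ => h' _ _).const_mul _

theorem tendsto_pt_wedgeNhds (l τ : ℝ) (u : Plane) :
    Tendsto (fun ρ => (l, pt τ ρ u)) (𝓝[>] 0) (wedgeNhds (l, pt τ 0 u)) := by
  refine tendsto_nhdsWithin_iff.2 ⟨?_, ?_⟩
  · exact ((continuous_const.prodMk (continuous_pt τ u)).tendsto' 0 _ rfl).mono_left
      nhdsWithin_le_nhds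
  · filter_upwards [self_mem_nhdsWithin] with ρ hρ
    simpa [pt] using hρ

/-- `Ord` controls `f` only at `ρ > 0`; continuity transfers the limit to the value at `p`. -/
theorem Ord.apply_eq_zero {f : ℝ × Pt → ℝ} (hf : Ord p 1 f) (hc : ContinuousAt f p)
    (hp : p.2 1 = 0) : f p = 0 := by
  obtain ⟨g, hg, e⟩ := hf
  have ht := tendsto_pt_wedgeNhds p.1 (p.2 0) (horiz p.2)
  rw [pt_zero_horiz hp] at ht
  have h1 := (hc.tendsto.mono_left nhdsWithin_le_nhds).comp ht
  have h2 : Tendsto (fun q : ℝ × Pt => q.2 1 ^ (1 : ℤ) * g q) (wedgeNhds p) (𝓝 (p.2 1 * g p)) := by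
    simp only [zpow_one]
    exact (ContinuousAt.mul (by fun_prop) hg.continuousAt).tendsto.mono_left nhdsWithin_le_nhds
  have h3 := (h2.congr' e.symm).comp ht
  have := tendsto_nhds_unique h1 h3
  rw [this, hp, zero_mul]

end mod

namespace IsGammaPath
variable {I : Set ℝ} {P : ℝ → Plane → ℝ} {G : ℝ → Plane → Plane} {γ : ℝ → Pt → Pt}
  (h : IsGammaPath I P G γ)
include h

theorem contDiffOn_pdP (A : Fin 2) :
    ContDiffOn ℝ ∞ (fun v : ℝ × Plane => pdPlane A (P v.1) v.2) (I ×ˢ univ) := by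
  refine ((h.contDiffOn_P.fderiv_of_isOpen h.isOpen_prod (m := ∞) (by simp)).clm_apply
    (contDiffOn_const (c := ((0 : ℝ), (Pi.single A 1 : Plane))))).congr fun v hv => ?_
  have hd : DifferentiableAt ℝ (fun v : ℝ × Plane => P v.1 v.2) v :=
    (h.contDiffOn_P.differentiableOn (by simp)).differentiableAt (h.isOpen_prod.mem_nhds hv)
  have h1 : HasFDerivAt (fun u => P v.1 u) _ v.2 :=
    HasFDerivAt.comp (g := fun v : ℝ × Plane => P v.1 v.2) (f := fun u => (v.1, u)) v.2
      hd.hasFDerivAt (hasFDerivAt_prodMk_right (𝕜 := ℝ) v.1 v.2)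
  simp [pdPlane, h1.fderiv]

theorem contDiffOn_pdG (A B : Fin 2) :
    ContDiffOn ℝ ∞ (fun v : ℝ × Plane => pdPlane A (fun u => G v.1 u B) v.2) (I ×ˢ univ) := by
  refine (((h.contDiffOn_G B).fderiv_of_isOpen h.isOpen_prod (m := ∞) (by simp)).clm_apply
    (contDiffOn_const (c := ((0 : ℝ), (Pi.single A 1 : Plane))))).congr fun v hv => ?_
  have hd : DifferentiableAt ℝ (fun v : ℝ × Plane => G v.1 v.2 B) v :=
    ((h.contDiffOn_G B).differentiableOn (by simp)).differentiableAt (h.isOpen_prod.mem_nhds hv)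
  have h1 : HasFDerivAt (fun u => G v.1 u B) _ v.2 :=
    HasFDerivAt.comp (g := fun v : ℝ × Plane => G v.1 v.2 B) (f := fun u => (v.1, u)) v.2
      hd.hasFDerivAt (hasFDerivAt_prodMk_right (𝕜 := ℝ) v.1 v.2)
  simp [pdPlane, h1.fderiv]

theorem contDiffOn_planeDet :
    ContDiffOn ℝ ∞ (fun v : ℝ × Plane => planeDet (G v.1) v.2) (I ×ˢ univ) :=
  ((h.contDiffOn_pdG 0 0).mul (h.contDiffOn_pdG 1 1)).sub
    ((h.contDiffOn_pdG 1 0).mul (h.contDiffOn_pdG 0 1))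

theorem jac_sub_lead {p : ℝ × Pt} (hp : p.1 ∈ I) (α μ : Fin 4) : Ord p 1 fun q =>
    jac (fun α q => γ q.1 q.2 α) q α μ - (!![1, 0, pdPlane 0 (P q.1) (horiz q.2),
        pdPlane 1 (P q.1) (horiz q.2);
      0, 1, 0, 0;
      0, 0, pdPlane 0 (fun u => G q.1 u 0) (horiz q.2), pdPlane 1 (fun u => G q.1 u 0) (horiz q.2);
      0, 0, pdPlane 0 (fun u => G q.1 u 1) (horiz q.2), pdPlane 1 (fun u => G q.1 u 1) (horiz q.2)]
      : Matrix (Fin 4) (Fin 4) ℝ) α μ := by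
  have hn : I ×ˢ univ ∈ 𝓝 p := h.isOpen_prod.mem_nhds ⟨hp, trivial⟩
  refine ((h.ord_sub_lead hp α).xd μ).congr ?_
  have hd1 : ∀ᶠ q in wedgeNhds p, DifferentiableAt ℝ (fun q : ℝ × Pt => γ q.1 q.2 α) q :=
    (Ord.of_contDiffAt (h.contDiffAt hp p.2 α)).eventually_differentiableAt
  have hd2 : ∀ᶠ q in wedgeNhds p,
      DifferentiableAt ℝ (fun q : ℝ × Pt => leadMap (P q.1) (G q.1) q.2 α) q :=
    (Ord.of_contDiffAt ((h.contDiffOn_lead α).contDiffAt hn)).eventually_differentiableAt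
  filter_upwards [hd1, hd2, eventually_wedgeNhds hn] with q d1 d2 hq
  rw [xd_sub d1 d2]
  have hl : q.1 ∈ I := hq.1
  have hPd : DifferentiableAt ℝ (P q.1) (horiz q.2) :=
    (h.mem q.1 hl).smooth_P.differentiable (by simp) _
  have hGd : ∀ A, DifferentiableAt ℝ (fun u => G q.1 u A) (horiz q.2) := fun A =>
    (contDiff_pi.1 (h.mem q.1 hl).smooth_G A).differentiable (by simp) _
  obtain ⟨⟨p0, p1⟩, p2, p3⟩ := pd_comp_horiz hPd
  obtain ⟨⟨a0, a1⟩, a2, a3⟩ := pd_comp_horiz (hGd 0)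
  obtain ⟨⟨b0, b1⟩, b2, b3⟩ := pd_comp_horiz (hGd 1)
  have hPx : DifferentiableAt ℝ (fun x => P q.1 (horiz x)) q.2 :=
    DifferentiableAt.comp q.2 hPd (contDiff_horiz (n := 1).differentiable (by simp) _)
  have hc : ∀ μ ν : Fin 4, pd μ (fun x : Pt => x ν) q.2 = if ν = μ then 1 else 0 :=
    fun μ ν => IsChart.xd_coord μ ν q
  have hsum : ∀ μ, pd μ (fun x => x 0 + P q.1 (horiz x)) q.2
      = (if 0 = μ then 1 else 0) + pd μ (fun x => P q.1 (horiz x)) q.2 := by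
    intro μ
    rw [← hc μ 0]
    simp only [pd]
    rw [fderiv_fun_add (by fun_prop) hPx]
    rfl
  congr 1
  have e0 : xd μ (fun q => leadMap (P q.1) (G q.1) q.2 0) q
      = pd μ (fun x => x 0 + P q.1 (horiz x)) q.2 := rfl
  have e1 : xd μ (fun q => leadMap (P q.1) (G q.1) q.2 1) q = pd μ (fun x => x 1) q.2 := rfl
  have e2 : xd μ (fun q => leadMap (P q.1) (G q.1) q.2 2) q
      = pd μ (fun x => G q.1 (horiz x) 0) q.2 := rfl
  have e3 : xd μ (fun q => leadMap (P q.1) (G q.1) q.2 3) q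
      = pd μ (fun x => G q.1 (horiz x) 1) q.2 := rfl
  fin_cases α
  · refine Eq.trans ?_ e0.symm
    rw [hsum]
    fin_cases μ <;> simp [p0, p1, p2, p3]
  · refine Eq.trans ?_ e1.symm
    rw [hc]
    fin_cases μ <;> simp
  · refine Eq.trans ?_ e2.symm
    fin_cases μ <;> simp [a0, a1, a2, a3]
  · refine Eq.trans ?_ e3.symm
    fin_cases μ <;> simp [b0, b1, b2, b3]

theorem det_sub_lead {p : ℝ × Pt} (hp : p.1 ∈ I) (hρ : p.2 1 = 0) : Ord p 1 fun q =>
    (jac (fun α q => γ q.1 q.2 α) q).det - planeDet (G q.1) (horiz q.2) := by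
  refine (Ord.det_sub_det (fun α μ => ((h.isChart hp hρ).stat_jac α μ).ord)
    (h.jac_sub_lead hp)).congr (Eventually.of_forall fun q => ?_)
  simp [Matrix.det_succ_row_zero, Fin.sum_univ_succ, Fin.succAbove, planeDet]
  ring

theorem contDiffAt_planeDet_horiz {p : ℝ × Pt} (hp : p.1 ∈ I) :
    ContDiffAt ℝ ∞ (fun q : ℝ × Pt => planeDet (G q.1) (horiz q.2)) p :=
  ContDiffAt.comp (f := fun q : ℝ × Pt => (q.1, horiz q.2)) p
    (h.contDiffOn_planeDet.contDiffAt (h.isOpen_prod.mem_nhds ⟨hp, trivial⟩))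
    (contDiffAt_fst.prodMk (contDiff_horiz.contDiffAt.comp p contDiffAt_snd))

theorem det_eq {p : ℝ × Pt} (hp : p.1 ∈ I) (hρ : p.2 1 = 0) :
    (jac (fun α q => γ q.1 q.2 α) p).det = planeDet (G p.1) (horiz p.2) := by
  have := (h.det_sub_lead hp hρ).apply_eq_zero
    ((h.isChart hp hρ).contDiffAt_det_jac.continuousAt.sub
      (h.contDiffAt_planeDet_horiz hp).continuousAt) hρ
  linarith

/-- Regularity of `γ_l` holds up to the horizon, where its Jacobian is that of `G_l`. Consequently
`|planeDet|` is smooth. -/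
theorem planeDet_ne {l : ℝ} (hl : l ∈ I) (u : Plane) : planeDet (G l) u ≠ 0 := by
  have hρ : (pt 0 0 u) 1 = 0 := by simp [pt]
  have := (h.isChart (p := (l, pt 0 0 u)) hl hρ).det_ne
  rwa [h.det_eq (p := (l, pt 0 0 u)) hl hρ, horiz_pt] at this

theorem contDiffOn_hair (κ Gn : ℝ) {W : Plane → ℝ} {R : Plane → Plane} (hW : ContDiff ℝ ∞ W)
    (hR : ContDiff ℝ ∞ R) :
    ContDiffOn ℝ ∞ (fun v : ℝ × Plane => hair κ Gn W R (P v.1) (G v.1) v.2) (I ×ˢ univ) := by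
  have habs : ContDiffOn ℝ ∞ (fun v : ℝ × Plane => |planeDet (G v.1) v.2|) (I ×ˢ univ) :=
    fun v hv => ContDiffAt.comp_contDiffWithinAt (g := fun x : ℝ => |x|) v
      (contDiffAt_abs (h.planeDet_ne hv.1 v.2)) (h.contDiffOn_planeDet v hv)
  refine contDiffOn_const.mul (habs.mul (ContDiffOn.add (hW.comp contDiff_snd).contDiffOn ?_))
  exact ContDiffOn.sum fun A _ => ((contDiff_pi.1 hR A).comp contDiff_snd).contDiffOn.mul
    (h.contDiffOn_pdP A)

/-- On the horizon the first row of the Jacobian is `(1, 0, ∂_y P, ∂_z P)`; applied to `(W, 0, R)`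
it gives `W + R^A ∂_A P`. -/
theorem ord_hair {p : ℝ × Pt} (hp : p.1 ∈ I) (hρ : p.2 1 = 0) (κ Gn : ℝ) {W : Plane → ℝ}
    {R : Plane → Plane} {ξ : Pt → Pt} (hξ : InAlgebra W R ξ) : Ord p 1 fun q =>
      hairC κ Gn (fun α q => γ q.1 q.2 α) (fun μ q => ξ q.2 μ) q
        - hair κ Gn W R (P q.1) (G q.1) (horiz q.2) := by
  have X := h.isChart hp hρ
  have habs : Ord p 1 fun q => |(jac (fun α q => γ q.1 q.2 α) q).det|
      - |planeDet (G q.1) (horiz q.2)| := by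
    have hd := h.det_sub_lead hp hρ
    have c1 := X.contDiffAt_det_jac.continuousAt
    have c2 := (h.contDiffAt_planeDet_horiz hp).continuousAt
    have hne := X.det_ne
    have he := h.det_eq hp hρ
    -- The two determinants agree and are nonzero at `p`, so they share a constant sign nearby and
    -- the absolute values can be removed.
    rcases hne.lt_or_gt with h0 | h0
    · refine hd.neg.congr ?_
      filter_upwards [eventually_wedgeNhds (c1.eventually_lt_const h0),
        eventually_wedgeNhds (c2.eventually_lt_const (he ▸ h0 : planeDet (G p.1) (horiz p.2) < 0))] with q h1 h2
      rw [abs_of_neg h1, abs_of_neg h2]; ring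
    · refine hd.congr ?_
      filter_upwards [eventually_wedgeNhds (c1.eventually_const_lt h0),
        eventually_wedgeNhds (c2.eventually_const_lt (he ▸ h0 : 0 < planeDet (G p.1) (horiz p.2)))] with q h1 h2
      rw [abs_of_pos h1, abs_of_pos h2]
  have hz := hξ.symField p
  have hpush : Ord p 1 fun q => pushC (fun α q => γ q.1 q.2 α) (fun μ q => ξ q.2 μ) 0 q
      - (W (horiz q.2) + along R (P q.1) (horiz q.2)) := by
    refine (Ord.sum (s := Finset.univ) fun β _ => Ord.mul_sub_mul (h.jac_sub_lead hp 0 β)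
      ((hξ.ord_sub p β).mono (by norm_num)) ((h.jac_sub_lead hp 0 β).of_sub (X.stat_jac 0 β).ord)
      (hz.ord β)).congr (Eventually.of_forall fun q => ?_)
    simp only [pushC, along, Fin.sum_univ_four, Fin.sum_univ_two, leadField, Matrix.of_apply,
      Matrix.cons_val]
    ring
  have hJ := ((Stat.det X.stat_jac).abs X.contDiffAt_det_jac X.det_ne).ord
  refine ((Ord.mul_sub_mul habs hpush (habs.of_sub hJ)
    (X.statSq_push hz (by decide)).ord).const_mul (κ / (8 * Real.pi * Gn))).congr
    (Eventually.of_forall fun q => ?_)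
  simp only [hairC, hair]; ring

end IsGammaPath

/-! ### Integrals over the horizon -/

theorem continuous_pt_pair (τ : ℝ) : Continuous fun z : ℝ × Plane => pt τ z.1 z.2 := by
  refine continuous_pi fun i => ?_
  fin_cases i <;> simp [pt] <;> fun_prop

theorem tendsto_pt_prod (l τ : ℝ) (u : Plane) :
    Tendsto (fun z : ℝ × Plane => (l, pt τ z.1 z.2)) (𝓝[>] 0 ×ˢ 𝓝 u)
      (wedgeNhds (l, pt τ 0 u)) := by
  refine tendsto_nhdsWithin_iff.2 ⟨?_, ?_⟩
  · have : Tendsto (fun z : ℝ × Plane => (l, pt τ z.1 z.2)) (𝓝 (0, u)) (𝓝 (l, pt τ 0 u)) :=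
      (continuous_const.prodMk (continuous_pt_pair τ)).tendsto' _ _ rfl
    rw [nhds_prod_eq] at this
    exact this.mono_left (Filter.prod_mono nhdsWithin_le_nhds le_rfl)
  · filter_upwards [(tendsto_fst (f := 𝓝[>] (0 : ℝ)) (g := 𝓝 u)).eventually
      self_mem_nhdsWithin] with z hz
    simpa [pt] using hz

theorem Ord.tendsto_zero {p : ℝ × Pt} {f : ℝ × Pt → ℝ} (hf : Ord p 1 f) (hp : p.2 1 = 0) :
    Tendsto f (wedgeNhds p) (𝓝 0) := by
  obtain ⟨g, hg, e⟩ := hf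
  refine Tendsto.congr' e.symm ?_
  have h2 : Tendsto (fun q : ℝ × Pt => q.2 1 ^ (1 : ℤ) * g q) (wedgeNhds p) (𝓝 (p.2 1 * g p)) := by
    simp only [zpow_one]
    exact (ContinuousAt.mul (by fun_prop) hg.continuousAt).tendsto.mono_left nhdsWithin_le_nhds
  simpa [hp] using h2

/-- An event near every point of the horizon holds uniformly on compact sets. -/
theorem eventually_forall_wedge {l τ : ℝ} {K : Set Plane} (hK : IsCompact K)
    {E : ℝ × Pt → Prop} (h : ∀ u ∈ K, ∀ᶠ q in wedgeNhds (l, pt τ 0 u), E q) :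
    ∀ᶠ ρ in 𝓝[>] (0 : ℝ), ∀ u ∈ K, E (l, pt τ ρ u) := by
  rw [eventually_nhdsWithin_iff]
  have : ∀ᶠ ρ in 𝓝 (0 : ℝ), ∀ u ∈ K, ρ ∈ Ioi (0 : ℝ) → E (l, pt τ ρ u) := by
    refine hK.eventually_forall_of_forall_eventually fun u hu => ?_
    have h1 := (tendsto_pt_prod l τ u).eventually (h u hu)
    have h2 : 𝓝[>] (0 : ℝ) ×ˢ 𝓝 u = 𝓝 (0, u) ⊓ 𝓟 (Ioi 0 ×ˢ univ) := by
      rw [← nhdsWithin, nhdsWithin_prod_eq, nhdsWithin_univ]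
    rw [h2, eventually_inf_principal] at h1
    filter_upwards [h1] with z hz hz0 using hz ⟨hz0, trivial⟩
  filter_upwards [this] with ρ h1 h2 u hu using h1 u hu h2

theorem isOpen_outer (r : ℝ) : IsOpen {u : Plane | r < |u 0| ∨ r < |u 1|} :=
  (isOpen_lt continuous_const (by fun_prop : Continuous fun u : Plane => |u 0|)).union
    (isOpen_lt continuous_const (by fun_prop : Continuous fun u : Plane => |u 1|))

theorem outer_of_notMem_closedBall {r : ℝ} {u : Plane} (hu : u ∉ Metric.closedBall 0 |r|) :
    r < |u 0| ∨ r < |u 1| := by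
  by_contra! hc
  refine hu ?_
  rw [mem_closedBall_zero_iff, pi_norm_le_iff_of_nonneg (abs_nonneg _)]
  intro i
  rw [Real.norm_eq_abs]
  fin_cases i
  · exact hc.1.trans (le_abs_self _)
  · exact hc.2.trans (le_abs_self _)

/-- The local estimates become uniform on a closed ball by compactness, and outside it `F` vanishes
at `ρ > 0`. Hence the integrands are continuous with compact support for small `ρ`, and are
dominated by `|f| + 1` on the ball. Off the ball `f` is zero as well, being the limit of `F`. -/
theorem tendsto_integral_of_ord {l τ r : ℝ} {F : ℝ × Pt → ℝ} {f : ℝ → Plane → ℝ}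
    (hf : Continuous (f l)) (hF : ∀ u, Ord (l, pt τ 0 u) 1 fun q => F q - f q.1 (horiz q.2))
    (h0 : ∀ x : Pt, 0 < x 1 → (r < |x 2| ∨ r < |x 3|) → F (l, x) = 0) :
    (∀ᶠ ρ in 𝓝[>] (0 : ℝ), Integrable fun u : Plane => F (l, pt τ ρ u)) ∧
    Tendsto (fun ρ : ℝ => ∫ u : Plane, F (l, pt τ ρ u)) (𝓝[>] 0) (𝓝 (∫ u, f l u)) := by
  set K : Set Plane := Metric.closedBall 0 |r|
  have hK : IsCompact K := isCompact_closedBall _ _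
  have hout : ∀ u ∉ K, r < |u 0| ∨ r < |u 1| := fun u hu => outer_of_notMem_closedBall hu
  have hpt : ∀ ρ : ℝ, Continuous fun u : Plane => (l, pt τ ρ u) := fun ρ =>
    continuous_const.prodMk ((continuous_pt_pair τ).comp (continuous_const.prodMk continuous_id))
  have hz : ∀ ρ : ℝ, 0 < ρ → ∀ u : Plane, (r < |u 0| ∨ r < |u 1|) → F (l, pt τ ρ u) = 0 :=
    fun ρ hρ u hu => h0 _ (by simpa [pt] using hρ) (by simpa [pt] using hu)
  have hcont : ∀ᶠ ρ in 𝓝[>] (0 : ℝ), Continuous fun u : Plane => F (l, pt τ ρ u) := by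
    have h1 := eventually_forall_wedge (l := l) (τ := τ) hK
      (fun u _ => (hF u).eventually_contDiffAt 1)
    filter_upwards [h1, self_mem_nhdsWithin] with ρ h1 hρ
    rw [continuous_iff_continuousAt]
    intro u
    by_cases hu : u ∈ K
    · have h2 := ContinuousAt.comp (f := fun u : Plane => (l, pt τ ρ u)) (h1 u hu).continuousAt
        (hpt ρ).continuousAt
      refine (h2.add hf.continuousAt).congr (Eventually.of_forall fun v => ?_)
      simp [Function.comp, horiz_pt]
    · refine (continuousAt_const (y := (0 : ℝ))).congr ?_
      filter_upwards [(isOpen_outer r).mem_nhds (hout u hu)] with v hv using (hz ρ hρ v hv).symm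
  have hbd : ∀ᶠ ρ in 𝓝[>] (0 : ℝ), ∀ u ∈ K, ‖F (l, pt τ ρ u) - f l u‖ < 1 := by
    have h1 := eventually_forall_wedge (l := l) (τ := τ) hK (fun u _ =>
      ((hF u).tendsto_zero (by simp [pt])).eventually (Metric.ball_mem_nhds 0 one_pos))
    filter_upwards [h1] with ρ h1 u hu
    simpa [horiz_pt] using h1 u hu
  constructor
  · filter_upwards [hcont, self_mem_nhdsWithin] with ρ hc hρ
    exact hc.integrable_of_hasCompactSupport (HasCompactSupport.intro hK fun u hu =>
      hz ρ hρ u (hout u hu))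
  · refine tendsto_integral_filter_of_dominated_convergence
      (K.indicator fun u => ‖f l u‖ + 1) ?_ ?_ ?_ ?_
    · exact hcont.mono fun ρ hc => hc.aestronglyMeasurable
    · filter_upwards [hbd, self_mem_nhdsWithin] with ρ hb hρ
      refine Eventually.of_forall fun u => ?_
      by_cases hu : u ∈ K
      · rw [indicator_of_mem hu]
        calc ‖F (l, pt τ ρ u)‖ = ‖f l u + (F (l, pt τ ρ u) - f l u)‖ := by congr 1; ring
          _ ≤ _ := (norm_add_le _ _).trans (by linarith [hb u hu])
      · rw [indicator_of_notMem hu, hz ρ hρ u (hout u hu), norm_zero]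
    · exact (integrable_indicator_iff hK.measurableSet).2
        ((hf.norm.add continuous_const).continuousOn.integrableOn_compact hK)
    · refine Eventually.of_forall fun u => ?_
      have h1 := ((hF u).tendsto_zero (by simp [pt])).comp (tendsto_pt_wedgeNhds l τ u)
      have h2 := h1.add_const (f l u)
      rw [zero_add] at h2
      refine h2.congr fun ρ => ?_
      simp [Function.comp, horiz_pt]

/-! ### Bounded fields -/

section bounded
variable {ξ : Pt → Pt} {x : Pt}

theorem eventually_outer {r : ℝ} (h1 : 0 < x 1) (h2 : r < |x 2| ∨ r < |x 3|) :
    ∀ᶠ x' : Pt in 𝓝 x, 0 < x' 1 ∧ (r < |x' 2| ∨ r < |x' 3|) :=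
  ((isOpen_lt continuous_const (by fun_prop : Continuous fun x : Pt => x 1)).inter
    ((isOpen_lt continuous_const (by fun_prop : Continuous fun x : Pt => |x 2|)).union
      (isOpen_lt continuous_const (by fun_prop : Continuous fun x : Pt => |x 3|)))).mem_nhds ⟨h1, h2⟩

theorem noether_eq_zero (Gn : ℝ) (g : Tensor2) (h : ξ =ᶠ[𝓝 x] 0) (μ ν : Fin 4) :
    noether Gn g ξ x μ ν = 0 := by
  have h0 : ξ x = 0 := h.self_of_nhds
  have hd : ∀ μ ν, pd μ (fun x' => ξ x' ν) x = 0 := fun μ ν => by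
    have : (fun x' => ξ x' ν) =ᶠ[𝓝 x] fun _ => 0 := h.mono fun y hy => by simp [hy]
    simp [pd, this.fderiv_eq]
  simp [noether, antisym, covVecUp, covVec, hd, h0]

theorem chargeVariation_eq_zero (Gn : ℝ) (g : ℝ → Tensor2) (l : ℝ) (h : ξ =ᶠ[𝓝 x] 0)
    (μ ν : Fin 4) : chargeVariation Gn g ξ l x μ ν = 0 := by
  simp [chargeVariation, noether_eq_zero Gn _ h, antisym, h.self_of_nhds]

theorem obstruction_eq_zero (Gn : ℝ) (g k : Tensor2) (χ : Pt → Pt) (h : ξ x = 0) (μ ν : Fin 4) :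
    obstruction Gn g k ξ χ x μ ν = 0 := by
  simp [obstruction, antisym, h]

/-- Boundedness is required only for `ρ > 0`; letting `ρ → 0` carries it to the leading data. -/
theorem InAlgebra.lead_eq_zero {W : Plane → ℝ} {R : Plane → Plane} (h : InAlgebra W R ξ) {r : ℝ}
    (hr : ∀ x : Pt, 0 < x 1 → (r < |x 2| ∨ r < |x 3|) → ξ x = 0) {u : Plane}
    (hu : r < |u 0| ∨ r < |u 1|) : W u = 0 ∧ R u = 0 := by
  have h0 : ∀ μ, leadField W R (pt 0 0 u) μ = 0 := fun μ => by
    obtain ⟨k, -, e⟩ := h.exists_rem μ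
    have e1 := e (0, pt 0 0 u)
    have ht : Tendsto (fun ρ => ξ (pt 0 ρ u) μ) (𝓝[>] 0) (𝓝 (ξ (pt 0 0 u) μ)) :=
      ((((continuous_apply μ).comp h.smooth.continuous).comp
        (continuous_pt 0 u)).tendsto' 0 _ rfl).mono_left nhdsWithin_le_nhds
    have hz : ξ (pt 0 0 u) μ = 0 := by
      refine tendsto_nhds_unique ht (tendsto_const_nhds.congr' ?_)
      filter_upwards [self_mem_nhdsWithin] with ρ hρ
      rw [hr _ (by simpa [pt] using hρ) (by simpa [pt] using hu)]; rfl
    rw [hz, zero_sub] at e1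
    simpa [pt] using e1
  refine ⟨by simpa [leadField, horiz_pt] using h0 0, ?_⟩
  ext A
  fin_cases A
  · simpa [leadField, horiz_pt] using h0 2
  · simpa [leadField, horiz_pt] using h0 3

end bounded

/-! ### The charges -/

/-- The charge of `ξ`: the integral of the Noether form over the horizon at time `0`. -/
def noetherCharge (Gn : ℝ) (ξ : Pt → Pt) (g : Tensor2) : ℝ :=
  limUnder (𝓝[>] 0) fun ρ : ℝ => ∫ u : Plane, noether Gn g ξ (pt 0 ρ u) 0 1

/-- The derivative of the density of the charge along a path. -/
def hairDeriv (κ Gn : ℝ) (W : Plane → ℝ) (R : Plane → Plane) (P : ℝ → Plane → ℝ)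
    (G : ℝ → Plane → Plane) (l : ℝ) (u : Plane) : ℝ :=
  deriv (fun l' => hair κ Gn W R (P l') (G l') u) l

namespace IsGammaPath
variable {I : Set ℝ} {P : ℝ → Plane → ℝ} {G : ℝ → Plane → Plane} {γ : ℝ → Pt → Pt}
  {κ Gn : ℝ} {W : Plane → ℝ} {R : Plane → Plane} {ξ : Pt → Pt}

theorem metricOf_eq (κ : ℝ) (γ : ℝ → Pt → Pt) (l : ℝ) :
    metricOf κ (γ l) = fun x => metricC κ (fun α q => γ q.1 q.2 α) (l, x) := rfl

variable (h : IsGammaPath I P G γ)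
include h

theorem isChart_pt {l : ℝ} (hl : l ∈ I) (τ : ℝ) (u : Plane) :
    IsChart (l, pt τ 0 u) fun α q => γ q.1 q.2 α := h.isChart hl (by simp [pt])

theorem hasHorizonIntegral_obstruction (hκ : 0 < κ) (hξ : InAlgebra W R ξ)
    (hb : HorizontallyBounded ξ) {η χ : Pt → Pt} (hη : η ∈ algebraB) (hχ : χ ∈ algebraB)
    {l : ℝ} (hl : l ∈ I) (τ : ℝ) : HasHorizonIntegral
      (obstruction Gn (metricOf κ (γ l)) (lieDeriv η (metricOf κ (γ l))) ξ χ) τ 0 := by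
  obtain ⟨r, hr⟩ := hb
  obtain ⟨_, _, hη⟩ := hη
  obtain ⟨_, _, hχ⟩ := hχ
  have := tendsto_integral_of_ord (l := l) (τ := τ) (r := r) (f := fun _ _ => 0)
    (F := fun q => surfaceDensity (obstruction Gn (metricOf κ (γ q.1))
      (lieDeriv η (metricOf κ (γ q.1))) ξ χ q.2)) continuous_const
    (fun u => ((h.isChart_pt hl τ u).ord_obstruction hκ Gn (hξ.symField _) (hη.symField _)
      (hχ.symField _)).congr (Eventually.of_forall fun q => by simp [metricOf_eq]))
    (fun x h1 h2 => by simp [surfaceDensity, obstruction_eq_zero Gn _ _ χ (hr x h1 h2)])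
  rwa [integral_zero] at this

theorem continuous_hair (hξ : InAlgebra W R ξ) {l : ℝ} (hl : l ∈ I) :
    Continuous (hair κ Gn W R (P l) (G l)) :=
  (h.contDiffOn_hair κ Gn hξ.smooth_W hξ.smooth_R).continuousOn.comp_continuous
    (continuous_const.prodMk continuous_id) fun _ => ⟨hl, trivial⟩

theorem noetherCharge_eq_integral (hκ : 0 < κ) (hξ : InAlgebra W R ξ)
    (hb : HorizontallyBounded ξ) {l : ℝ} (hl : l ∈ I) :
    noetherCharge Gn ξ (metricOf κ (γ l)) = ∫ u, hair κ Gn W R (P l) (G l) u := by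
  obtain ⟨r, hr⟩ := hb
  refine (tendsto_integral_of_ord (l := l) (τ := 0) (r := r)
    (f := fun l => hair κ Gn W R (P l) (G l))
    (F := fun q => noether Gn (metricOf κ (γ q.1)) ξ q.2 0 1)
    (h.continuous_hair hξ hl) (fun u => ?_) (fun x h1 h2 => ?_)).2.limUnder_eq
  · refine (((h.isChart_pt hl 0 u).ord_noether hκ Gn (hξ.symField _)).add
      (h.ord_hair (p := (l, pt 0 0 u)) hl (by simp [pt]) κ Gn hξ)).congr
      (Eventually.of_forall fun q => ?_)
    simp only [metricOf_eq]; ring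
  · exact noether_eq_zero Gn _ ((eventually_outer h1 h2).mono fun y hy => hr y hy.1 hy.2) 0 1

theorem contDiffOn_hairDeriv (hξ : InAlgebra W R ξ) : ContDiffOn ℝ ∞
    (fun v : ℝ × Plane => hairDeriv κ Gn W R P G v.1 v.2) (I ×ˢ univ) := by
  have hh := h.contDiffOn_hair κ Gn hξ.smooth_W hξ.smooth_R
  refine ((hh.fderiv_of_isOpen h.isOpen_prod (m := ∞) (by simp)).clm_apply
    (contDiffOn_const (c := ((1 : ℝ), (0 : Plane))))).congr fun v hv => ?_
  have hd : DifferentiableAt ℝ (fun v : ℝ × Plane => hair κ Gn W R (P v.1) (G v.1) v.2) v :=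
    (hh.differentiableOn (by simp)).differentiableAt (h.isOpen_prod.mem_nhds hv)
  exact (HasFDerivAt.comp_hasDerivAt (f := fun l => (l, v.2)) v.1 hd.hasFDerivAt
    ((hasDerivAt_id v.1).prodMk (hasDerivAt_const v.1 v.2))).deriv

theorem hasDerivAt_hair (hξ : InAlgebra W R ξ) {l : ℝ} (hl : l ∈ I) (u : Plane) :
    HasDerivAt (fun l => hair κ Gn W R (P l) (G l) u) (hairDeriv κ Gn W R P G l u) l := by
  refine DifferentiableAt.hasDerivAt ?_
  exact DifferentiableAt.comp (g := fun v : ℝ × Plane => hair κ Gn W R (P v.1) (G v.1) v.2) l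
    (((h.contDiffOn_hair κ Gn hξ.smooth_W hξ.smooth_R).differentiableOn (by simp)).differentiableAt
      (h.isOpen_prod.mem_nhds (x := (l, u)) ⟨hl, trivial⟩))
    (by fun_prop : DifferentiableAt ℝ (fun l : ℝ => (l, u)) l)

theorem hasHorizonIntegral_chargeVariation (hκ : 0 < κ) (hξ : InAlgebra W R ξ)
    (hb : HorizontallyBounded ξ) {l : ℝ} (hl : l ∈ I) (τ : ℝ) : HasHorizonIntegral
      (chargeVariation Gn (fun l' => metricOf κ (γ l')) ξ l) τ
      (∫ u, hairDeriv κ Gn W R P G l u) := by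
  obtain ⟨r, hr⟩ := hb
  refine tendsto_integral_of_ord (l := l) (τ := τ) (r := r)
    (f := hairDeriv κ Gn W R P G)
    (F := fun q => surfaceDensity (chargeVariation Gn (fun l' => metricOf κ (γ l')) ξ q.1 q.2))
    ?_ (fun u => ?_) (fun x h1 h2 => ?_)
  · exact (h.contDiffOn_hairDeriv hξ).continuousOn.comp_continuous
      (continuous_const.prodMk continuous_id) fun _ => ⟨hl, trivial⟩
  · exact (h.isChart_pt hl τ u).ord_chargeVariation hκ Gn (hξ.symField _)
      (StatSq.of_horiz (φ := fun v => hair κ Gn W R (P v.1) (G v.1) v.2)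
        ((h.contDiffOn_hair κ Gn hξ.smooth_W hξ.smooth_R).contDiffAt
          (h.isOpen_prod.mem_nhds ⟨hl, trivial⟩))).ord
      (h.ord_hair (p := (l, pt τ 0 u)) hl (by simp [pt]) κ Gn hξ)
  · have := chargeVariation_eq_zero Gn (fun l' => metricOf κ (γ l')) l
      ((eventually_outer h1 h2).mono fun y hy => hr y hy.1 hy.2)
    simp [surfaceDensity, this]

end IsGammaPath

/-! ### The charge along a path -/

theorem InAlgebra.hair_eq_zero {W : Plane → ℝ} {R : Plane → Plane} {ξ : Pt → Pt}
    (h : InAlgebra W R ξ) {r : ℝ} (hr : ∀ x : Pt, 0 < x 1 → (r < |x 2| ∨ r < |x 3|) → ξ x = 0)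
    (κ Gn : ℝ) (P : Plane → ℝ) (G : Plane → Plane) {u : Plane}
    (hu : u ∉ Metric.closedBall (0 : Plane) |r|) : hair κ Gn W R P G u = 0 := by
  have := h.lead_eq_zero hr (outer_of_notMem_closedBall hu)
  simp [hair, along, this.1, this.2]

theorem continuous_pdPlane (A : Fin 2) {f : Plane → ℝ} (hf : ContDiff ℝ ∞ f) :
    Continuous (pdPlane A f) :=
  (hf.continuous_fderiv (by simp)).clm_apply continuous_const

theorem integrable_hair (κ Gn : ℝ) {W P : Plane → ℝ} {R G : Plane → Plane} (hW : ContDiff ℝ ∞ W)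
    (hR : ContDiff ℝ ∞ R) (hP : ContDiff ℝ ∞ P) (hG : ContDiff ℝ ∞ G) {r : ℝ}
    (hz : ∀ u ∉ Metric.closedBall (0 : Plane) r, W u = 0 ∧ R u = 0) :
    Integrable (hair κ Gn W R P G) := by
  have hG' := contDiff_pi.1 hG
  have hJ : Continuous (planeDet G) :=
    ((continuous_pdPlane 0 (hG' 0)).mul (continuous_pdPlane 1 (hG' 1))).sub
      ((continuous_pdPlane 1 (hG' 0)).mul (continuous_pdPlane 0 (hG' 1)))
  have hA : Continuous (along R P) := continuous_finsetSum _ fun A _ =>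
    ((contDiff_pi.1 hR A).continuous).mul (continuous_pdPlane A hP)
  have hc : Continuous (hair κ Gn W R P G) :=
    continuous_const.mul (hJ.abs.mul (hW.continuous.add hA))
  refine hc.integrable_of_hasCompactSupport
    (HasCompactSupport.intro (isCompact_closedBall 0 r) fun u hu => ?_)
  simp [hair, along, hz u hu]

theorem integral_hair_zero_right (κ Gn : ℝ) (W P : Plane → ℝ) (G : Plane → Plane) :
    ∫ u, hair κ Gn W 0 P G u = chargeST κ Gn G W := by
  simp [hair, chargeST, sqrt_Ldet, along, integral_const_mul]

theorem integral_hair_zero_left {κ : ℝ} (hκ : 0 < κ) (Gn : ℝ) (P : Plane → ℝ)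
    (R G : Plane → Plane) : ∫ u, hair κ Gn 0 R P G u = chargeSR κ Gn P G R := by
  have e : ∀ u, |planeDet G u| * ∑ A, R u A * L1 κ P A u
      = -κ ^ 2 * (|planeDet G u| * along R P u) := fun u => by
    simp only [along, L1, Fin.sum_univ_two]; ring
  simp only [hair, chargeSR, sqrt_Ldet, e, integral_const_mul, Pi.zero_apply, zero_add]
  field_simp

theorem pdPlane_const_mul (A : Fin 2) (l : ℝ) {f : Plane → ℝ} (hf : ContDiff ℝ ∞ f) (u : Plane) :
    pdPlane A (fun u => l * f u) u = l * pdPlane A f u := by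
  have := fderiv_const_mul (hf.differentiable (by simp) u) l
  simp only [pdPlane]
  rw [this]; simp

/-- The planar Jacobian is quadratic in `G`, and the superrotation part has one more factor, linear
in `P`: this is where the degrees `2` and `3` come from. -/
theorem hair_smul (κ Gn : ℝ) (W : Plane → ℝ) (R : Plane → Plane) {P : Plane → ℝ}
    {G : Plane → Plane} (hP : ContDiff ℝ ∞ P) (hG : ContDiff ℝ ∞ G) (l : ℝ) (u : Plane) :
    hair κ Gn W R (l • P) (l • G) u
      = l ^ 2 * hair κ Gn W 0 P G u + l ^ 3 * hair κ Gn 0 R P G u := by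
  have hG' := contDiff_pi.1 hG
  have e1 : planeDet (l • G) u = l ^ 2 * planeDet G u := by
    simp only [planeDet, Pi.smul_apply, smul_eq_mul, pdPlane_const_mul _ _ (hG' _)]; ring
  have e2 : along R (l • P) u = l * along R P u := by
    have : l • P = fun u => l * P u := rfl
    simp only [along, this, pdPlane_const_mul _ _ hP, Fin.sum_univ_two]; ring
  have e3 : along 0 P u = 0 := by simp [along]
  simp only [hair, e1, e2, e3, abs_mul, abs_pow, sq_abs, Pi.zero_apply]
  ring

/-- The integral of the charge density of a scaled map. -/
theorem InAlgebra.integral_hair_smul {κ : ℝ} (hκ : 0 < κ) (Gn : ℝ) {W : Plane → ℝ}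
    {R : Plane → Plane} {ξ : Pt → Pt} (hξ : InAlgebra W R ξ) (hb : HorizontallyBounded ξ)
    {P : Plane → ℝ} {G : Plane → Plane} (hP : ContDiff ℝ ∞ P) (hG : ContDiff ℝ ∞ G) (l : ℝ) :
    ∫ u, hair κ Gn W R (l • P) (l • G) u
      = l ^ 2 * chargeST κ Gn G W + l ^ 3 * chargeSR κ Gn P G R := by
  obtain ⟨r, hr⟩ := hb
  have hz := fun u (hu : u ∉ Metric.closedBall (0 : Plane) |r|) =>
    hξ.lead_eq_zero hr (outer_of_notMem_closedBall hu)
  have i1 : Integrable (hair κ Gn W 0 P G) := integrable_hair κ Gn hξ.smooth_W contDiff_const hP hG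
    fun u hu => ⟨(hz u hu).1, rfl⟩
  have i2 : Integrable (hair κ Gn 0 R P G) := integrable_hair κ Gn contDiff_const hξ.smooth_R hP hG
    fun u hu => ⟨rfl, (hz u hu).2⟩
  simp only [hair_smul κ Gn W R hP hG l]
  rw [integral_add (i1.const_mul _) (i2.const_mul _), integral_const_mul, integral_const_mul,
    integral_hair_zero_right, integral_hair_zero_left hκ]

/-- The integral of the charge density is the sum of the two charges. -/
theorem InAlgebra.integral_hair {κ : ℝ} (hκ : 0 < κ) (Gn : ℝ) {W : Plane → ℝ} {R : Plane → Plane}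
    {ξ : Pt → Pt} (hξ : InAlgebra W R ξ) (hb : HorizontallyBounded ξ) {P : Plane → ℝ}
    {G : Plane → Plane} (hP : ContDiff ℝ ∞ P) (hG : ContDiff ℝ ∞ G) :
    ∫ u, hair κ Gn W R P G u = chargeST κ Gn G W + chargeSR κ Gn P G R := by
  simpa using hξ.integral_hair_smul hκ Gn hb hP hG 1

theorem InAlgebra.hairDeriv_eq_zero {W : Plane → ℝ} {R : Plane → Plane} {ξ : Pt → Pt}
    (hξ : InAlgebra W R ξ) {r : ℝ} (hr : ∀ x : Pt, 0 < x 1 → (r < |x 2| ∨ r < |x 3|) → ξ x = 0)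
    (κ Gn : ℝ) (P : ℝ → Plane → ℝ) (G : ℝ → Plane → Plane) (l : ℝ) {u : Plane}
    (hu : u ∉ Metric.closedBall (0 : Plane) |r|) : hairDeriv κ Gn W R P G l u = 0 := by
  simp [hairDeriv, hξ.hair_eq_zero hr κ Gn _ _ hu]

namespace IsGammaPath
variable {I : Set ℝ} {P : ℝ → Plane → ℝ} {G : ℝ → Plane → Plane} {γ : ℝ → Pt → Pt}
  {κ Gn : ℝ} {W : Plane → ℝ} {R : Plane → Plane} {ξ : Pt → Pt} (h : IsGammaPath I P G γ)
include h

/-- Differentiation under the integral; the derivative of the density is bounded on the product of a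
compact neighbourhood of `l` and the ball outside which `W` and `R` vanish. -/
theorem hasDerivAt_integral_hair (hξ : InAlgebra W R ξ) (hb : HorizontallyBounded ξ) {l : ℝ}
    (hl : l ∈ I) : HasDerivAt (fun l => ∫ u, hair κ Gn W R (P l) (G l) u)
      (∫ u, hairDeriv κ Gn W R P G l u) l := by
  obtain ⟨r, hr⟩ := hb
  set K : Set Plane := Metric.closedBall 0 |r|
  have hK : IsCompact K := isCompact_closedBall _ _
  obtain ⟨J, hJ, hJI, hJc⟩ := local_compact_nhds (h.isOpen.mem_nhds hl)
  have hc := (h.contDiffOn_hairDeriv (κ := κ) (Gn := Gn) hξ).continuousOn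
  obtain ⟨C, hC⟩ := (hJc.prod hK).exists_bound_of_continuousOn
    (hc.mono (prod_mono hJI (subset_univ _)))
  have hd : Continuous (hairDeriv κ Gn W R P G l) := hc.comp_continuous
    (continuous_const.prodMk continuous_id) fun _ => ⟨hl, trivial⟩
  refine (hasDerivAt_integral_of_dominated_loc_of_deriv_le (bound := K.indicator fun _ => C)
    hJ ?_ ?_ hd.aestronglyMeasurable ?_ ?_ ?_).2
  · filter_upwards [h.isOpen.mem_nhds hl] with l' hl'
    exact (h.continuous_hair hξ hl').aestronglyMeasurable
  · exact (h.continuous_hair hξ hl).integrable_of_hasCompactSupport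
      (HasCompactSupport.intro hK fun u hu => hξ.hair_eq_zero hr κ Gn _ _ hu)
  · refine Eventually.of_forall fun u l' hl' => ?_
    by_cases hu : u ∈ K
    · rw [indicator_of_mem hu]; exact hC (l', u) ⟨hl', hu⟩
    · rw [indicator_of_notMem hu, hξ.hairDeriv_eq_zero hr κ Gn P G l' hu, norm_zero]
  · exact (integrable_indicator_iff hK.measurableSet).2
      (continuousOn_const.integrableOn_compact hK)
  · exact Eventually.of_forall fun u l' hl' => h.hasDerivAt_hair hξ (hJI hl') u

theorem continuousOn_integral_hairDeriv (hξ : InAlgebra W R ξ) (hb : HorizontallyBounded ξ) :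
    ContinuousOn (fun l => ∫ u, hairDeriv κ Gn W R P G l u) I := by
  obtain ⟨r, hr⟩ := hb
  exact continuousOn_integral_of_compact_support (isCompact_closedBall (0 : Plane) |r|)
    (h.contDiffOn_hairDeriv hξ).continuousOn fun l u _ hu => hξ.hairDeriv_eq_zero hr κ Gn P G l hu

theorem hasDerivAt_noetherCharge (hκ : 0 < κ) (hξ : InAlgebra W R ξ) (hb : HorizontallyBounded ξ)
    {l : ℝ} (hl : l ∈ I) : HasDerivAt (fun l => noetherCharge Gn ξ (metricOf κ (γ l)))
      (∫ u, hairDeriv κ Gn W R P G l u) l := by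
  refine (h.hasDerivAt_integral_hair hξ hb hl).congr_of_eventuallyEq ?_
  filter_upwards [h.isOpen.mem_nhds hl] with l' hl' using h.noetherCharge_eq_integral hκ hξ hb hl'

theorem integral_hairDeriv (hκ : 0 < κ) (hξ : InAlgebra W R ξ) (hb : HorizontallyBounded ξ)
    {a b : ℝ} (hab : uIcc a b ⊆ I) :
    IntervalIntegrable (fun l => ∫ u, hairDeriv κ Gn W R P G l u) volume a b ∧
    ∫ l in a..b, (∫ u, hairDeriv κ Gn W R P G l u)
      = noetherCharge Gn ξ (metricOf κ (γ b)) - noetherCharge Gn ξ (metricOf κ (γ a)) := by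
  have hi : IntervalIntegrable (fun l => ∫ u, hairDeriv κ Gn W R P G l u) volume a b :=
    ((h.continuousOn_integral_hairDeriv hξ hb).mono hab).intervalIntegrable
  exact ⟨hi, intervalIntegral.integral_eq_sub_of_hasDerivAt
    (fun l hl => h.hasDerivAt_noetherCharge hκ hξ hb (hab hl)) hi⟩

theorem noetherCharge_eq (hκ : 0 < κ) (hξ : InAlgebra W R ξ) (hb : HorizontallyBounded ξ) {l : ℝ}
    (hl : l ∈ I) : noetherCharge Gn ξ (metricOf κ (γ l))
      = chargeST κ Gn (G l) W + chargeSR κ Gn (P l) (G l) R := by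
  rw [h.noetherCharge_eq_integral hκ hξ hb hl,
    hξ.integral_hair hκ Gn hb (h.mem l hl).smooth_P (h.mem l hl).smooth_G]

end IsGammaPath

/-- Along a path that scales `P` and `G`, the charge is the integral of its variation. -/
theorem IsGammaPath.integral_scaling {I : Set ℝ} {P : Plane → ℝ} {G : Plane → Plane}
    {γ : ℝ → Pt → Pt} {κ Gn : ℝ} {W : Plane → ℝ} {R : Plane → Plane} {ξ : Pt → Pt}
    (hI : Ioc 0 1 ⊆ I) (h : IsGammaPath I (fun l => l • P) (fun l => l • G) γ)
    (hκ : 0 < κ) (hξ : InAlgebra W R ξ) (hb : HorizontallyBounded ξ) : ∃ F : ℝ → ℝ,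
      (∀ l ∈ Ioc (0 : ℝ) 1, ∀ τ : ℝ, HasHorizonIntegral
        (chargeVariation Gn (fun l' => metricOf κ (γ l')) ξ l) τ (F l)) ∧
      IntervalIntegrable F volume 0 1 ∧
      ∫ l in (0 : ℝ)..1, F l = noetherCharge Gn ξ (metricOf κ (γ 1)) := by
  have h1 : (1 : ℝ) ∈ I := hI ⟨one_pos, le_rfl⟩
  have hP : ContDiff ℝ ∞ P := by simpa using (h.mem 1 h1).smooth_P
  have hG : ContDiff ℝ ∞ G := by simpa using (h.mem 1 h1).smooth_G
  have hpoly := hξ.integral_hair_smul hκ Gn hb hP hG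
  set A := chargeST κ Gn G W
  set B := chargeSR κ Gn P G R
  -- At `λ = 0` the planar map is constant and there is no metric to evaluate on. The charge for `λ
  -- > 0` is a polynomial in `λ` without constant term, so its derivative extends to `[0, 1]` and
  -- integrates to the value at `1`.
  have hderiv : ∀ l : ℝ, HasDerivAt (fun l : ℝ => l ^ 2 * A + l ^ 3 * B)
      (2 * l * A + 3 * l ^ 2 * B) l := fun l => by
    simpa using ((hasDerivAt_pow 2 l).mul_const A).fun_add ((hasDerivAt_pow 3 l).mul_const B)
  have hi : IntervalIntegrable (fun l : ℝ => 2 * l * A + 3 * l ^ 2 * B) volume 0 1 :=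
    Continuous.intervalIntegrable (by fun_prop) _ _
  refine ⟨fun l => 2 * l * A + 3 * l ^ 2 * B, fun l hl τ => ?_, hi, ?_⟩
  · have e : 2 * l * A + 3 * l ^ 2 * B = ∫ u, hairDeriv κ Gn W R (fun l => l • P)
        (fun l => l • G) l u := by
      have h2 := h.hasDerivAt_integral_hair (κ := κ) (Gn := Gn) hξ hb (hI hl)
      simp only [hpoly] at h2
      exact (hderiv l).unique h2
    dsimp only
    rw [e]
    exact h.hasHorizonIntegral_chargeVariation hκ hξ hb (hI hl) τ
  · rw [intervalIntegral.integral_eq_sub_of_hasDerivAt (fun l _ => hderiv l) hi,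
      h.noetherCharge_eq_integral hκ hξ hb h1, hpoly]
    simp

/-! ### The bracket -/

section bracket
variable {W W' : Plane → ℝ} {R R' : Plane → Plane} {U U' : Pt → Pt}

theorem IsBigORhoSq.of_ord {f : Pt → ℝ} (h : ∀ τ u, Ord (0, pt τ 0 u) 2 fun q => f q.2) :
    IsBigORhoSq f := by
  intro τ u
  obtain ⟨g, hg, e⟩ := h τ u
  have ht := tendsto_pt_wedgeNhds 0 τ u
  have hb : (fun ρ : ℝ => g (0, pt τ ρ u)) =O[𝓝[>] 0] fun _ => (1 : ℝ) :=
    (hg.continuousAt.tendsto.comp (ht.mono_right nhdsWithin_le_nhds)).isBigO_one ℝ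
  have h2 := (isBigO_refl (fun ρ : ℝ => ρ ^ 2) (𝓝[>] 0)).mul hb
  refine (h2.congr' ?_ (Eventually.of_forall fun ρ => mul_one _))
  filter_upwards [ht.eventually e] with ρ hρ
  rw [hρ]
  simp only [pt, Matrix.cons_val]
  norm_cast

theorem IsBigORhoSq.add {f g : Pt → ℝ} (hf : IsBigORhoSq f) (hg : IsBigORhoSq g) :
    IsBigORhoSq fun x => f x + g x := fun τ u => (hf τ u).add (hg τ u)

theorem IsBigORhoSq.const_mul {f : Pt → ℝ} (c : ℝ) (hf : IsBigORhoSq f) :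
    IsBigORhoSq fun x => c * f x := fun τ u => (hf τ u).const_mul_left c

theorem InAlgebra.linear_combination (h : InAlgebra W R U) (h' : InAlgebra W' R' U') (a b : ℝ) :
    InAlgebra (a • W + b • W') (a • R + b • R') (a • U + b • U') where
  smooth_W := (h.smooth_W.const_smul a).add (h'.smooth_W.const_smul b)
  smooth_R := (h.smooth_R.const_smul a).add (h'.smooth_R.const_smul b)
  smooth := (h.smooth.const_smul a).add (h'.smooth.const_smul b)
  asymp μ := by
    convert ((h.asymp μ).const_mul a).add ((h'.asymp μ).const_mul b) using 2 with x
    fin_cases μ <;> simp [leadField] <;> ring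

theorem contDiff_pdPlane {f : Plane → ℝ} (hf : ContDiff ℝ ∞ f) (A : Fin 2) :
    ContDiff ℝ ∞ (pdPlane A f) :=
  (hf.fderiv_right (m := ∞) (by simp)).clm_apply contDiff_const

theorem contDiff_along (hR : ContDiff ℝ ∞ R) {f : Plane → ℝ} (hf : ContDiff ℝ ∞ f) :
    ContDiff ℝ ∞ (along R f) :=
  ContDiff.sum fun A _ => (contDiff_pi.1 hR A).mul (contDiff_pdPlane hf A)

/-- The derivative `U^ν ∂_ν f` of a function on spacetime. -/
def dirDeriv (U : Pt → Pt) (f : Pt → ℝ) (x : Pt) : ℝ := ∑ ν, U x ν * pd ν f x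

theorem lieBracket_apply (hU : Differentiable ℝ U) (hU' : Differentiable ℝ U') (x : Pt)
    (μ : Fin 4) : VectorField.lieBracket ℝ U U' x μ
      = dirDeriv U (fun x => U' x μ) x - dirDeriv U' (fun x => U x μ) x := by
  have key : ∀ {V V' : Pt → Pt}, Differentiable ℝ V' →
      fderiv ℝ V' x (V x) μ = dirDeriv V (fun x => V' x μ) x := fun {V V'} hV' => by
    have h1 := (hasFDerivAt_pi'.1 (hV' x).hasFDerivAt μ).fderiv
    have h2 : V x = ∑ ν, V x ν • (Pi.single ν 1 : Pt) := (pi_eq_sum_univ' (V x))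
    simp only [dirDeriv, pd, h1]
    conv_lhs => rw [h2]
    simp [map_sum]
  rw [VectorField.lieBracket, Pi.sub_apply, key hU', key hU]

theorem dirDeriv_leadField {φ : Plane → ℝ} (hφ : ContDiff ℝ ∞ φ) (x : Pt) :
    dirDeriv (leadField W R) (fun x => φ (horiz x)) x = along R φ (horiz x) := by
  obtain ⟨⟨h0, h1⟩, h2, h3⟩ := pd_comp_horiz (x := x) (hφ.differentiable (by simp) _)
  simp [dirDeriv, Fin.sum_univ_four, Fin.sum_univ_two, h0, h1, h2, h3, leadField, along]

theorem dirDeriv_leadField_leadField (hW' : ContDiff ℝ ∞ W') (hR' : ContDiff ℝ ∞ R') (x : Pt)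
    (μ : Fin 4) : dirDeriv (leadField W R) (fun x => leadField W' R' x μ) x
      = leadField (along R W') (fun u A => along R (fun v => R' v A) u) x μ := by
  have hR := contDiff_pi.1 hR'
  fin_cases μ
  · exact dirDeriv_leadField hW' x
  · simp [leadField, dirDeriv, pd]
  · exact dirDeriv_leadField (hR 0) x
  · exact dirDeriv_leadField (hR 1) x

/-- Derivatives in `τ, y, z` respect errors `O(ρ²)`. The derivative `∂_ρ`, which does not, is
multiplied by `U^ρ = O(ρ²)`, and the leading field has no `ρ` component. -/
theorem InAlgebra.ord_dirDeriv (h : InAlgebra W R U) (h' : InAlgebra W' R' U') (p : ℝ × Pt)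
    (μ : Fin 4) : Ord p 2 fun q => dirDeriv U (fun x => U' x μ) q.2
      - leadField (along R W') (fun u A => along R (fun v => R' v A) u) q.2 μ := by
  have hs : ∀ ν, Ord p 2 fun q => U q.2 ν * xd ν (fun q => U' q.2 μ) q
      - leadField W R q.2 ν * xd ν (fun q => leadField W' R' q.2 μ) q := by
    intro ν
    by_cases hν : ν = 1
    · subst hν
      refine ((h.ord_sub p 1).mul' (Ord.of_contDiffAt (contDiffAt_xd
        ((contDiff_pi.1 h'.smooth μ).comp contDiff_snd).contDiffAt 1)) (n := 2)).congr ?_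
      refine Eventually.of_forall fun q => ?_
      simp only [leadField, Matrix.cons_val, zero_mul, sub_zero]
      rfl
    · refine Ord.mul_sub_mul (h.ord_sub p ν) ?_ (statSq_leadField h.smooth_W h.smooth_R p ν).ord
        ((h'.statSq p μ).ord.xd_of_ne hν)
      refine ((h'.ord_sub p μ).xd_of_ne hν).congr (Eventually.of_forall fun q => ?_)
      rw [xd_sub]
      · exact ((contDiff_pi.1 h'.smooth μ).comp contDiff_snd).differentiable (by simp) q
      · exact ((contDiff_leadField h'.smooth_W h'.smooth_R μ).comp contDiff_snd).differentiable
          (by simp) q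
  refine (Ord.sum (s := Finset.univ) fun ν _ => hs ν).congr (Eventually.of_forall fun q => ?_)
  dsimp only
  rw [Finset.sum_sub_distrib, ← dirDeriv_leadField_leadField h'.smooth_W h'.smooth_R]
  rfl

theorem InAlgebra.lieBracket (h : InAlgebra W R U) (h' : InAlgebra W' R' U') :
    InAlgebra (fun u => along R W' u - along R' W u)
      (fun u A => along R (fun v => R' v A) u - along R' (fun v => R v A) u)
      (VectorField.lieBracket ℝ U U') where
  smooth_W := (contDiff_along h.smooth_R h'.smooth_W).sub (contDiff_along h'.smooth_R h.smooth_W)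
  smooth_R := contDiff_pi.2 fun A =>
    (contDiff_along h.smooth_R (contDiff_pi.1 h'.smooth_R A)).sub
      (contDiff_along h'.smooth_R (contDiff_pi.1 h.smooth_R A))
  smooth := ((h'.smooth.fderiv_right (m := ∞) (by simp)).clm_apply h.smooth).sub
    ((h.smooth.fderiv_right (m := ∞) (by simp)).clm_apply h'.smooth)
  asymp μ := by
    refine IsBigORhoSq.of_ord fun τ u => ?_
    refine ((h.ord_dirDeriv h' _ μ).sub (h'.ord_dirDeriv h _ μ)).congr
      (Eventually.of_forall fun q => ?_)
    dsimp only
    rw [lieBracket_apply (h.smooth.differentiable (by simp)) (h'.smooth.differentiable (by simp))]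
    fin_cases μ <;> simp [leadField] <;> ring

theorem HorizontallyBounded.lieBracket (h : HorizontallyBounded U) (h' : HorizontallyBounded U') :
    HorizontallyBounded (VectorField.lieBracket ℝ U U') := by
  obtain ⟨r, hr⟩ := h
  obtain ⟨r', hr'⟩ := h'
  refine ⟨max r r', fun x h1 h2 => ?_⟩
  have e : U =ᶠ[𝓝 x] 0 := (eventually_outer h1 (h2.imp (le_max_left r r').trans_lt
    (le_max_left r r').trans_lt)).mono fun y hy => hr y hy.1 hy.2
  have e' : U' =ᶠ[𝓝 x] 0 := (eventually_outer h1 (h2.imp (le_max_right r r').trans_lt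
    (le_max_right r r').trans_lt)).mono fun y hy => hr' y hy.1 hy.2
  simp [VectorField.lieBracket, e.self_of_nhds, e'.self_of_nhds]

theorem InAlgebra.lieBracket_supertranslation_superrotation {U₁ U₂ : Pt → Pt}
    (h₁ : InAlgebra W 0 U₁) (h₂ : InAlgebra 0 R U₂) :
    InAlgebra (fun u => -along R W u) 0 (VectorField.lieBracket ℝ U₁ U₂) := by
  have h := h₁.lieBracket h₂
  have e1 : ∀ (f : Plane → ℝ) u, along 0 f u = 0 := fun f u => by simp [along]
  have e2 : ∀ (A : Fin 2) u, along R (fun v => (0 : Plane → Plane) v A) u = 0 := fun A u => by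
    simp [along, pdPlane]
  simp only [e1, e2, zero_sub, sub_zero] at h
  exact h

end bracket

/-! ### Flows -/

/-! ### Gronwall estimates and uniqueness for autonomous equations. -/

section gronwall
variable {E F : Type*} [NormedAddCommGroup E] [NormedSpace ℝ E] [NormedAddCommGroup F]
  [NormedSpace ℝ F]

/-- Gronwall's inequality with zero initial value. The bound is linear in `ε`, so an error of size
`ρ²` in the equation yields an error of size `ρ²` in the solution; `ε = 0` gives uniqueness. -/
theorem norm_le_of_norm_deriv_le {f f' : ℝ → E} {C ε : ℝ} (hC : 0 < C) (hε : 0 ≤ ε)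
    (hf : ∀ l ∈ Icc (0 : ℝ) 1, HasDerivAt f (f' l) l) (h0 : f 0 = 0)
    (hb : ∀ l ∈ Icc (0 : ℝ) 1, ‖f' l‖ ≤ C * ‖f l‖ + ε) {l : ℝ} (hl : l ∈ Icc (0 : ℝ) 1) :
    ‖f l‖ ≤ Real.exp C / C * ε := by
  have h := norm_le_gronwallBound_of_norm_deriv_right_le (δ := 0)
    (fun l hl => (hf l hl).continuousAt.continuousWithinAt)
    (fun l hl => (hf l ⟨hl.1, hl.2.le⟩).hasDerivWithinAt) (by simp [h0])
    (fun l hl => hb l ⟨hl.1, hl.2.le⟩) l hl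
  refine h.trans ?_
  rw [gronwallBound_of_K_ne_0 hC.ne']
  simp only [zero_mul, zero_add, sub_zero]
  rw [div_mul_eq_mul_div,
    div_mul_eq_mul_div, mul_comm (Real.exp C)]
  have : Real.exp (C * l) ≤ Real.exp C := Real.exp_le_exp.2 (by nlinarith [hl.1, hl.2])
  gcongr
  linarith

theorem exists_lipschitz_closedBall [ProperSpace E] {f : E → F} (hf : ContDiff ℝ 1 f) (r : ℝ) :
    ∃ C, 0 < C ∧ ∀ x ∈ Metric.closedBall (0 : E) r, ∀ y ∈ Metric.closedBall (0 : E) r,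
      ‖f x - f y‖ ≤ C * ‖x - y‖ := by
  obtain ⟨C, hC⟩ := (isCompact_closedBall (0 : E) r).exists_bound_of_continuousOn
    (hf.continuous_fderiv (by simp)).continuousOn
  -- The constant is kept positive because `norm_le_of_norm_deriv_le` divides by it.
  refine ⟨max C 1, by positivity, fun x hx y hy => ?_⟩
  exact (convex_closedBall (0 : E) r).norm_image_sub_le_of_norm_fderiv_le
    (fun z _ => hf.differentiable (by simp) z) (fun z hz => (hC z hz).trans (le_max_left _ _)) hy hx

/-- Uniqueness of the solution of an autonomous equation on `[0, 1]`. -/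
theorem eq_of_hasDerivAt [ProperSpace E] {η : E → E} (hη : ContDiff ℝ 1 η) {f g : ℝ → E}
    (hf : ∀ l ∈ Icc (0 : ℝ) 1, HasDerivAt f (η (f l)) l)
    (hg : ∀ l ∈ Icc (0 : ℝ) 1, HasDerivAt g (η (g l)) l) (h0 : f 0 = g 0) {l : ℝ}
    (hl : l ∈ Icc (0 : ℝ) 1) : f l = g l := by
  obtain ⟨r, hr⟩ := isCompact_Icc.exists_bound_of_continuousOn
    (fun l hl => (hf l hl).continuousAt.continuousWithinAt)
  obtain ⟨s, hs⟩ := isCompact_Icc.exists_bound_of_continuousOn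
    (fun l hl => (hg l hl).continuousAt.continuousWithinAt)
  obtain ⟨C, hC, hL⟩ := exists_lipschitz_closedBall hη (max r s)
  have h := norm_le_of_norm_deriv_le hC le_rfl (fun l hl => (hf l hl).fun_sub (hg l hl))
    (sub_eq_zero.2 h0) (fun l hl => by
      rw [add_zero]
      exact hL _ (mem_closedBall_zero_iff.2 ((hr l hl).trans (le_max_left _ _))) _
        (mem_closedBall_zero_iff.2 ((hs l hl).trans (le_max_right _ _)))) hl
  rw [mul_zero] at h
  exact sub_eq_zero.1 (norm_le_zero_iff.1 h)

end gronwall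

namespace IsFlow
variable {η : Pt → Pt} {φ : ℝ → Pt → Pt}

theorem neg (h : IsFlow η φ) : IsFlow (-η) fun l => φ (-l) where
  smooth := h.smooth.comp ((contDiff_fst.neg).prodMk contDiff_snd)
  mapsTo l := h.mapsTo (-l)
  init x hx := by simpa using h.init x hx
  ode x hx l := by
    have := (h.ode x hx (-l)).scomp l (hasDerivAt_neg l)
    simpa using! this

/-- The group law is not part of `IsFlow`. It follows from uniqueness: `l ↦ φ (l - 1) x` is a
solution which starts at `φ (-1) x` and reaches `x` at `l = 1`. -/
theorem apply_one_apply_neg_one (h : IsFlow η φ) (hη : ContDiff ℝ ∞ η) {x : Pt}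
    (hx : x ∈ closedWedge) : φ 1 (φ (-1) x) = x := by
  have := eq_of_hasDerivAt (hη.of_le (by simp)) (f := fun l => φ l (φ (-1) x))
    (g := fun l => φ (l - 1) x) (fun l _ => h.ode _ (h.mapsTo (-1) hx) l)
    (fun l _ => (h.ode x hx (l - 1)).comp_sub_const l 1)
    (by simpa using h.init _ (h.mapsTo (-1) hx)) (l := 1) (by simp)
  simpa [h.init x hx] using this

theorem apply_neg_one_apply_one (h : IsFlow η φ) (hη : ContDiff ℝ ∞ η) {x : Pt}
    (hx : x ∈ closedWedge) : φ (-1) (φ 1 x) = x := by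
  simpa using h.neg.apply_one_apply_neg_one hη.neg hx

theorem bijOn (h : IsFlow η φ) (hη : ContDiff ℝ ∞ η) : BijOn (φ 1) closedWedge closedWedge :=
  InvOn.bijOn (f' := φ (-1)) ⟨fun _ hx => h.apply_neg_one_apply_one hη hx,
    fun _ hx => h.apply_one_apply_neg_one hη hx⟩ (h.mapsTo 1) (h.mapsTo (-1))

theorem contDiff (h : IsFlow η φ) (l : ℝ) : ContDiff ℝ ∞ (φ l) :=
  h.smooth.comp (contDiff_const.prodMk contDiff_id)

end IsFlow

/-- The Jacobian matrix of a map of spacetime. -/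
def jacobian (γ : Pt → Pt) (x : Pt) : Matrix (Fin 4) (Fin 4) ℝ :=
  Matrix.of fun α μ => pd μ (fun x' => γ x' α) x

theorem jacobian_apply {γ : Pt → Pt} {x : Pt} (h : DifferentiableAt ℝ γ x) (α μ : Fin 4) :
    jacobian γ x α μ = fderiv ℝ γ x (Pi.single μ 1) α := by
  have h1 := (hasFDerivAt_pi'.1 h.hasFDerivAt α).fderiv
  simp only [jacobian, Matrix.of_apply, pd, h1]
  rfl

theorem jacobian_comp {γ₁ γ₂ : Pt → Pt} {x : Pt} (h₁ : DifferentiableAt ℝ γ₁ (γ₂ x))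
    (h₂ : DifferentiableAt ℝ γ₂ x) :
    jacobian (γ₁ ∘ γ₂) x = jacobian γ₁ (γ₂ x) * jacobian γ₂ x := by
  ext α μ
  rw [jacobian_apply (h₁.comp x h₂), fderiv_comp x h₁ h₂, Matrix.mul_apply]
  simp only [jacobian_apply h₁, jacobian_apply h₂, ContinuousLinearMap.comp_apply]
  conv_lhs => rw [pi_eq_sum_univ' (fderiv ℝ γ₂ x (Pi.single μ 1))]
  simp [map_sum, mul_comm]

theorem uniqueDiffOn_closedWedge : UniqueDiffOn ℝ closedWedge := by
  refine uniqueDiffOn_convex ?_ ?_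
  · exact convex_halfSpace_ge (IsLinearMap.mk (fun _ _ => rfl) fun _ _ => rfl) 0
  · refine ⟨fun _ => 1, mem_interior.2 ⟨{x | 0 < x 1}, fun x hx => ?_, ?_, ?_⟩⟩
    · exact (show (0 : ℝ) < x 1 from hx).le
    · exact isOpen_lt continuous_const (continuous_apply 1)
    · simp

/-- The map is the identity only where `ρ ≥ 0`, its extension to `ρ < 0` being arbitrary. The
half-space is a set of unique differentiability, so the full derivative is still determined, even at
boundary points. -/
theorem jacobian_eq_one {γ : Pt → Pt} (h : Differentiable ℝ γ) (hid : ∀ x ∈ closedWedge, γ x = x)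
    {x : Pt} (hx : x ∈ closedWedge) : jacobian γ x = 1 := by
  have h1 : HasFDerivWithinAt γ (ContinuousLinearMap.id ℝ Pt) closedWedge x :=
    (hasFDerivWithinAt_id x closedWedge).congr hid (hid x hx)
  have h2 := (uniqueDiffOn_closedWedge x hx).eq (h x).hasFDerivAt.hasFDerivWithinAt h1
  ext α μ
  rw [jacobian_apply (h x), h2]
  simp [Matrix.one_apply, Pi.single_apply]

theorem IsFlow.det_ne_zero {η : Pt → Pt} {φ : ℝ → Pt → Pt} (h : IsFlow η φ) (hη : ContDiff ℝ ∞ η)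
    {x : Pt} (hx : x ∈ closedWedge) : (jacobian (φ 1) x).det ≠ 0 := by
  have hd : ∀ l, Differentiable ℝ (φ l) := fun l => (h.contDiff l).differentiable (by simp)
  have h1 := jacobian_eq_one ((hd (-1)).comp (hd 1))
    (fun y hy => h.apply_neg_one_apply_one hη hy) hx
  rw [jacobian_comp (hd _ _) (hd _ _)] at h1
  have h2 := congrArg Matrix.det h1
  rw [Matrix.det_mul, Matrix.det_one] at h2
  exact right_ne_zero_of_mul (h2.trans_ne one_ne_zero)

/-! ### Behaviour of a flow near the horizon. -/

section asymptotics
variable {η : Pt → Pt} {φ : ℝ → Pt → Pt} {W : Plane → ℝ} {R : Plane → Plane}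

theorem pt_mem_closedWedge {τ ρ : ℝ} (h : 0 ≤ ρ) (u : Plane) : pt τ ρ u ∈ closedWedge := by
  simpa [closedWedge, pt] using h

theorem InAlgebra.exists_decomp (h : InAlgebra W R η) : ∃ K : Pt → Pt, Continuous K ∧
    ∀ x, η x = leadField W R x + x 1 ^ 2 • K x := by
  choose k hk e using h.exists_rem
  refine ⟨fun x μ => k μ (0, x), continuous_pi fun μ =>
    (hk μ).continuous.comp (continuous_const.prodMk continuous_id), fun x => ?_⟩
  ext μ
  have := e μ (0, x)
  simp only [Pi.add_apply, Pi.smul_apply, smul_eq_mul]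
  dsimp only at this
  linarith

/-- The horizon is invariant. -/
theorem IsFlow.apply_horizon (h : IsFlow η φ) (hη : InAlgebra W R η) {x : Pt} (hx : x 1 = 0)
    {l : ℝ} (hl : l ∈ Icc (0 : ℝ) 1) : φ l x 1 = 0 := by
  obtain ⟨K, hK, e⟩ := hη.exists_decomp
  have hxc : x ∈ closedWedge := hx.ge
  have hc : Continuous fun l => φ l x :=
    h.smooth.continuous.comp (continuous_id.prodMk continuous_const)
  -- Since `η^ρ = ρ² K^ρ`, the `ρ` coordinate of the orbit satisfies a linear inequality with
  -- constant `M`, a bound for `ρ K^ρ` along the orbit, and it starts at zero.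
  obtain ⟨M, hM⟩ := (isCompact_Icc (a := (0 : ℝ)) (b := 1)).exists_bound_of_continuousOn
    (f := fun l => φ l x 1 * K (φ l x) 1)
    (((continuous_apply 1).comp hc).mul ((continuous_apply 1).comp (hK.comp hc))).continuousOn
  have := norm_le_of_norm_deriv_le (f := fun l => φ l x 1) (f' := fun l => η (φ l x) 1)
    (C := max M 1) (by positivity) le_rfl (fun l _ => hasDerivAt_pi.1 (h.ode x hxc l) 1)
    (by rw [h.init x hxc, hx]) (fun l hl => ?_) hl
  · simpa using this
  · have h1 : η (φ l x) 1 = (φ l x 1 * K (φ l x) 1) * φ l x 1 := by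
      rw [e]
      simp [leadField]; ring
    rw [add_zero, h1, norm_mul]
    exact mul_le_mul_of_nonneg_right ((hM l hl).trans (le_max_left _ _)) (norm_nonneg _)

theorem InAlgebra.apply_horizon (hη : InAlgebra W R η) {x : Pt} (hx : x 1 = 0) :
    η x = leadField W R x := by
  obtain ⟨K, -, e⟩ := hη.exists_decomp
  rw [e, hx]; simp

/-- On the horizon the flow commutes with translations of the time. -/
theorem IsFlow.apply_pt (h : IsFlow η φ) (hη : InAlgebra W R η) (τ : ℝ) (u : Plane) {l : ℝ}
    (hl : l ∈ Icc (0 : ℝ) 1) : φ l (pt τ 0 u) = φ l (pt 0 0 u) + Pi.single 0 τ := by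
  have hm : ∀ τ, pt τ 0 u ∈ closedWedge := fun τ => pt_mem_closedWedge le_rfl u
  refine eq_of_hasDerivAt (hη.smooth.of_le (by simp)) (f := fun l => φ l (pt τ 0 u))
    (g := fun l => φ l (pt 0 0 u) + Pi.single 0 τ) (fun l _ => h.ode _ (hm τ) l)
    (fun l hl => ?_) ?_ hl
  · have h0 := h.apply_horizon hη (x := pt 0 0 u) (by simp [pt]) hl
    have e : η (φ l (pt 0 0 u) + Pi.single 0 τ) = η (φ l (pt 0 0 u)) := by
      rw [hη.apply_horizon h0, hη.apply_horizon (by simp [h0])]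
      simp [leadField, horiz]
    rw [e]
    exact (h.ode _ (hm 0) l).add_const _
  · simp only [h.init _ (hm _)]
    ext μ
    fin_cases μ <;> simp [pt]

theorem pt_eq_add_single (τ ρ : ℝ) (u : Plane) : pt τ ρ u = pt τ 0 u + Pi.single 1 ρ := by
  ext μ
  fin_cases μ <;> simp [pt]

/-- The flow near the horizon, compared with the flow on the horizon. -/
theorem IsFlow.isBigO (h : IsFlow η φ) (hη : InAlgebra W R η) (τ : ℝ) (u : Plane) :
    (fun ρ : ℝ => φ 1 (pt τ ρ u) - (φ 1 (pt τ 0 u) + Pi.single 1 ρ)) =O[𝓝[>] 0]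
      fun ρ : ℝ => ρ ^ 2 := by
  obtain ⟨K, hK, e⟩ := hη.exists_decomp
  have hlead : ContDiff ℝ 1 (leadField W R) :=
    contDiff_pi.2 fun μ => (contDiff_leadField hη.smooth_W hη.smooth_R μ).of_le (by simp)
  have hcφ : ContDiff ℝ 1 fun z : ℝ × ℝ => φ z.1 (pt τ z.2 u) := by
    have hp : ContDiff ℝ 1 fun z : ℝ × ℝ => pt τ z.2 u := by
      rw [contDiff_pi]
      intro i
      fin_cases i <;> simp [pt] <;> fun_prop
    exact (h.smooth.of_le (by simp)).comp (contDiff_fst.prodMk hp)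
  obtain ⟨r, hr⟩ := ((isCompact_Icc (a := (0 : ℝ)) (b := 1)).prod
    (isCompact_Icc (a := (0 : ℝ)) (b := 1))).exists_bound_of_continuousOn
    hcφ.continuous.continuousOn
  obtain ⟨C₁, hC₁, hφL⟩ := exists_lipschitz_closedBall hcφ 1
  -- The radius `r + 1` leaves room for the shift by `ρ < 1` of a point of the orbit on the horizon.
  obtain ⟨C₂, hC₂, hL⟩ := exists_lipschitz_closedBall hlead (r + 1)
  obtain ⟨M, hM⟩ := (isCompact_closedBall (0 : Pt) r).exists_bound_of_continuousOn hK.continuousOn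
  have hM0 : 0 ≤ M := (norm_nonneg _).trans (hM _ (mem_closedBall_zero_iff.2
    (hr (0, 0) ⟨by simp, by simp⟩)))
  refine IsBigO.of_bound (Real.exp C₂ / C₂ * (C₁ ^ 2 * M)) ?_
  filter_upwards [Ioo_mem_nhdsGT one_pos] with ρ hρ
  have hm : ∀ ρ, 0 ≤ ρ → pt τ ρ u ∈ closedWedge := fun ρ h => pt_mem_closedWedge h u
  have h01 : ∀ l ∈ Icc (0 : ℝ) 1, ∀ s ∈ Icc (0 : ℝ) 1,
      (l, s) ∈ Metric.closedBall (0 : ℝ × ℝ) 1 := fun l hl s hs => by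
    rw [mem_closedBall_zero_iff, Prod.norm_def]
    simp only [Real.norm_eq_abs, abs_of_nonneg hl.1, abs_of_nonneg hs.1]
    exact max_le hl.2 hs.2
  have hρI : ρ ∈ Icc (0 : ℝ) 1 := ⟨hρ.1.le, hρ.2.le⟩
  have := norm_le_of_norm_deriv_le (f := fun l => φ l (pt τ ρ u) - (φ l (pt τ 0 u) + Pi.single 1 ρ))
    (f' := fun l => η (φ l (pt τ ρ u)) - η (φ l (pt τ 0 u))) (C := C₂) (ε := C₁ ^ 2 * M * ρ ^ 2)
    hC₂ (by positivity) (fun l _ => (h.ode _ (hm ρ hρ.1.le) l).fun_sub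
      ((h.ode _ (hm 0 le_rfl) l).add_const _)) ?_ (fun l hl => ?_) (l := 1) (by simp)
  · refine this.trans_eq ?_
    rw [Real.norm_eq_abs, abs_of_nonneg (by positivity)]; ring
  · simp only [h.init _ (hm _ hρ.1.le), h.init _ (hm 0 le_rfl)]
    rw [pt_eq_add_single, sub_self]
  · have h0 := h.apply_horizon hη (x := pt τ 0 u) (by simp [pt]) hl
    set X := φ l (pt τ ρ u)
    set Y := φ l (pt τ 0 u)
    have hX : ‖X‖ ≤ r := hr (l, ρ) ⟨hl, hρI⟩
    have hY : ‖Y‖ ≤ r := hr (l, 0) ⟨hl, by simp⟩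
    have hXY : ‖X - Y‖ ≤ C₁ * ρ := by
      have := hφL (l, ρ) (h01 l hl ρ hρI) (l, 0) (h01 l hl 0 (by simp))
      simpa [Prod.norm_def, abs_of_pos hρ.1, hρ.1.le] using this
    have hX1 : |X 1| ≤ C₁ * ρ := by
      have := (norm_le_pi_norm (X - Y) 1).trans hXY
      simpa [h0] using this
    -- The leading field does not see the shift by `ρ`, so its increment is bounded by the quantity
    -- under estimation, `X - (Y + ρ e_ρ)`, and not by `X - Y`, which is only `O(ρ)`.
    have hlY : leadField W R (Y + Pi.single 1 ρ) = leadField W R Y := by simp [leadField, horiz]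
    have hYρ : ‖Y + Pi.single 1 ρ‖ ≤ r + 1 := (norm_add_le _ _).trans
      (add_le_add hY (by simpa [Pi.norm_single, abs_of_pos hρ.1] using hρ.2.le))
    rw [hη.apply_horizon h0, e X, add_sub_right_comm, ← hlY]
    refine (norm_add_le _ _).trans (add_le_add ?_ ?_)
    · exact hL _ (mem_closedBall_zero_iff.2 (by linarith)) _ (mem_closedBall_zero_iff.2 hYρ)
    · rw [norm_smul, Real.norm_eq_abs, abs_pow]
      calc |X 1| ^ 2 * ‖K X‖ ≤ (C₁ * ρ) ^ 2 * M := by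
            gcongr
            exact hM _ (mem_closedBall_zero_iff.2 hX)
        _ = C₁ ^ 2 * M * ρ ^ 2 := by ring

/-- The exponential of a field of the algebra. -/
theorem IsFlow.isGamma (h : IsFlow η φ) (hη : InAlgebra W R η) :
    IsGamma (fun u => φ 1 (pt 0 0 u) 0) (fun u => horiz (φ 1 (pt 0 0 u))) (φ 1) where
  smooth_P := contDiff_pi.1 ((h.contDiff 1).comp contDiff_pt_zero) 0
  smooth_G := contDiff_horiz.comp ((h.contDiff 1).comp contDiff_pt_zero)
  smooth := h.contDiff 1
  bijOn := h.bijOn hη.smooth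
  regular x hx := h.det_ne_zero hη.smooth hx
  asymp μ τ u := by
    refine (isBigO_pi.1 (h.isBigO hη τ u) μ).congr_left fun ρ => ?_
    have h0 := h.apply_horizon hη (x := pt 0 0 u) (l := 1) (by simp [pt]) (by simp)
    rw [h.apply_pt hη τ u (by simp)]
    have e : leadMap (fun u => φ 1 (pt 0 0 u) 0) (fun u => horiz (φ 1 (pt 0 0 u))) (pt τ ρ u)
        = φ 1 (pt 0 0 u) + Pi.single 0 τ + Pi.single 1 ρ := by
      simp only [leadMap, horiz_pt]
      generalize φ 1 (pt 0 0 u) = y at h0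
      ext ν
      fin_cases ν <;> simp [pt, horiz, h0, add_comm]
    dsimp only
    rw [e]; rfl

end asymptotics

/-! ### Composition of diffeomorphisms. -/

section comp
variable {P₁ P₂ : Plane → ℝ} {G₁ G₂ : Plane → Plane} {γ₁ γ₂ : Pt → Pt}

/-- The leading maps compose exactly. The error of `γ₂` passes through `γ₁` because a strictly
differentiable map is Lipschitz near the common limit point on the horizon; the error of `γ₁` is
evaluated on the curve `ρ ↦ (τ + P₂, ρ, G₂)`. -/
theorem IsGamma.comp (h₁ : IsGamma P₁ G₁ γ₁) (h₂ : IsGamma P₂ G₂ γ₂) :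
    IsGamma (fun u => P₂ u + P₁ (G₂ u)) (G₁ ∘ G₂) (γ₁ ∘ γ₂) where
  smooth_P := h₂.smooth_P.add (h₁.smooth_P.comp h₂.smooth_G)
  smooth_G := h₁.smooth_G.comp h₂.smooth_G
  smooth := h₁.smooth.comp h₂.smooth
  bijOn := h₁.bijOn.comp h₂.bijOn
  regular x hx := by
    show (jacobian (γ₁ ∘ γ₂) x).det ≠ 0
    rw [jacobian_comp (h₁.smooth.differentiable (by simp) _)
      (h₂.smooth.differentiable (by simp) _), Matrix.det_mul]
    exact mul_ne_zero (h₁.regular _ (h₂.bijOn.mapsTo hx)) (h₂.regular x hx)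
  asymp μ τ u := by
    have hl : ∀ ρ, leadMap P₂ G₂ (pt τ ρ u) = pt (τ + P₂ u) ρ (G₂ u) := fun ρ => by
      simp only [leadMap, horiz_pt]; simp [pt]
    have e : ∀ ρ, leadMap (fun u => P₂ u + P₁ (G₂ u)) (G₁ ∘ G₂) (pt τ ρ u)
        = leadMap P₁ G₁ (pt (τ + P₂ u) ρ (G₂ u)) := fun ρ => by
      simp only [leadMap, horiz_pt]; simp [pt, add_assoc]
    have h2 : (fun ρ : ℝ => γ₂ (pt τ ρ u) - pt (τ + P₂ u) ρ (G₂ u)) =O[𝓝[>] 0]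
        fun ρ : ℝ => ρ ^ 2 := by
      simp only [← hl]
      exact isBigO_pi.2 fun ν => h₂.asymp ν τ u
    have t0 : γ₂ (pt τ 0 u) = pt (τ + P₂ u) 0 (G₂ u) := by
      rw [← hl]; ext ν; exact h₂.apply_horizon (by simp [pt]) ν
    have t1 : Tendsto (fun ρ => γ₂ (pt τ ρ u)) (𝓝[>] 0) (𝓝 (pt (τ + P₂ u) 0 (G₂ u))) :=
      ((h₂.smooth.continuous.comp (continuous_pt τ u)).tendsto' 0 _ t0).mono_left
        nhdsWithin_le_nhds
    have t2 : Tendsto (fun ρ => pt (τ + P₂ u) ρ (G₂ u)) (𝓝[>] 0) (𝓝 (pt (τ + P₂ u) 0 (G₂ u))) :=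
      ((continuous_pt _ _).tendsto 0).mono_left nhdsWithin_le_nhds
    have hs := (h₁.smooth.contDiffAt (x := pt (τ + P₂ u) 0 (G₂ u))).hasStrictFDerivAt (by simp)
    have h3 := (hs.isBigO_sub.comp_tendsto (t1.prodMk_nhds t2)).trans h2
    refine ((isBigO_pi.1 h3 μ).add (h₁.asymp μ (τ + P₂ u) (G₂ u))).congr_left fun ρ => ?_
    simp [e, Function.comp]

end comp

theorem Generated.exists_isGamma {γ : Pt → Pt} (h : Generated γ) : ∃ P G, IsGamma P G γ := by
  induction h with
  | exp η φ hη hφ =>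
    obtain ⟨W, R, hη⟩ := hη
    exact ⟨_, _, hφ.isGamma hη⟩
  | comp γ₁ γ₂ _ _ ih₁ ih₂ =>
    obtain ⟨P₁, G₁, h₁⟩ := ih₁
    obtain ⟨P₂, G₂, h₂⟩ := ih₂
    exact ⟨_, _, h₁.comp h₂⟩

end Rindler

end

theorem mainTheorem6 (κ Gn : ℝ) (hκ : 0 < κ) (hG : 0 < Gn) :
    -- the fields form a closed algebra
    (∀ (W W' : Plane → ℝ) (R R' : Plane → Plane) (U U' : Pt → Pt),
      InAlgebra W R U → InAlgebra W' R' U' →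
      (∀ a b : ℝ, InAlgebra (a • W + b • W') (a • R + b • R') (a • U + b • U')) ∧
      InAlgebra (fun u => along R W' u - along R' W u)
        (fun u A => along R (fun v => R' v A) u - along R' (fun v => R v A) u)
        (VectorField.lieBracket ℝ U U') ∧
      (HorizontallyBounded U → HorizontallyBounded U' →
        HorizontallyBounded (VectorField.lieBracket ℝ U U'))) ∧
    -- the bracket of a supertranslation and a superrotation
    (∀ (W : Plane → ℝ) (R : Plane → Plane) (U₁ U₂ : Pt → Pt),
      InAlgebra W 0 U₁ → InAlgebra 0 R U₂ →
      InAlgebra (fun u => -along R W u) 0 (VectorField.lieBracket ℝ U₁ U₂)) ∧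
    -- the diffeomorphisms generated by the algebra
    (∀ γ : Pt → Pt, Generated γ → ∃ P G, IsGamma P G γ) ∧
    -- the integrability condition
    (∀ (P : Plane → ℝ) (G : Plane → Plane) (γ ξ η χ : Pt → Pt), IsGamma P G γ →
      ξ ∈ algebraB → η ∈ algebraB → χ ∈ algebraB → HorizontallyBounded ξ →
      ∀ τ : ℝ, HasHorizonIntegral
        (obstruction Gn (metricOf κ γ) (lieDeriv η (metricOf κ γ)) ξ χ) τ 0) ∧
    -- the charges, as functions on the set of metrics
    (∃ H : (Pt → Pt) → Tensor2 → ℝ,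
      (∀ (W : Plane → ℝ) (R : Plane → Plane) (ξ : Pt → Pt), InAlgebra W R ξ →
        HorizontallyBounded ξ →
        -- they are given by the charge formula
        (∀ (P : Plane → ℝ) (G : Plane → Plane) (γ : Pt → Pt), IsGamma P G γ →
          H ξ (metricOf κ γ) = chargeST κ Gn G W + chargeSR κ Gn P G R) ∧
        -- their variation along every path of metrics is the prescribed one
        (∀ (I : Set ℝ) (P : ℝ → Plane → ℝ) (G : ℝ → Plane → Plane) (γ : ℝ → Pt → Pt),
          IsGammaPath I P G γ →
          (∀ l ∈ I, ∃ F : ℝ, HasDerivAt (fun l' => H ξ (metricOf κ (γ l'))) F l ∧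
            ∀ τ : ℝ, HasHorizonIntegral
              (chargeVariation Gn (fun l' => metricOf κ (γ l')) ξ l) τ F) ∧
          (∀ a b : ℝ, uIcc a b ⊆ I → ∃ F : ℝ → ℝ,
            (∀ l ∈ uIcc a b, ∀ τ : ℝ, HasHorizonIntegral
              (chargeVariation Gn (fun l' => metricOf κ (γ l')) ξ l) τ (F l)) ∧
            IntervalIntegrable F volume a b ∧
            ∫ l in a..b, F l = H ξ (metricOf κ (γ b)) - H ξ (metricOf κ (γ a)))) ∧
        -- they are the integral of the variation along the path with `(lP, lG)`, `0 < l ≤ 1`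
        (∀ (I : Set ℝ) (P : Plane → ℝ) (G : Plane → Plane) (γ : ℝ → Pt → Pt),
          Ioc 0 1 ⊆ I → IsGammaPath I (fun l => l • P) (fun l => l • G) γ →
          ∃ F : ℝ → ℝ,
            (∀ l ∈ Ioc (0 : ℝ) 1, ∀ τ : ℝ, HasHorizonIntegral
              (chargeVariation Gn (fun l' => metricOf κ (γ l')) ξ l) τ (F l)) ∧
            IntervalIntegrable F volume 0 1 ∧
            ∫ l in (0 : ℝ)..1, F l = H ξ (metricOf κ (γ 1)))) ∧
      -- the charges of supertranslations
      (∀ (W : Plane → ℝ) (U₁ : Pt → Pt), InAlgebra W 0 U₁ → HorizontallyBounded U₁ →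
        ∀ (P : Plane → ℝ) (G : Plane → Plane) (γ : Pt → Pt), IsGamma P G γ →
          H U₁ (metricOf κ γ)
            = κ / (8 * Real.pi * Gn) * ∫ u : Plane, Real.sqrt (Ldet G u) * W u) ∧
      -- the charges of superrotations
      (∀ (R : Plane → Plane) (U₂ : Pt → Pt), InAlgebra 0 R U₂ → HorizontallyBounded U₂ →
        ∀ (P : Plane → ℝ) (G : Plane → Plane) (γ : Pt → Pt), IsGamma P G γ →
          H U₂ (metricOf κ γ)
            = -(1 / (8 * Real.pi * Gn * κ)) *
              ∫ u : Plane, Real.sqrt (Ldet G u) * ∑ A, R u A * L1 κ P A u)) := by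
  -- The witness for `H` is the horizon limit of `∮ Q` at `τ = 0`. It is defined from the metric
  -- alone, so its value does not depend on the `γ` chosen to represent that metric.
  refine ⟨fun W W' R R' U U' h h' => ⟨h.linear_combination h', h.lieBracket h',
      HorizontallyBounded.lieBracket⟩,
    fun W R U₁ U₂ => InAlgebra.lieBracket_supertranslation_superrotation,
    fun γ h => h.exists_isGamma, ?_, noetherCharge Gn, ?_, ?_, ?_⟩
  · rintro P G γ ξ η χ h ⟨W, R, hξ⟩ hη hχ hb τ
    -- A single diffeomorphism is treated as a constant path over `ℝ`, evaluated at the parameter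
    -- `0`.
    exact h.toPath.hasHorizonIntegral_obstruction hκ hξ hb hη hχ (mem_univ 0) τ
  · intro W R ξ hξ hb
    refine ⟨fun P G γ h => h.toPath.noetherCharge_eq hκ hξ hb (mem_univ 0),
      fun I P G γ h => ⟨fun l hl => ⟨_, h.hasDerivAt_noetherCharge hκ hξ hb hl,
        h.hasHorizonIntegral_chargeVariation hκ hξ hb hl⟩, fun a b hab => ?_⟩,
      fun I P G γ hI h => h.integral_scaling hI hκ hξ hb⟩
    exact ⟨_, fun l hl => h.hasHorizonIntegral_chargeVariation hκ hξ hb (hab hl),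
      h.integral_hairDeriv hκ hξ hb hab⟩
  · intro W U₁ hU hb P G γ h
    rw [h.toPath.noetherCharge_eq hκ hU hb (mem_univ 0)]
    simp [chargeST, chargeSR]
  · intro R U₂ hU hb P G γ h
    rw [h.toPath.noetherCharge_eq hκ hU hb (mem_univ 0)]
    simp [chargeST, chargeSR]
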